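/- Let $F$ be a field of characteristic different from $2$ and $3$ containing a primitive third root of unity $\rho$, let $r,t,e,\alpha,\beta,\gamma,\delta\in F$, and let $$\Phi(z,a,b)=z^3-rbz^2-(eab+tb^2)z-f_3(a,b),\qquad f_3(a,b)=\alpha a^3+\beta a^2b+\gamma ab^2+\delta b^3 .$$ The Pappacena–Clifford algebra $C_\Phi$ is the associative $F$-algebra generated by $x,y$ subject to the relations $$(ax+by)^3=rb\,(ax+by)^2+(eab+tb^2)(ax+by)+f_3(a,b)\qquad\text{for all } a,b\in F .$$ Assume that $F[X]/(X^3-\alpha)$ is a field (so $\alpha\neq 0$, and in $C_\Phi$ one has $x^3=\alpha$). Put $$D_1=\gamma+\frac{er}{3}-\frac{\beta^2}{3\alpha},\qquad D_2=e\beta-3\alpha t-\alpha r^2,\qquad D=\frac{e^3}{27\alpha}+\frac{\beta^3}{27\alpha^2}-\frac{2r^3}{27}+\frac{\beta}{3\alpha}D_1-\frac{rt}{3}-\delta ,$$ $$y_k=\tfrac13\left(y+\rho^kxyx^{-1}+\rho^{2k}x^2yx^{-2}\right)\ (k=1,2),\qquad w=x^{-1}y_2y_1+\rho^2\frac{D_1}{3\alpha}x+\frac{D_2}{9\alpha}x^{-1},$$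 and let $E$ be the affine plane curve with coordinates $(R,S)$ $$E\colon\ (D-\rho^2eR)S+S^2+\alpha R^3-\frac{D_1^3}{27\alpha}-\frac{D_2^3}{729\alpha^3}-\rho^2\frac{D_1D_2}{9\alpha}R=0 .$$ Assume that $D\neq 0$ and that $E$ is an (affine) elliptic curve, i.e. that the discriminant of its Weierstrass form, obtained by the substitution $X=-\alpha R$, $Y=\alpha S$, is nonzero. For a field $K\supseteq F$ and $a,b\in K$ write $(a,b)_{3,K}=K[u,v: u^3=a,\ v^3=b,\ vu=\rho uv]$. Then: 1. $C_\Phi$ is an Azumaya algebra of constant rank $9$ over its center $Z$. 2. $Z=F[y_1^3,w]$, and there is an isomorphism of $F$-algebras from the coordinate ring $F[E]$ onto $Z$ that maps $R$ to $w$ and $S$ to $y_1^3$. 3. Let $\bar F$ be an algebraic closure of $F$. There is a bijection between the orbits of $\mathrm{Aut}(\bar F/F)$ on the $\bar F$-points of $E$ and the simple homomorphic images (simple quotient algebras) of $C_\Phi$ such that, for every $\bar F$-point $(R_0,S_0)$ of $E$, with $K=F(R_0,S_0)$, the image corresponding to the orbit of $(R_0,S_0)$ is isomorphic as an $F$-algebra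 to the algebra $(\alpha,S_0)_{3,K}$ if $S_0\neq0$, and to $(\rho^2eR_0-D,\alpha)_{3,K}$ if $S_0=0$; this algebra is central simple of degree $3$ over $K$, and the isomorphism can be chosen to map the images of $w$ and $y_1^3$ to $R_0$ and $S_0$. -/

import Mathlib

namespace CubicClifford

/-- The defining relations of the Clifford algebra of the monic polynomial
`z ^ d - ∑_{1 ≤ k ≤ d} f_k(a_1, …, a_n) z ^ (d - k)`: one relation for every `a ∈ F ^ n`,
obtained by substituting `a_1 x_1 + ⋯ + a_n x_n` for `z`. -/
inductive PappacenaRel (F : Type*) [Field F] (n d : ℕ) (f : ℕ → MvPolynomial (Fin n) F) :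
    FreeAlgebra F (Fin n) → FreeAlgebra F (Fin n) → Prop
  | rel (a : Fin n → F) : PappacenaRel F n d f
      ((∑ i, a i • FreeAlgebra.ι F i) ^ d)
      (∑ k ∈ Finset.Icc 1 d,
        MvPolynomial.eval a (f k) • (∑ i, a i • FreeAlgebra.ι F i) ^ (d - k))

/-- The Pappacena–Clifford algebra of `z ^ d - ∑_{1 ≤ k ≤ d} f_k(a_1, …, a_n) z ^ (d - k)`.
Only the values `f 1, …, f d` matter. -/
abbrev PappacenaClifford (F : Type*) [Field F] (n d : ℕ) (f : ℕ → MvPolynomial (Fin n) F) :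
    Type _ :=
  RingQuot (PappacenaRel F n d f)

/-- The coefficients of
`Φ(z, a, b) = z³ - r b z² - (e a b + t b²) z - (α a³ + β a² b + γ a b² + δ b³)`. -/
structure Coeffs (F : Type*) where
  (r t e α β γ δ : F)

namespace Coeffs

variable {F : Type*} [Field F] (Φ : Coeffs F) (ρ : F)

/-- The binary forms `f_1, f_2, f_3` of `Φ = z³ - f_1 z² - f_2 z - f_3`, in the variables
`a = X 0` and `b = X 1`. -/
noncomputable def form : ℕ → MvPolynomial (Fin 2) F
  | 1 => MvPolynomial.C Φ.r * MvPolynomial.X 1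
  | 2 => MvPolynomial.C Φ.e * MvPolynomial.X 0 * MvPolynomial.X 1
      + MvPolynomial.C Φ.t * MvPolynomial.X 1 ^ 2
  | 3 => MvPolynomial.C Φ.α * MvPolynomial.X 0 ^ 3
      + MvPolynomial.C Φ.β * MvPolynomial.X 0 ^ 2 * MvPolynomial.X 1
      + MvPolynomial.C Φ.γ * MvPolynomial.X 0 * MvPolynomial.X 1 ^ 2
      + MvPolynomial.C Φ.δ * MvPolynomial.X 1 ^ 3
  | _ => 0

/-- The algebra `C_Φ`. -/
abbrev Alg : Type _ := PappacenaClifford F 2 3 Φ.form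

/-- The generator `x` of `C_Φ`. -/
noncomputable def x : Φ.Alg :=
  RingQuot.mkAlgHom F (PappacenaRel F 2 3 Φ.form) (FreeAlgebra.ι F 0)

/-- The generator `y` of `C_Φ`. -/
noncomputable def y : Φ.Alg :=
  RingQuot.mkAlgHom F (PappacenaRel F 2 3 Φ.form) (FreeAlgebra.ι F 1)

theorem x_pow_three : Φ.x ^ 3 = algebraMap F Φ.Alg Φ.α := by
  have h := RingQuot.mkAlgHom_rel F (PappacenaRel.rel (F := F) (n := 2) (d := 3) (f := Φ.form)
    ![1, 0])
  simpa [x, form, Finset.sum_Icc_succ_top, Algebra.algebraMap_eq_smul_one] using h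

/-- `x⁻¹ = α⁻¹ x²`, as `x³ = α` in `C_Φ`. -/
noncomputable def xInv : Φ.Alg := Φ.α⁻¹ • Φ.x ^ 2

theorem x_mul_xInv (hα : Φ.α ≠ 0) : Φ.x * Φ.xInv = 1 := by
  rw [xInv, mul_smul_comm, ← pow_succ', x_pow_three, Algebra.algebraMap_eq_smul_one, smul_smul,
    inv_mul_cancel₀ hα, one_smul]

/-- The components `y_k = (y + ρ^k x y x⁻¹ + ρ^(2k) x² y x⁻²) / 3` of `y = y_0 + y_1 + y_2`,
which satisfy `y_k x = ρ^k x y_k`. -/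
noncomputable def yComp (k : ℕ) : Φ.Alg :=
  (3 : F)⁻¹ • (Φ.y + ρ ^ k • (Φ.x * Φ.y * Φ.xInv)
    + ρ ^ (2 * k) • (Φ.x ^ 2 * Φ.y * Φ.xInv ^ 2))

/-- `D_1 = γ + e r / 3 - β² / (3 α)`. -/
def D₁ : F := Φ.γ + Φ.e * Φ.r / 3 - Φ.β ^ 2 / (3 * Φ.α)

/-- `D_2 = e β - 3 α t - α r²`. -/
def D₂ : F := Φ.e * Φ.β - 3 * Φ.α * Φ.t - Φ.α * Φ.r ^ 2

/-- `D = e³/(27 α) + β³/(27 α²) - 2 r³/27 + β D_1/(3 α) - r t/3 - δ`. -/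
def D : F :=
  Φ.e ^ 3 / (27 * Φ.α) + Φ.β ^ 3 / (27 * Φ.α ^ 2) - 2 * Φ.r ^ 3 / 27
    + Φ.β / (3 * Φ.α) * Φ.D₁ - Φ.r * Φ.t / 3 - Φ.δ

/-- The central element `w = x⁻¹ y_2 y_1 + ρ² D_1/(3 α) x + D_2/(9 α) x⁻¹`. -/
noncomputable def w : Φ.Alg :=
  Φ.xInv * Φ.yComp ρ 2 * Φ.yComp ρ 1
    + (ρ ^ 2 * Φ.D₁ / (3 * Φ.α)) • Φ.x + (Φ.D₂ / (9 * Φ.α)) • Φ.xInv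

/-- The polynomial in `R = X 0` and `S = X 1` that defines the affine curve `E`:
`(D - ρ² e R) S + S² + α R³ - D_1³/(27 α) - D_2³/(729 α³) - ρ² D_1 D_2/(9 α) R`. -/
noncomputable def curve : MvPolynomial (Fin 2) F :=
  (MvPolynomial.C Φ.D - MvPolynomial.C (ρ ^ 2 * Φ.e) * MvPolynomial.X 0) * MvPolynomial.X 1
    + MvPolynomial.X 1 ^ 2 + MvPolynomial.C Φ.α * MvPolynomial.X 0 ^ 3
    - MvPolynomial.C (Φ.D₁ ^ 3 / (27 * Φ.α)) - MvPolynomial.C (Φ.D₂ ^ 3 / (729 * Φ.α ^ 3))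
    - MvPolynomial.C (ρ ^ 2 * Φ.D₁ * Φ.D₂ / (9 * Φ.α)) * MvPolynomial.X 0

/-- The Weierstrass form of `E`, in the coordinates `X = -α R`, `Y = α S`. -/
def weierstrass : WeierstrassCurve F where
  a₁ := ρ ^ 2 * Φ.e
  a₂ := 0
  a₃ := Φ.α * Φ.D
  a₄ := -(ρ ^ 2 * Φ.D₁ * Φ.D₂ / 9)
  a₆ := Φ.α * Φ.D₁ ^ 3 / 27 + Φ.D₂ ^ 3 / (729 * Φ.α)

/-- The equation of `E` and its Weierstrass form agree under `X = -α R`, `Y = α S`. -/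
theorem weierstrass_equation_iff (hα : Φ.α ≠ 0) (R S : F) :
    (Φ.weierstrass ρ).toAffine.Equation (-(Φ.α * R)) (Φ.α * S) ↔
      MvPolynomial.eval ![R, S] (Φ.curve ρ) = 0 := by
  have h : (Φ.α * S) ^ 2 + ρ ^ 2 * Φ.e * (-(Φ.α * R)) * (Φ.α * S) + Φ.α * Φ.D * (Φ.α * S)
      - ((-(Φ.α * R)) ^ 3 + 0 * (-(Φ.α * R)) ^ 2
        + -(ρ ^ 2 * Φ.D₁ * Φ.D₂ / 9) * (-(Φ.α * R))
        + (Φ.α * Φ.D₁ ^ 3 / 27 + Φ.D₂ ^ 3 / (729 * Φ.α)))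
      = Φ.α ^ 2 * MvPolynomial.eval ![R, S] (Φ.curve ρ) := by
    have e1 : Φ.α * Φ.D₁ ^ 3 / 27 = Φ.α ^ 2 * (Φ.D₁ ^ 3 / (27 * Φ.α)) := by
      rw [← div_div, mul_div_assoc, pow_two, mul_assoc, mul_div_cancel₀ _ hα]
    have e2 : Φ.D₂ ^ 3 / (729 * Φ.α) = Φ.α ^ 2 * (Φ.D₂ ^ 3 / (729 * Φ.α ^ 3)) := by
      rw [← div_div, ← div_div]
      field_simp
    have e3 : ρ ^ 2 * Φ.D₁ * Φ.D₂ / 9 * Φ.α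
        = Φ.α ^ 2 * (ρ ^ 2 * Φ.D₁ * Φ.D₂ / (9 * Φ.α)) := by
      rw [← div_div]
      field_simp
    simp only [curve, map_add, map_sub, map_mul, map_pow, MvPolynomial.eval_C,
      MvPolynomial.eval_X, Matrix.cons_val_zero, Matrix.cons_val_one]
    linear_combination -e1 - e2 - R * e3
  rw [WeierstrassCurve.Affine.equation_iff, ← sub_eq_zero]
  change (Φ.α * S) ^ 2 + ρ ^ 2 * Φ.e * (-(Φ.α * R)) * (Φ.α * S) + Φ.α * Φ.D * (Φ.α * S)
      - ((-(Φ.α * R)) ^ 3 + 0 * (-(Φ.α * R)) ^ 2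
        + -(ρ ^ 2 * Φ.D₁ * Φ.D₂ / 9) * (-(Φ.α * R))
        + (Φ.α * Φ.D₁ ^ 3 / 27 + Φ.D₂ ^ 3 / (729 * Φ.α))) = 0 ↔ _
  rw [h, mul_eq_zero, or_iff_right (pow_ne_zero 2 hα)]

/-- The coordinate ring `F[E]` of the affine curve `E`. -/
abbrev CoordRing : Type _ := MvPolynomial (Fin 2) F ⧸ Ideal.span {Φ.curve ρ}

/-- The coordinate functions `R` (for `i = 0`) and `S` (for `i = 1`) in `F[E]`. -/
noncomputable def coord (i : Fin 2) : Φ.CoordRing ρ :=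
  Ideal.Quotient.mk _ (MvPolynomial.X i)

/-- The points `(R_0, S_0)` of the affine curve `E` over an algebraic closure of `F`. -/
def Point : Type _ :=
  {P : Fin 2 → AlgebraicClosure F // MvPolynomial.aeval P (Φ.curve ρ) = 0}

/-- The coordinatewise action of the automorphisms of the algebraic closure over `F`. -/
noncomputable instance : MulAction Gal(AlgebraicClosure F/F) (Φ.Point ρ) where
  smul σ P := ⟨fun i => σ (P.1 i), by
    have h : MvPolynomial.aeval (fun i => σ (P.1 i))
        = (σ : AlgebraicClosure F →ₐ[F] AlgebraicClosure F).comp (MvPolynomial.aeval P.1) := by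
      ext i
      simp
    rw [h, AlgHom.comp_apply, P.2, map_zero]⟩
  one_smul _ := rfl
  mul_smul _ _ _ := rfl

end Coeffs

/-- The relations `u^n = a`, `v^n = b`, `v u = ρ u v`, where `u = ι 0` and `v = ι 1`. -/
inductive SymbolRel (K : Type*) [Field K] (n : ℕ) (ρ a b : K) :
    FreeAlgebra K (Fin 2) → FreeAlgebra K (Fin 2) → Prop
  | left : SymbolRel K n ρ a b (FreeAlgebra.ι K 0 ^ n) (algebraMap K _ a)
  | right : SymbolRel K n ρ a b (FreeAlgebra.ι K 1 ^ n) (algebraMap K _ b)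
  | comm : SymbolRel K n ρ a b (FreeAlgebra.ι K 1 * FreeAlgebra.ι K 0)
      (ρ • (FreeAlgebra.ι K 0 * FreeAlgebra.ι K 1))

/-- The symbol algebra `(a, b)_{n, K} = K[u, v : u^n = a, v^n = b, v u = ρ u v]`. -/
abbrev SymbolAlgebra (K : Type*) [Field K] (n : ℕ) (ρ a b : K) : Type _ :=
  RingQuot (SymbolRel K n ρ a b)

/-- `A` is a central simple `K`-algebra of degree `n`. -/
def IsCentralSimpleOfDegree (K A : Type*) [Field K] [Ring A] [Algebra K A] (n : ℕ) : Prop :=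
  Algebra.IsCentral K A ∧ IsSimpleRing A ∧ FiniteDimensional K A ∧ Module.finrank K A = n ^ 2

/-- The simple homomorphic images of a ring `A`, i.e. its simple quotients, recorded by the
kernel of the quotient map. -/
def SimpleImage (A : Type*) [Ring A] : Type _ :=
  {I : TwoSidedIdeal A // IsSimpleRing I.ringCon.Quotient}

namespace Coeffs

variable {F : Type*} [Field F] (Φ : Coeffs F) (ρ : F) (P : Φ.Point ρ)

/-- The field `F(R_0, S_0)` generated by the coordinates of a point `(R_0, S_0)` of `E`. -/
noncomputable abbrev pointField : IntermediateField F (AlgebraicClosure F) :=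
  IntermediateField.adjoin F (Set.range P.1)

/-- The coordinates `R_0` (for `i = 0`) and `S_0` (for `i = 1`) as elements of `F(R_0, S_0)`. -/
noncomputable def pointCoord (i : Fin 2) : Φ.pointField ρ P :=
  ⟨P.1 i, IntermediateField.subset_adjoin F _ (Set.mem_range_self i)⟩

/-- The simple image `C_Φ / I` is the `F(R_0, S_0)`-central simple algebra
`(a, b)_{3, F(R_0, S_0)}`, compatibly with the point: the images of the central elements `w` and
`y_1³` are `R_0` and `S_0`. -/
def ImageIsSymbol (I : SimpleImage Φ.Alg) (a b : Φ.pointField ρ P) : Prop :=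
  IsCentralSimpleOfDegree (Φ.pointField ρ P)
      (SymbolAlgebra (Φ.pointField ρ P) 3 (algebraMap F _ ρ) a b) 3 ∧
    ∃ ψ : I.1.ringCon.Quotient ≃ₐ[F]
        SymbolAlgebra (Φ.pointField ρ P) 3 (algebraMap F _ ρ) a b,
      ψ (I.1.ringCon.mk' (Φ.w ρ)) = algebraMap (Φ.pointField ρ P) _ (Φ.pointCoord ρ P 0) ∧
      ψ (I.1.ringCon.mk' (Φ.yComp ρ 1 ^ 3)) =
        algebraMap (Φ.pointField ρ P) _ (Φ.pointCoord ρ P 1)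

end Coeffs

end CubicClifford

/-! Conjugation by `x` splits `y` into eigencomponents `y₀ + y₁ + y₂`. Write `c₁ = wCoeff₁`, `c₂ =
wCoeff₂` and `q(x) = w x - c₁ x² - c₂`. The `a²b` part of the Clifford relation makes `y₀` a
polynomial in `x`. Given the definition of `w`, which says `y₂ y₁ = q(x)`, the `ab²` part becomes
`y₁ y₂ = q(ρx)`, and this makes `w` central. The `b³` part becomes `y₁³ + y₂³ = ρ² e w - D`. So
`C_Φ` is governed by the relations collected in `IsFrame`: they hold in it (`isFrame`), and any
elements satisfying them are the image of a homomorphism (`IsFrame.exists_algHom`).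

The cubes `S = y₁³` and `S' = y₂³` are central. Their sum is `ρ² e w - D` and their product is the
norm `q(x) q(ρx) q(ρ²x) = α w³ - α² c₁³ - c₂³ - 3α c₁ c₂ w`; eliminating `S'` gives the equation of
`E`. Where `S` is invertible the algebra looks like the symbol algebra on `x, y₁`, and where `S'` is
invertible like the one on `y₂, x`. These two charts cover `E` (`exists_mul_add_mul_eq_one`): at a
common zero of `S` and `S'` one has `ρ² e R = D ≠ 0`, so `R` is a nonzero element of `F`, and the
norm from `F(∛α)` of a nonzero element would vanish.

In each chart the sum of conjugates by the monomials `x^i y_k^j` (`conjSum`) is a multiple of the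
reduced trace. The two sums take the values `κ · 9αS` and `κ · 9αS'` with a common `κ` from `F[E]`,
so they glue. The glued trace identifies the center (`toCenter_surjective`), provides dual bases and
hence the Azumaya property and the rank (`isAzumaya_and_rankAtStalk`), and shows that two-sided
ideals are determined by their intersection with the center (`le_of_forall_center`).

Each point of `E` over a field carries a frame in its symbol algebra (`exists_algHom_symbol`).
Evaluating at all points makes `F[E] → Z` injective. Simple images then correspond to maximal ideals
of `F[E]`, that is, by the Nullstellensatz, to Galois orbits of points. -/

namespace CubicClifford

/-! ### The Clifford relation in terms of the eigencomponents of `y` -/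

section Identities

variable {k B : Type*} [CommRing k] [Ring B] [Algebra k B]

/-- The `a b²`-coefficient of the Clifford relation for `x` and `p₀ + p₁ x + p₂ x² + y₁ + y₂`. -/
theorem mixed_relation_eq {ρ α p₀ p₁ p₂ a b : k} (hρ : ρ ^ 2 + ρ + 1 = 0) {x y₁ y₂ Y : B}
    (hx : x * (x * x) = α • 1) (h₁ : y₁ * x = ρ • (x * y₁)) (h₂ : y₂ * x = ρ ^ 2 • (x * y₂))
    (hY : Y = p₀ • 1 + p₁ • x + p₂ • (x * x) + y₁ + y₂) :
    x * (Y * Y) + Y * (x * Y) + Y * (Y * x) - ((3 * p₀) • (x * Y + Y * x) + (3 * α * p₂) • Y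
      + (3 * (α * p₁ * p₂ - p₀ ^ 2 - b)) • x
      + (3 * α * (ρ * a - p₀ * p₂ + p₁ ^ 2)) • 1)
    = (2 + ρ) • (x * (y₁ * y₂ - ρ • (y₂ * y₁)
        - (((ρ - ρ ^ 2) * a) • (x * x) + ((ρ - 1) * b) • 1))) := by
  subst hY
  have hx' : ∀ z, x * (x * (x * z)) = α • z := fun z => by
    rw [← mul_assoc x x z, ← mul_assoc x _ z, hx, smul_mul_assoc, one_mul]
  have h₁' : ∀ z, y₁ * (x * z) = ρ • (x * (y₁ * z)) := fun z => by
    rw [← mul_assoc, h₁, smul_mul_assoc, mul_assoc]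
  have h₂' : ∀ z, y₂ * (x * z) = ρ ^ 2 • (x * (y₂ * z)) := fun z => by
    rw [← mul_assoc, h₂, smul_mul_assoc, mul_assoc]
  -- All powers of `x` are moved to the left and reduced by `x³ = α`; the identity is then one
  -- between the coefficients of each remaining word.
  simp only [mul_add, add_mul, mul_sub, sub_mul, smul_mul_assoc, mul_smul_comm, mul_one, one_mul,
    mul_assoc, smul_add, smul_sub, smul_smul, h₁, h₂, h₁', h₂', hx, hx']
  match_scalars <;> grind

/-- The `b³`-coefficient of the Clifford relation for `p₀ + p₁ x + p₂ x² + y₁ + y₂`. -/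
theorem cubic_relation_eq {ρ α p₀ p₁ p₂ a b d : k} (hρ : ρ ^ 2 + ρ + 1 = 0) {x y₁ y₂ Y : B}
    (hx : x * (x * x) = α • 1) (h₁ : y₁ * x = ρ • (x * y₁)) (h₂ : y₂ * x = ρ ^ 2 • (x * y₂))
    (h₁₂ : y₁ * y₂ = ρ • (y₂ * y₁) + (((ρ - ρ ^ 2) * a) • (x * x) + ((ρ - 1) * b) • 1))
    (hY : Y = p₀ • 1 + p₁ • x + p₂ • (x * x) + y₁ + y₂) :
    Y * (Y * Y) - ((3 * p₀) • (Y * Y) + (3 * (α * p₁ * p₂ - p₀ ^ 2 - b)) • Y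
      + (α ^ 2 * p₂ ^ 3 + α * p₁ ^ 3 - 2 * p₀ ^ 3 + 3 * α * ρ * a * p₁
        - p₀ * (3 * (α * p₁ * p₂ - p₀ ^ 2 - b)) - d) • 1)
    = y₁ * (y₁ * y₁) + y₂ * (y₂ * y₂) - ((3 * ρ ^ 2 * p₂) • (x * (x * (y₂ * y₁)))
        + (3 * α * ρ ^ 2 * p₂ * a) • x + (3 * ρ ^ 2 * p₂ * b) • (x * x) - d • 1) := by
  subst hY
  have hx' : ∀ z, x * (x * (x * z)) = α • z := fun z => by
    rw [← mul_assoc x x z, ← mul_assoc x _ z, hx, smul_mul_assoc, one_mul]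
  have h₁' : ∀ z, y₁ * (x * z) = ρ • (x * (y₁ * z)) := fun z => by
    rw [← mul_assoc, h₁, smul_mul_assoc, mul_assoc]
  have h₂' : ∀ z, y₂ * (x * z) = ρ ^ 2 • (x * (y₂ * z)) := fun z => by
    rw [← mul_assoc, h₂, smul_mul_assoc, mul_assoc]
  have h₁₂' : ∀ z, y₁ * (y₂ * z) = ρ • (y₂ * (y₁ * z))
      + (((ρ - ρ ^ 2) * a) • (x * (x * z)) + ((ρ - 1) * b) • z) := fun z => by
    rw [← mul_assoc, h₁₂]
    simp only [add_mul, smul_mul_assoc, mul_assoc, one_mul]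
  simp only [mul_add, add_mul, mul_sub, sub_mul, smul_mul_assoc, mul_smul_comm, mul_one, one_mul,
    mul_assoc, smul_add, smul_smul, h₁, h₂, h₁', h₂', hx, hx', h₁₂, h₁₂']
  match_scalars <;> grind

end Identities

end CubicClifford

/-! ### Constants, the four coefficient relations, and frames -/

namespace CubicClifford

theorem IsPrimitiveRoot.sq_add_self_add_one {F : Type*} [Field F] {ρ : F}
    (hρ : IsPrimitiveRoot ρ 3) : ρ ^ 2 + ρ + 1 = 0 := by
  have h := hρ.geom_sum_eq_zero (by norm_num)
  simp only [Finset.sum_range_succ, Finset.sum_range_zero] at h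
  linear_combination h

theorem IsPrimitiveRoot.three_ne_zero {F : Type*} [Field F] {ρ : F}
    (hρ : IsPrimitiveRoot ρ 3) : (3 : F) ≠ 0 := by
  intro h
  have h1 := IsPrimitiveRoot.sq_add_self_add_one hρ
  have h2 : (ρ - 1) ^ 2 = 0 := by linear_combination h1 - ρ * h
  exact hρ.ne_one (by norm_num) (sub_eq_zero.1 (pow_eq_zero_iff (by norm_num) |>.1 h2))

theorem ne_zero_of_isField_adjoinRoot {F : Type*} [Field F] {α : F}
    (hα : IsField (AdjoinRoot (Polynomial.X ^ 3 - Polynomial.C α))) : α ≠ 0 := by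
  rintro rfl
  let _ := hα.toField
  have h : AdjoinRoot.mk (Polynomial.X ^ 3 - Polynomial.C (0 : F)) Polynomial.X ^ 3 = 0 := by
    rw [← map_pow, AdjoinRoot.mk_eq_zero]
    simp
  have h' := pow_eq_zero_iff (by norm_num) |>.1 h
  rw [AdjoinRoot.mk_eq_zero] at h'
  have := Polynomial.natDegree_le_of_dvd h' Polynomial.X_ne_zero
  simp at this

namespace Coeffs

variable {F : Type*} [Field F] (Φ : Coeffs F) (ρ : F)

/-- The coefficient `ρ² D_1 / (3 α)` of `x` in `w`. -/
def wCoeff₁ : F := ρ ^ 2 * Φ.D₁ / (3 * Φ.α)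

/-- The coefficient `D_2 / (9 α)` of `x⁻¹` in `w`. -/
def wCoeff₂ : F := Φ.D₂ / (9 * Φ.α)

section

variable {Φ ρ}

/-- `D₂`, `D₁` and `D` are the corrections for which `p₀ = r/3`, `p₁ = β/(3α)`, `p₂ = e/(3α)`, put
into `mixed_relation_eq` and `cubic_relation_eq`, reproduce `t`, `γ` and `δ`; this and the next two
identities are the comparison. -/
theorem t_eq (hα : Φ.α ≠ 0) (h3 : (3 : F) ≠ 0) :
    3 * (Φ.α * (Φ.β / (3 * Φ.α)) * (Φ.e / (3 * Φ.α)) - (Φ.r / 3) ^ 2 - Φ.wCoeff₂) = Φ.t := by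
  have h9 : (9 : F) ≠ 0 := by convert pow_ne_zero 2 h3 using 1; norm_num
  unfold wCoeff₂ D₂
  field_simp
  ring

theorem γ_eq (hρ : ρ ^ 2 + ρ + 1 = 0) (hα : Φ.α ≠ 0) (h3 : (3 : F) ≠ 0) :
    3 * Φ.α * (ρ * Φ.wCoeff₁ ρ - Φ.r / 3 * (Φ.e / (3 * Φ.α)) + (Φ.β / (3 * Φ.α)) ^ 2) = Φ.γ := by
  have h : ρ * Φ.wCoeff₁ ρ = Φ.D₁ / (3 * Φ.α) := by
    unfold wCoeff₁
    field_simp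
    linear_combination Φ.D₁ * (ρ - 1) * hρ
  rw [h]
  unfold D₁
  field_simp
  ring

theorem δ_eq (hρ : ρ ^ 2 + ρ + 1 = 0) (hα : Φ.α ≠ 0) (h3 : (3 : F) ≠ 0) :
    Φ.α ^ 2 * (Φ.e / (3 * Φ.α)) ^ 3 + Φ.α * (Φ.β / (3 * Φ.α)) ^ 3 - 2 * (Φ.r / 3) ^ 3
      + 3 * Φ.α * ρ * Φ.wCoeff₁ ρ * (Φ.β / (3 * Φ.α)) - Φ.r / 3 * Φ.t - Φ.D = Φ.δ := by
  have h : 3 * Φ.α * ρ * Φ.wCoeff₁ ρ = Φ.D₁ := by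
    unfold wCoeff₁
    field_simp
    linear_combination Φ.D₁ * (ρ - 1) * hρ
  have h27 : (27 : F) ≠ 0 := by convert pow_ne_zero 3 h3 using 1; norm_num
  rw [h]
  unfold D
  generalize Φ.D₁ = D₁
  field_simp
  ring

end

section

variable {B : Type*} [Ring B] [Algebra F B]

/-- The Clifford relations for all `a, b ∈ F` amount to the four relations between their
coefficients. -/
theorem relation_iff (h2 : (2 : F) ≠ 0) {X Y : B} :
    (∀ a b : F, (a • X + b • Y) ^ 3 = (Φ.r * b) • (a • X + b • Y) ^ 2
      + (Φ.e * a * b + Φ.t * b ^ 2) • (a • X + b • Y)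
      + (Φ.α * a ^ 3 + Φ.β * a ^ 2 * b + Φ.γ * a * b ^ 2 + Φ.δ * b ^ 3) • 1) ↔
    X * (X * X) = Φ.α • 1 ∧
    X * (X * Y) + X * (Y * X) + Y * (X * X) = Φ.r • (X * X) + Φ.e • X + Φ.β • 1 ∧
    X * (Y * Y) + Y * (X * Y) + Y * (Y * X)
      = Φ.r • (X * Y + Y * X) + Φ.e • Y + Φ.t • X + Φ.γ • 1 ∧
    Y * (Y * Y) = Φ.r • (Y * Y) + Φ.t • Y + Φ.δ • 1 := by
  have key : ∀ a b : F, (a • X + b • Y) ^ 3 - ((Φ.r * b) • (a • X + b • Y) ^ 2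
      + (Φ.e * a * b + Φ.t * b ^ 2) • (a • X + b • Y)
      + (Φ.α * a ^ 3 + Φ.β * a ^ 2 * b + Φ.γ * a * b ^ 2 + Φ.δ * b ^ 3) • 1)
      = a ^ 3 • (X * (X * X) - Φ.α • 1)
      + (a ^ 2 * b) • (X * (X * Y) + X * (Y * X) + Y * (X * X)
          - (Φ.r • (X * X) + Φ.e • X + Φ.β • 1))
      + (a * b ^ 2) • (X * (Y * Y) + Y * (X * Y) + Y * (Y * X)
          - (Φ.r • (X * Y + Y * X) + Φ.e • Y + Φ.t • X + Φ.γ • 1))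
      + b ^ 3 • (Y * (Y * Y) - (Φ.r • (Y * Y) + Φ.t • Y + Φ.δ • 1)) := by
    intro a b
    simp only [pow_succ (_ : B), pow_zero, one_mul, mul_add, add_mul, smul_mul_assoc,
      mul_smul_comm, mul_assoc]
    module
  constructor
  · intro h
    have h' := fun a b => (key a b).symm.trans (sub_eq_zero.2 (h a b))
    have e1 := h' 1 0
    have e2 := h' 0 1
    have e3 := h' 1 1
    -- Under `b ↦ -b` the coefficient of `a²b` changes sign and that of `ab²` does not, so the
    -- values at `(1, 1)` and `(1, -1)` separate them up to the factor `2`.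
    have e4 := h' 1 (-1)
    simp only [one_pow, one_smul, mul_zero, zero_smul, add_zero, ne_eq, OfNat.ofNat_ne_zero,
      not_false_eq_true, zero_pow, zero_mul, zero_add] at e1 e2
    rw [e1, e2] at e3 e4
    simp only [one_pow, one_smul, mul_one, zero_add, smul_zero, add_zero] at e3 e4
    have e5 : (2 : F) • (X * (Y * Y) + Y * (X * Y) + Y * (Y * X)
          - (Φ.r • (X * Y + Y * X) + Φ.e • Y + Φ.t • X + Φ.γ • 1)) = 0 := by
      linear_combination (norm := module) e3 + e4
    have e6 := (smul_eq_zero.1 e5).resolve_left h2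
    rw [e6, add_zero] at e3
    exact ⟨sub_eq_zero.1 e1, sub_eq_zero.1 e3, sub_eq_zero.1 e6, sub_eq_zero.1 e2⟩
  · rintro ⟨e1, e2, e3, e4⟩ a b
    rw [← sub_eq_zero, key, sub_eq_zero.2 e1, sub_eq_zero.2 e2, sub_eq_zero.2 e3,
      sub_eq_zero.2 e4]
    simp

theorem pappacenaRel_iff (x y : B) :
    (∀ ⦃p q : FreeAlgebra F (Fin 2)⦄, PappacenaRel F 2 3 Φ.form p q →
      FreeAlgebra.lift F ![x, y] p = FreeAlgebra.lift F ![x, y] q) ↔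
    ∀ a b : F, (a • x + b • y) ^ 3 = (Φ.r * b) • (a • x + b • y) ^ 2
      + (Φ.e * a * b + Φ.t * b ^ 2) • (a • x + b • y)
      + (Φ.α * a ^ 3 + Φ.β * a ^ 2 * b + Φ.γ * a * b ^ 2 + Φ.δ * b ^ 3) • 1 := by
  constructor
  · intro h a b
    have := h (PappacenaRel.rel ![a, b])
    simpa [form, Finset.sum_Icc_succ_top, Algebra.algebraMap_eq_smul_one] using this
  · rintro h _ _ ⟨a⟩
    have := h (a 0) (a 1)
    simpa [form, Finset.sum_Icc_succ_top, Algebra.algebraMap_eq_smul_one] using this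

/-- Elements that generate a quotient of `C_Φ`, with `x`, `y_1`, `y_2`, `w` as in `C_Φ`. -/
structure IsFrame (x y₁ y₂ w : B) : Prop where
  x_cube : x * (x * x) = Φ.α • 1
  y₁_x : y₁ * x = ρ • (x * y₁)
  y₂_x : y₂ * x = ρ ^ 2 • (x * y₂)
  y₂_y₁ : y₂ * y₁ = x * w - Φ.wCoeff₁ ρ • (x * x) - Φ.wCoeff₂ • 1
  y₁_y₂ : y₁ * y₂ = ρ • (x * w) - (ρ ^ 2 * Φ.wCoeff₁ ρ) • (x * x) - Φ.wCoeff₂ • 1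
  w_x : w * x = x * w
  w_y₁ : w * y₁ = y₁ * w
  w_y₂ : w * y₂ = y₂ * w
  cubes : y₁ * (y₁ * y₁) + y₂ * (y₂ * y₂) = (ρ ^ 2 * Φ.e) • w - Φ.D • 1

end

end Coeffs

end CubicClifford

/-! ### `C_Φ` described by `x`, `y₁`, `y₂`, `w` -/

namespace CubicClifford

namespace Coeffs

variable {F : Type*} [Field F] (Φ : Coeffs F) (ρ : F)

section

variable {Φ ρ} {B : Type*} [Ring B] [Algebra F B]

theorem x_mul_x_mul_x : Φ.x * (Φ.x * Φ.x) = Φ.α • (1 : Φ.Alg) := by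
  rw [← Algebra.algebraMap_eq_smul_one, ← x_pow_three]
  noncomm_ring

/-- The component `(Y + ρ^k X Y X⁻¹ + ρ^(2k) X² Y X⁻²) / 3` for any `X` with `X³ = α`. -/
theorem map_yComp (hα : Φ.α ≠ 0) (f : Φ.Alg →ₐ[F] B) (k : ℕ) :
    f (Φ.yComp ρ k) = (3 : F)⁻¹ • (f Φ.y + (ρ ^ k * Φ.α⁻¹) • (f Φ.x * (f Φ.y * (f Φ.x * f Φ.x)))
      + (ρ ^ (2 * k) * Φ.α⁻¹) • (f Φ.x * (f Φ.x * (f Φ.y * f Φ.x)))) := by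
  have h : Φ.xInv ^ 2 = Φ.α⁻¹ • Φ.x := by
    have : Φ.x ^ 2 * Φ.x ^ 2 = Φ.α • Φ.x := by
      have h' := congrArg (· * Φ.x) (x_mul_x_mul_x (Φ := Φ))
      simp only [smul_mul_assoc, one_mul] at h'
      rw [← h']
      noncomm_ring
    rw [xInv, pow_two, smul_mul_smul_comm, this, smul_smul]
    congr 1
    field_simp
  rw [yComp, h, xInv]
  simp only [map_smul, map_add, map_mul, mul_smul_comm, smul_smul, pow_two, mul_assoc]

theorem map_w (f : Φ.Alg →ₐ[F] B) :
    f (Φ.w ρ) = Φ.α⁻¹ • (f Φ.x * (f Φ.x * (f (Φ.yComp ρ 2) * f (Φ.yComp ρ 1))))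
      + Φ.wCoeff₁ ρ • f Φ.x + (Φ.wCoeff₂ * Φ.α⁻¹) • (f Φ.x * f Φ.x) := by
  rw [w, xInv]
  simp only [map_smul, map_add, map_mul, smul_smul, pow_two, mul_assoc, smul_mul_assoc, wCoeff₁,
    wCoeff₂]

/-- The universal property of `C_Φ` in terms of `x`, `y_1`, `y_2`, `w`. -/
theorem IsFrame.exists_algHom (hρ : ρ ^ 2 + ρ + 1 = 0) (h2 : (2 : F) ≠ 0) (h3 : (3 : F) ≠ 0)
    (hα : Φ.α ≠ 0) {X Y₁ Y₂ W : B} (h : Φ.IsFrame ρ X Y₁ Y₂ W) :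
    ∃ f : Φ.Alg →ₐ[F] B, f Φ.x = X ∧ f (Φ.yComp ρ 1) = Y₁ ∧ f (Φ.yComp ρ 2) = Y₂ ∧
      f (Φ.w ρ) = W := by
  set p₀ := Φ.r / 3 with hp₀
  set p₁ := Φ.β / (3 * Φ.α) with hp₁
  set p₂ := Φ.e / (3 * Φ.α) with hp₂
  have hr : Φ.r = 3 * p₀ := by rw [hp₀]; field_simp
  have hβ : Φ.β = 3 * Φ.α * p₁ := by rw [hp₁]; field_simp
  have he : Φ.e = 3 * Φ.α * p₂ := by rw [hp₂]; field_simp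
  set Y : B := p₀ • 1 + p₁ • X + p₂ • (X * X) + Y₁ + Y₂ with hY
  have hX := h.x_cube
  have hX' : ∀ z, X * (X * (X * z)) = Φ.α • z := fun z => by
    rw [← mul_assoc X X z, ← mul_assoc X _ z, hX, smul_mul_assoc, one_mul]
  have h₁ := h.y₁_x
  have h₂ := h.y₂_x
  have h₁' : ∀ z, Y₁ * (X * z) = ρ • (X * (Y₁ * z)) := fun z => by
    rw [← mul_assoc, h₁, smul_mul_assoc, mul_assoc]
  have h₂' : ∀ z, Y₂ * (X * z) = ρ ^ 2 • (X * (Y₂ * z)) := fun z => by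
    rw [← mul_assoc, h₂, smul_mul_assoc, mul_assoc]
  have h₁₂ : Y₁ * Y₂ = ρ • (Y₂ * Y₁)
      + (((ρ - ρ ^ 2) * Φ.wCoeff₁ ρ) • (X * X) + ((ρ - 1) * Φ.wCoeff₂) • 1) := by
    rw [h.y₁_y₂, h.y₂_y₁]
    module
  have g1 : X * (X * Y) + X * (Y * X) + Y * (X * X) = Φ.r • (X * X) + Φ.e • X + Φ.β • 1 := by
    rw [hr, hβ, he, hY]
    simp only [mul_add, add_mul, smul_mul_assoc, mul_smul_comm, mul_one, one_mul, mul_assoc,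
      smul_smul, h₁, h₂, h₁', h₂', hX]
    match_scalars <;> grind (ematch := 0)
  have g2 := mixed_relation_eq (a := Φ.wCoeff₁ ρ) (b := Φ.wCoeff₂) hρ hX h₁ h₂ hY
  rw [h₁₂, add_sub_cancel_left, sub_self, mul_zero, smul_zero, sub_eq_zero, γ_eq hρ hα h3,
    t_eq hα h3, ← he, ← hr] at g2
  have g3 := cubic_relation_eq (d := Φ.D) hρ hX h₁ h₂ h₁₂ hY
  rw [t_eq hα h3, δ_eq hρ hα h3, ← hr, h.cubes, h.y₂_y₁] at g3
  -- By the definition of `W` one has `X²(Y₂Y₁ + c₁X² + c₂) = αW`, so the terms with `p₂` add up to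
  -- `ρ² e W` because `e = 3αp₂`.
  have g3' : (ρ ^ 2 * Φ.e) • W - Φ.D • 1 - ((3 * ρ ^ 2 * p₂) • (X * (X * (X * W
      - Φ.wCoeff₁ ρ • (X * X) - Φ.wCoeff₂ • 1))) + (3 * Φ.α * ρ ^ 2 * p₂ * Φ.wCoeff₁ ρ) • X
        + (3 * ρ ^ 2 * p₂ * Φ.wCoeff₂) • (X * X) - Φ.D • 1) = 0 := by
    simp only [mul_sub, mul_smul_comm, mul_one, hX, hX', he]
    module
  rw [g3', sub_eq_zero] at g3
  let f : Φ.Alg →ₐ[F] B := RingQuot.liftAlgHom F ⟨FreeAlgebra.lift F ![X, Y],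
    (pappacenaRel_iff Φ X Y).2 ((relation_iff Φ h2).2 ⟨hX, g1, by rw [g2], g3⟩)⟩
  have fx : f Φ.x = X := by simp [f, x]
  have fy : f Φ.y = Y := by simp [f, y]
  have hk : ∀ k, f (Φ.yComp ρ k) = (3 : F)⁻¹ • (Y + (ρ ^ k * Φ.α⁻¹) • (X * (Y * (X * X)))
      + (ρ ^ (2 * k) * Φ.α⁻¹) • (X * (X * (Y * X)))) := by
    intro k
    rw [map_yComp hα, fx, fy]
  have f1 : f (Φ.yComp ρ 1) = Y₁ := by
    rw [hk, hY]
    simp only [mul_add, add_mul, smul_mul_assoc, mul_smul_comm, mul_one, one_mul, mul_assoc,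
      smul_smul, smul_add, h₁, h₂, h₁', h₂', hX, hX']
    match_scalars <;> grind (ematch := 0)
  have f2 : f (Φ.yComp ρ 2) = Y₂ := by
    rw [hk, hY]
    simp only [mul_add, add_mul, smul_mul_assoc, mul_smul_comm, mul_one, one_mul, mul_assoc,
      smul_smul, smul_add, h₁, h₂, h₁', h₂', hX, hX']
    match_scalars <;> grind (ematch := 0)
  refine ⟨f, fx, f1, f2, ?_⟩
  rw [map_w, fx, f1, f2, h.y₂_y₁]
  simp only [mul_sub, mul_smul_comm, mul_one, hX, hX', smul_sub, smul_smul]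
  match_scalars <;> grind (ematch := 0)

theorem yComp_mul_x (hρ : ρ ^ 2 + ρ + 1 = 0) (hα : Φ.α ≠ 0) (k : ℕ) :
    Φ.yComp ρ k * Φ.x = ρ ^ k • (Φ.x * Φ.yComp ρ k) := by
  have hX := x_mul_x_mul_x (Φ := Φ)
  have hX' : ∀ z, Φ.x * (Φ.x * (Φ.x * z)) = Φ.α • z := fun z => by
    rw [← mul_assoc Φ.x Φ.x z, ← mul_assoc Φ.x _ z, hX, smul_mul_assoc, one_mul]
  have hρ3 : (ρ ^ k) ^ 3 = 1 := by
    rw [← pow_mul, mul_comm, pow_mul, show ρ ^ 3 = 1 by linear_combination (ρ - 1) * hρ, one_pow]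
  have := map_yComp hα (ρ := ρ) (AlgHom.id F Φ.Alg) k
  simp only [AlgHom.id_apply] at this
  rw [this, mul_comm 2 k, pow_mul]
  generalize ρ ^ k = q at *
  simp only [mul_add, add_mul, smul_mul_assoc, mul_smul_comm, mul_one, mul_assoc,
    smul_smul, smul_add, hX, hX']
  match_scalars <;> grind (ematch := 0)

/-- In `x²y + xyx + yx²` the components `y₁`, `y₂` cancel by `1 + ρ + ρ² = 0`, and `y₀` contributes
`3x²y₀`. The `a²b` relation therefore gives `y₀ = (r + e x⁻¹ + β x⁻²)/3`. -/
theorem y_eq (hρ : ρ ^ 2 + ρ + 1 = 0) (h2 : (2 : F) ≠ 0) (h3 : (3 : F) ≠ 0)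
    (hα : Φ.α ≠ 0) : Φ.y = (Φ.r / 3) • 1 + (Φ.β / (3 * Φ.α)) • Φ.x
      + (Φ.e / (3 * Φ.α)) • (Φ.x * Φ.x) + Φ.yComp ρ 1 + Φ.yComp ρ 2 := by
  have hf : FreeAlgebra.lift F ![Φ.x, Φ.y] = RingQuot.mkAlgHom F (PappacenaRel F 2 3 Φ.form) := by
    ext i
    fin_cases i <;> simp [x, y]
  have hrel := (relation_iff Φ h2).1 ((pappacenaRel_iff Φ Φ.x Φ.y).1
    (by rw [hf]; exact fun _ _ h => RingQuot.mkAlgHom_rel F h))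
  have hX := x_mul_x_mul_x (Φ := Φ)
  have hX' : ∀ z, Φ.x * (Φ.x * (Φ.x * z)) = Φ.α • z := fun z => by
    rw [← mul_assoc Φ.x Φ.x z, ← mul_assoc Φ.x _ z, hX, smul_mul_assoc, one_mul]
  have key := map_yComp hα (ρ := ρ) (AlgHom.id F Φ.Alg)
  simp only [AlgHom.id_apply] at key
  have h := congrArg (fun z => Φ.x * z) hrel.2.1
  simp only [mul_add, mul_smul_comm, mul_one, hX, hX'] at h
  rw [key 1, key 2]
  have e1 : ρ ^ 4 = ρ := by linear_combination (ρ ^ 2 - ρ) * hρ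
  simp only [Nat.reduceMul, pow_one, mul_one, e1]
  linear_combination (norm := skip) (3 * Φ.α)⁻¹ • h
  match_scalars <;> grind (ematch := 0)

/-- The `ab²` relation is a multiple of the commutation rule for `y₁`, `y₂`, and the `b³` relation
is the one for the cubes. `w` commutes with `x` because `y₂y₁` has eigenvalue `ρ³ = 1`; it commutes
with `y₁` and `y₂` because both ways of bracketing `y₁y₂y₁` and `y₂y₁y₂` agree. -/
theorem isFrame (hρ : ρ ^ 2 + ρ + 1 = 0) (h2 : (2 : F) ≠ 0) (h3 : (3 : F) ≠ 0)
    (hα : Φ.α ≠ 0) : Φ.IsFrame ρ Φ.x (Φ.yComp ρ 1) (Φ.yComp ρ 2) (Φ.w ρ) := by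
  have hf : FreeAlgebra.lift F ![Φ.x, Φ.y] = RingQuot.mkAlgHom F (PappacenaRel F 2 3 Φ.form) := by
    ext i
    fin_cases i <;> simp [x, y]
  have hrel := (relation_iff Φ h2).1 ((pappacenaRel_iff Φ Φ.x Φ.y).1
    (by rw [hf]; exact fun _ _ h => RingQuot.mkAlgHom_rel F h))
  set p₀ := Φ.r / 3 with hp₀
  set p₁ := Φ.β / (3 * Φ.α) with hp₁
  set p₂ := Φ.e / (3 * Φ.α) with hp₂
  have hr : Φ.r = 3 * p₀ := by rw [hp₀]; field_simp
  have he : Φ.e = 3 * Φ.α * p₂ := by rw [hp₂]; field_simp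
  have hY := y_eq hρ h2 h3 hα
  have hX := x_mul_x_mul_x (Φ := Φ)
  have h₁ := yComp_mul_x hρ hα 1
  have h₂ := yComp_mul_x hρ hα 2
  have hw := map_w (ρ := ρ) (AlgHom.id F Φ.Alg)
  rw [pow_one] at h₁
  simp only [AlgHom.id_apply] at hw
  generalize Φ.x = X at *
  generalize Φ.yComp ρ 1 = Y₁ at *
  generalize Φ.yComp ρ 2 = Y₂ at *
  generalize Φ.y = Y at *
  have hX' : ∀ z, X * (X * (X * z)) = Φ.α • z := fun z => by
    rw [← mul_assoc X X z, ← mul_assoc X _ z, hX, smul_mul_assoc, one_mul]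
  have h₁' : ∀ z, Y₁ * (X * z) = ρ • (X * (Y₁ * z)) := fun z => by
    rw [← mul_assoc, h₁, smul_mul_assoc, mul_assoc]
  have h₂' : ∀ z, Y₂ * (X * z) = ρ ^ 2 • (X * (Y₂ * z)) := fun z => by
    rw [← mul_assoc, h₂, smul_mul_assoc, mul_assoc]
  have g2 := mixed_relation_eq (a := Φ.wCoeff₁ ρ) (b := Φ.wCoeff₂) hρ hX h₁ h₂ hY
  rw [γ_eq hρ hα h3, t_eq hα h3, ← he, ← hr, sub_eq_zero.2 (hrel.2.2.1)] at g2
  have h₁₂ : Y₁ * Y₂ = ρ • (Y₂ * Y₁)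
      + (((ρ - ρ ^ 2) * Φ.wCoeff₁ ρ) • (X * X) + ((ρ - 1) * Φ.wCoeff₂) • 1) := by
    -- `(2 + ρ)(1 - ρ) = 3`. The factor `X` is then removed by multiplying with `X²` and dividing by
    -- `α`.
    have h' : 2 + ρ ≠ 0 := fun h => h3 (by linear_combination (1 - ρ) * h + hρ)
    have h'' := congrArg (fun z => X * (X * z)) ((smul_eq_zero.1 g2.symm).resolve_left h')
    simp only [hX', mul_zero] at h''
    have := (smul_eq_zero.1 h'').resolve_left hα
    rw [← sub_eq_zero, ← this]
    abel
  have h₁₂' : ∀ z, Y₁ * (Y₂ * z) = ρ • (Y₂ * (Y₁ * z))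
      + (((ρ - ρ ^ 2) * Φ.wCoeff₁ ρ) • (X * (X * z)) + ((ρ - 1) * Φ.wCoeff₂) • z) := fun z => by
    rw [← mul_assoc, h₁₂]
    simp only [add_mul, smul_mul_assoc, mul_assoc, one_mul]
  have g3 := cubic_relation_eq (d := Φ.D) hρ hX h₁ h₂ h₁₂ hY
  rw [t_eq hα h3, δ_eq hρ hα h3, ← hr, sub_eq_zero.2 hrel.2.2.2] at g3
  have h₂₁ : Y₂ * Y₁ = X * Φ.w ρ - Φ.wCoeff₁ ρ • (X * X) - Φ.wCoeff₂ • 1 := by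
    rw [hw]
    simp only [mul_add, mul_smul_comm, hX, hX', smul_smul]
    match_scalars <;> grind (ematch := 0)
  refine ⟨hX, h₁, h₂, h₂₁, ?_, ?_, ?_, ?_, ?_⟩
  · rw [h₁₂, h₂₁]
    module
  · rw [hw]
    simp only [mul_add, add_mul, mul_smul_comm, smul_mul_assoc, hX, h₁, h₂', mul_assoc,
      smul_smul]
    match_scalars <;> grind (ematch := 0)
  · rw [hw]
    simp only [mul_add, add_mul, mul_smul_comm, smul_mul_assoc, h₁, h₁', h₁₂', mul_assoc,
      smul_smul, smul_add, hX']
    match_scalars <;> grind (ematch := 0)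
  · rw [hw]
    simp only [mul_add, add_mul, mul_smul_comm, smul_mul_assoc, h₂, h₂', h₁₂, mul_assoc,
      smul_smul, smul_add, mul_one, hX']
    match_scalars <;> grind (ematch := 0)
  · rw [hw, ← sub_eq_zero, g3, he]
    match_scalars <;> grind (ematch := 0)

end

end Coeffs

end CubicClifford

/-! ### Sums of conjugates for a pair of elements that commute up to a root of unity -/

namespace CubicClifford

/-- `u` and `v` commute up to `ω`, and their cubes are central. -/
structure IsSymbolPair {k B : Type*} [CommRing k] [Ring B] [Algebra k B] (ω : k) (u v : B) :
    Prop where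
  sum_eq : ω ^ 2 + ω + 1 = 0
  rel : v * u = ω • (u * v)
  u_cube : ∀ c, Commute (u ^ 3) c
  v_cube : ∀ c, Commute (v ^ 3) c

section

variable {B : Type*} [Ring B]

/-- The monomials `u^i v^j`. -/
def mon (u v : B) (i : Fin 3 × Fin 3) : B := u ^ (i.1 : ℕ) * v ^ (i.2 : ℕ)

/-- The monomials `v^(3-j) u^(3-i)`, inverse to `u^i v^j` up to the factor `v³ u³`. -/
def comon (u v : B) (i : Fin 3 × Fin 3) : B := v ^ (3 - i.2 : ℕ) * u ^ (3 - i.1 : ℕ)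

/-- The sum of the conjugates of `c` by the monomials `u^i v^j`, times `v³ u³`. -/
def conjSum (u v c : B) : B := ∑ i, mon u v i * c * comon u v i

theorem conjSum_add (u v c d : B) : conjSum u v (c + d) = conjSum u v c + conjSum u v d := by
  simp [conjSum, mul_add, add_mul, Finset.sum_add_distrib]

/-- `conjSum` as a linear map. -/
def conjSumHom (R : Type*) [CommRing R] [Algebra R B] (u v : B) : B →ₗ[R] B where
  toFun := conjSum u v
  map_add' := conjSum_add u v
  map_smul' c d := by simp [conjSum, Finset.smul_sum]

theorem conjSumHom_apply (R : Type*) [CommRing R] [Algebra R B] (u v c : B) :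
    conjSumHom R u v c = conjSum u v c := rfl

theorem conjSum_mem {u v c : B} {I : TwoSidedIdeal B} (hc : c ∈ I) : conjSum u v c ∈ I :=
  sum_mem fun _ _ => I.mul_mem_right _ _ (I.mul_mem_left _ _ hc)

theorem conjSum_mul_central {u v : B} (c : B) {z : B} (hz : ∀ d, Commute z d) :
    conjSum u v (z * c) = z * conjSum u v c := by
  rw [conjSum, conjSum, Finset.mul_sum]
  refine Finset.sum_congr rfl fun i _ => ?_
  rw [← mul_assoc, ← (hz (mon u v i)).eq, mul_assoc, mul_assoc, mul_assoc]

end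

namespace IsSymbolPair

variable {k B : Type*} [CommRing k] [Ring B] [Algebra k B] {ω : k} {u v : B}
  (h : IsSymbolPair ω u v)

include h

theorem pow_three : ω ^ 3 = 1 := by linear_combination (ω - 1) * h.sum_eq

omit h in
theorem mul_pow_of_mul {n : B} {μ : k} (hn : n * u = μ • (u * n)) (p : ℕ) :
    n * u ^ p = μ ^ p • (u ^ p * n) := by
  induction p with
  | zero => simp
  | succ p ih =>
    rw [pow_succ, ← mul_assoc, ih, smul_mul_assoc, mul_assoc, hn, mul_smul_comm, smul_smul,
      mul_assoc, pow_succ]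

omit h in
theorem pow_mul_of_mul {n : B} {μ : k} (hn : u * n = μ • (n * u)) (p : ℕ) :
    u ^ p * n = μ ^ p • (n * u ^ p) := by
  induction p with
  | zero => simp
  | succ p ih =>
    rw [pow_succ', mul_assoc, ih, mul_smul_comm, ← mul_assoc, hn, smul_mul_assoc, smul_smul,
      mul_assoc, pow_succ]

theorem u_mul_v_pow (q : ℕ) : u * v ^ q = ω ^ (2 * q) • (v ^ q * u) := by
  rw [pow_mul_of_mul h.rel, smul_smul, ← pow_add, show 2 * q + q = 3 * q by ring, pow_mul,
    h.pow_three, one_pow, one_smul]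

theorem v_mul_u_pow (q : ℕ) : v * u ^ q = ω ^ q • (u ^ q * v) := mul_pow_of_mul h.rel q

/-- `comon i` inverts `mon i` up to the central `v³u³`, so each term is `n` scaled by powers of its
two eigenvalues, and the nine terms factor into two geometric sums. -/
theorem sum_comon_mul_mon {n : B} {μ ν : k} (hu : n * u = μ • (u * n)) (hv : n * v = ν • (v * n)) :
    ∑ i, comon u v i * n * mon u v i
      = ((1 + μ + μ ^ 2) * (1 + ν + ν ^ 2)) • (v ^ 3 * u ^ 3 * n) := by
  have key : ∀ i : Fin 3 × Fin 3, comon u v i * n * mon u v i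
      = (μ ^ (i.1 : ℕ) * ν ^ (i.2 : ℕ)) • (v ^ 3 * u ^ 3 * n) := by
    intro i
    calc comon u v i * n * mon u v i
        = v ^ (3 - i.2 : ℕ) * u ^ (3 - i.1 : ℕ) * (n * u ^ (i.1 : ℕ)) * v ^ (i.2 : ℕ) := by
          simp only [comon, mon, mul_assoc]
      _ = μ ^ (i.1 : ℕ) • (v ^ (3 - i.2 : ℕ) * (u ^ (3 - i.1 : ℕ) * u ^ (i.1 : ℕ))
            * (n * v ^ (i.2 : ℕ))) := by
          rw [mul_pow_of_mul hu]
          simp only [mul_assoc, mul_smul_comm, smul_mul_assoc]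
      _ = (μ ^ (i.1 : ℕ) * ν ^ (i.2 : ℕ)) • (v ^ (3 - i.2 : ℕ) * u ^ 3
            * v ^ (i.2 : ℕ) * n) := by
          rw [mul_pow_of_mul hv, ← pow_add, Nat.sub_add_cancel i.1.is_lt.le]
          simp only [mul_assoc, mul_smul_comm, smul_smul]
      _ = _ := by
          rw [mul_assoc (v ^ _), (h.u_cube _).eq, ← mul_assoc (v ^ _), ← pow_add,
            Nat.sub_add_cancel i.2.is_lt.le]
  simp only [key, ← Finset.sum_smul]
  congr 1
  simp only [Fintype.sum_prod_type, Fin.sum_univ_three, Fin.val_zero, Fin.val_one, Fin.val_two]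
  ring

theorem conjSum_of_mul {n : B} {μ ν : k} (hu : u * n = μ • (n * u)) (hv : v * n = ν • (n * v)) :
    conjSum u v n = ((1 + μ + μ ^ 2) * (1 + ν + ν ^ 2)) • (v ^ 3 * u ^ 3 * n) := by
  have key : ∀ i : Fin 3 × Fin 3, mon u v i * n * comon u v i
      = (μ ^ (i.1 : ℕ) * ν ^ (i.2 : ℕ)) • (v ^ 3 * u ^ 3 * n) := by
    intro i
    calc mon u v i * n * comon u v i
        = u ^ (i.1 : ℕ) * (v ^ (i.2 : ℕ) * n) * v ^ (3 - i.2 : ℕ) * u ^ (3 - i.1 : ℕ) := by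
          simp only [comon, mon, mul_assoc]
      _ = ν ^ (i.2 : ℕ) • (u ^ (i.1 : ℕ) * n * (v ^ (i.2 : ℕ) * v ^ (3 - i.2 : ℕ))
            * u ^ (3 - i.1 : ℕ)) := by
          rw [pow_mul_of_mul hv]
          simp only [mul_assoc, mul_smul_comm, smul_mul_assoc]
      _ = (μ ^ (i.1 : ℕ) * ν ^ (i.2 : ℕ)) • (n * (u ^ (i.1 : ℕ) * (v ^ 3
            * u ^ (3 - i.1 : ℕ)))) := by
          rw [pow_mul_of_mul hu, ← pow_add, Nat.add_sub_cancel' i.2.is_lt.le]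
          simp only [mul_assoc, smul_mul_assoc, smul_smul, mul_comm]
      _ = _ := by
          rw [(h.v_cube _).eq, ← mul_assoc (u ^ _), ← pow_add,
            Nat.add_sub_cancel' i.1.is_lt.le, ← (h.v_cube _).eq, ← mul_assoc,
            ← (h.v_cube _).eq, mul_assoc, ← (h.u_cube _).eq, ← mul_assoc]
  simp only [conjSum, key, ← Finset.sum_smul]
  congr 1
  simp only [Fintype.sum_prod_type, Fin.sum_univ_three, Fin.val_zero, Fin.val_one, Fin.val_two]
  ring

/-- No relation between `v` and `n` is needed: `v^j n v^(3-j)` has the same eigenvalue under `u` as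
`n`, since the total exponent of `v` is `3`, so the sum over the powers of `u` already vanishes. -/
theorem conjSum_eq_zero {n : B} {μ : k} (hu : u * n = μ • (n * u)) (hμ : μ ^ 2 + μ + 1 = 0) :
    conjSum u v n = 0 := by
  have key : ∀ i j : Fin 3, mon u v (i, j) * n * comon u v (i, j)
      = μ ^ (i : ℕ) • (v ^ (j : ℕ) * n * v ^ (3 - j : ℕ) * u ^ 3) := by
    intro i j
    have hd : u * (v ^ (j : ℕ) * n * v ^ (3 - j : ℕ))
        = μ • (v ^ (j : ℕ) * n * v ^ (3 - j : ℕ) * u) := by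
      rw [mul_assoc (v ^ _), ← mul_assoc, h.u_mul_v_pow, smul_mul_assoc, mul_assoc, ← mul_assoc u,
        hu, smul_mul_assoc, mul_assoc n u, h.u_mul_v_pow]
      simp only [mul_smul_comm, smul_smul, mul_assoc]
      congr 1
      have : ω ^ (2 * (j : ℕ)) * ω ^ (2 * (3 - j : ℕ)) = 1 := by
        rw [← pow_add, ← mul_add, Nat.add_sub_cancel' j.is_lt.le, mul_comm, pow_mul, h.pow_three,
          one_pow]
      linear_combination μ * this
    calc mon u v (i, j) * n * comon u v (i, j)
        = u ^ (i : ℕ) * (v ^ (j : ℕ) * n * v ^ (3 - j : ℕ)) * u ^ (3 - i : ℕ) := by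
          simp only [comon, mon, mul_assoc]
      _ = _ := by
          rw [pow_mul_of_mul hd, smul_mul_assoc, mul_assoc _ (u ^ _), ← pow_add,
            Nat.add_sub_cancel' i.is_lt.le]
  rw [conjSum, Fintype.sum_prod_type, Finset.sum_comm]
  refine Finset.sum_eq_zero fun j _ => ?_
  simp only [key, ← Finset.sum_smul, Fin.sum_univ_three, Fin.val_zero, Fin.val_one, Fin.val_two]
  rw [show μ ^ 0 + μ ^ 1 + μ ^ 2 = 0 by linear_combination hμ, zero_smul]

theorem sq_sum_eq : (ω ^ 2) ^ 2 + ω ^ 2 + 1 = 0 := by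
  linear_combination (ω ^ 2 - ω + 1) * h.sum_eq

theorem one_add_pow_add (n : ℕ) : 1 + ω ^ n + (ω ^ n) ^ 2 = if 3 ∣ n then 3 else 0 := by
  have h3 := h.pow_three
  have hn : ω ^ n = ω ^ (n % 3) := by
    conv_lhs => rw [← Nat.div_add_mod n 3, pow_add, pow_mul, h3, one_pow, one_mul]
  simp only [hn, Nat.dvd_iff_mod_eq_zero]
  have : n % 3 < 3 := Nat.mod_lt _ (by norm_num)
  interval_cases n % 3
  · norm_num
  · simp only [one_ne_zero, if_false]
    linear_combination h.sum_eq
  · simp only [OfNat.ofNat_ne_zero, if_false]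
    linear_combination h.sq_sum_eq

theorem one_add_pow_mul (p q : ℕ) :
    (1 + ω ^ q + (ω ^ q) ^ 2) * (1 + ω ^ (2 * p) + (ω ^ (2 * p)) ^ 2)
      = if 3 ∣ p ∧ 3 ∣ q then 9 else 0 := by
  have hp : 3 ∣ 2 * p ↔ 3 ∣ p := by omega
  simp only [h.one_add_pow_add, hp]
  by_cases h1 : 3 ∣ p <;> by_cases h2 : 3 ∣ q <;> simp [h1, h2]
  norm_num

theorem u_pow_mul_v (p : ℕ) : u ^ p * v = ω ^ (2 * p) • (v * u ^ p) := by
  rw [h.v_mul_u_pow, smul_smul, ← pow_add, show 2 * p + p = 3 * p by ring, pow_mul,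
    h.pow_three, one_pow, one_smul]

omit h in
theorem dvd_iff_eq_zero (j : Fin 3 × Fin 3) : 3 ∣ (j.1 : ℕ) ∧ 3 ∣ (j.2 : ℕ) ↔ j = 0 := by
  rw [Prod.ext_iff, Fin.ext_iff, Fin.ext_iff]
  simp only [Prod.fst_zero, Prod.snd_zero, Fin.val_zero]
  omega

omit h in
theorem dvd_sub_iff_eq_zero (j : Fin 3 × Fin 3) :
    3 ∣ (3 - j.1 : ℕ) ∧ 3 ∣ (3 - j.2 : ℕ) ↔ j = 0 := by
  rw [Prod.ext_iff, Fin.ext_iff, Fin.ext_iff]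
  simp only [Prod.fst_zero, Prod.snd_zero, Fin.val_zero]
  omega

theorem sum_comon_mul_mon_mul_mon (j : Fin 3 × Fin 3) :
    ∑ i, comon u v i * mon u v j * mon u v i = if j = 0 then (9 : k) • (v ^ 3 * u ^ 3) else 0 := by
  have hu : mon u v j * u = ω ^ (j.2 : ℕ) • (u * mon u v j) := by
    rw [mon, mul_assoc, pow_mul_of_mul h.rel, mul_smul_comm, ← mul_assoc, ← mul_assoc, pow_mul_comm']
  have hv : mon u v j * v = ω ^ (2 * (j.1 : ℕ)) • (v * mon u v j) := by
    rw [mon, mul_assoc, pow_mul_comm', ← mul_assoc, h.u_pow_mul_v, smul_mul_assoc, mul_assoc]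
  rw [h.sum_comon_mul_mon hu hv, h.one_add_pow_mul]
  simp only [dvd_iff_eq_zero]
  split_ifs with hj
  · simp [hj, mon]
  · simp

theorem sum_comon_mul_comon_mul_mon (j : Fin 3 × Fin 3) :
    ∑ i, comon u v i * comon u v j * mon u v i
      = if j = 0 then (9 : k) • (v ^ 3 * u ^ 3) ^ 2 else 0 := by
  have hu : comon u v j * u = ω ^ (3 - j.2 : ℕ) • (u * comon u v j) := by
    rw [comon, mul_assoc, pow_mul_comm', ← mul_assoc, pow_mul_of_mul h.rel, smul_mul_assoc,
      mul_assoc]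
  have hv : comon u v j * v = ω ^ (2 * (3 - j.1 : ℕ)) • (v * comon u v j) := by
    rw [comon, mul_assoc, h.u_pow_mul_v, mul_smul_comm, ← mul_assoc, ← mul_assoc, pow_mul_comm']
  rw [h.sum_comon_mul_mon hu hv, h.one_add_pow_mul]
  simp only [dvd_sub_iff_eq_zero]
  split_ifs with hj
  · simp [hj, comon, pow_two]
  · simp

/-- The expansion of `c` in dual bases for the trace form. After interchanging the sums, the inner
sum over `i` kills every conjugating monomial except `j = 0`. -/
theorem sum_conjSum_mul_comon (c : B) :
    ∑ i, conjSum u v (c * comon u v i) * mon u v i = (9 : k) • ((v ^ 3 * u ^ 3) ^ 2 * c) := by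
  have hz : Commute ((v ^ 3 * u ^ 3) ^ 2) c := ((h.v_cube c).mul_left (h.u_cube c)).pow_left 2
  calc ∑ i, conjSum u v (c * comon u v i) * mon u v i
      = ∑ j, mon u v j * c * ∑ i, comon u v i * comon u v j * mon u v i := by
        simp only [conjSum, Finset.sum_mul, Finset.mul_sum, mul_assoc]
        exact Finset.sum_comm
    _ = _ := by
        simp only [h.sum_comon_mul_comon_mul_mon]
        rw [Finset.sum_eq_single 0 (fun j _ hj => by simp [hj]) (by simp)]
        simp [mon, hz.eq]

theorem sum_comon_mul_conjSum (c : B) :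
    ∑ i, comon u v i * conjSum u v (mon u v i * c) = (9 : k) • ((v ^ 3 * u ^ 3) ^ 2 * c) := by
  have hz : Commute (v ^ 3 * u ^ 3) c := (h.v_cube c).mul_left (h.u_cube c)
  calc ∑ i, comon u v i * conjSum u v (mon u v i * c)
      = ∑ j, (∑ i, comon u v i * mon u v j * mon u v i) * c * comon u v j := by
        simp only [conjSum, Finset.sum_mul, Finset.mul_sum, mul_assoc]
        exact Finset.sum_comm
    _ = _ := by
        simp only [h.sum_comon_mul_mon_mul_mon]
        rw [Finset.sum_eq_single 0 (fun j _ hj => by simp [hj]) (by simp)]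
        simp only [if_true, comon, Prod.fst_zero, Prod.snd_zero, Fin.val_zero, Nat.sub_zero,
          smul_mul_assoc, pow_two]
        rw [mul_assoc, ← hz.eq]
        simp only [mul_assoc]

/-- Orthogonality of the monomials and their duals. The product is an eigenvector for conjugation by
`u` and `v`, and both exponents are divisible by `3` exactly when `i = j`. -/
theorem conjSum_mon_mul_comon (i j : Fin 3 × Fin 3) :
    conjSum u v (mon u v i * comon u v j) = if i = j then (9 : k) • (v ^ 3 * u ^ 3) ^ 2 else 0 := by
  set p : ℕ := i.1 + (3 - j.1) with hp
  set q : ℕ := i.2 + (3 - j.2) with hq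
  have hn : mon u v i * comon u v j = u ^ (i.1 : ℕ) * v ^ q * u ^ (3 - j.1 : ℕ) := by
    rw [mon, comon, hq, pow_add]
    simp only [mul_assoc]
  have hu : u * (mon u v i * comon u v j) = ω ^ (2 * q) • (mon u v i * comon u v j * u) := by
    calc u * (mon u v i * comon u v j)
        = u ^ (i.1 : ℕ) * (u * v ^ q) * u ^ (3 - j.1 : ℕ) := by
          rw [hn, ← mul_assoc, ← mul_assoc, ← mul_assoc, ← pow_succ, ← pow_succ']
      _ = _ := by
          rw [h.u_mul_v_pow, hn]
          simp only [mul_smul_comm, smul_mul_assoc, mul_assoc, pow_mul_comm']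
  have hv : v * (mon u v i * comon u v j) = ω ^ p • (mon u v i * comon u v j * v) := by
    calc v * (mon u v i * comon u v j)
        = ω ^ (i.1 : ℕ) • (u ^ (i.1 : ℕ) * v ^ q * (v * u ^ (3 - j.1 : ℕ))) := by
          rw [hn, ← mul_assoc, ← mul_assoc, h.v_mul_u_pow]
          simp only [smul_mul_assoc, mul_assoc]
          rw [← mul_assoc v, ← pow_mul_comm', mul_assoc]
      _ = _ := by
          rw [h.v_mul_u_pow, hn]
          simp only [mul_smul_comm, mul_assoc, smul_smul, hp, pow_add]
  rw [h.conjSum_of_mul hu hv, mul_comm, h.one_add_pow_mul]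
  have hij : 3 ∣ q ∧ 3 ∣ p ↔ i = j := by
    rw [Prod.ext_iff, Fin.ext_iff, Fin.ext_iff]
    omega
  simp only [hij]
  split_ifs with e
  · subst e
    rw [hn, hq, Nat.add_sub_cancel' i.2.is_lt.le, ← (h.v_cube (u ^ _)).eq,
      mul_assoc (v ^ 3) (u ^ (i.1 : ℕ)), ← pow_add, Nat.add_sub_cancel' i.1.is_lt.le, pow_two (_ * _)]
  · simp

/-- `conjSum` on the monomials `u^i y^j`, for `y` that commutes with `u` up to a root of unity. -/
theorem conjSum_pow_mul_pow {μ : k} {y : B} (hμ : μ ^ 2 + μ + 1 = 0) (hy : y * u = μ • (u * y))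
    (j : Fin 3 × Fin 3) :
    conjSum u v (mon u y j) = if j = 0 then (9 : k) • (v ^ 3 * u ^ 3) else 0 := by
  have hμ3 : μ ^ 3 = 1 := by linear_combination (μ - 1) * hμ
  have hcomm : u * mon u y j = μ ^ (2 * (j.2 : ℕ)) • (mon u y j * u) := by
    rw [mon, mul_assoc, pow_mul_of_mul hy, mul_smul_comm, smul_smul, ← pow_add,
      show 2 * (j.2 : ℕ) + j.2 = 3 * j.2 by ring, pow_mul, hμ3, one_pow, one_smul, ← mul_assoc,
      ← mul_assoc, pow_mul_comm']
  obtain ⟨p, q⟩ := j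
  -- Without a factor `y` the element is a power of `u`, which is an eigenvector for `v` as well;
  -- with such a factor conjugation by `u` alone annihilates it. Hence `y` need not be related to
  -- `v`.
  by_cases hq : q = 0
  · subst hq
    have hv : v * mon u y (p, 0) = ω ^ (p : ℕ) • (mon u y (p, 0) * v) := by
      simp [mon, h.v_mul_u_pow]
    rw [h.conjSum_of_mul hcomm hv, h.one_add_pow_add]
    simp only [Fin.val_zero, mul_zero, pow_zero]
    by_cases hp : p = 0
    · subst hp
      simp only [mon, Fin.val_zero, pow_zero, mul_one, dvd_zero, if_true, Prod.mk_zero_zero]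
      norm_num
    · rw [if_neg (by omega), if_neg (by rw [Prod.mk_eq_zero]; tauto), mul_zero, zero_smul]
  · rw [if_neg (by rw [Prod.mk_eq_zero]; tauto)]
    refine h.conjSum_eq_zero hcomm ?_
    have h12 : (q : ℕ) = 1 ∨ (q : ℕ) = 2 := by omega
    rcases h12 with e | e <;> simp only [e]
    · linear_combination (μ ^ 2 - μ + 1) * hμ
    · linear_combination hμ + (μ ^ 5 + μ ^ 2 + μ) * hμ3

end IsSymbolPair

end CubicClifford

/-! ### Symbol algebras of degree 3 -/

namespace CubicClifford

/-- This reduces the statements that monomials span to multiplying a monomial from the left by a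
generator. -/
theorem submodule_eq_top_of_adjoin {R A : Type*} [CommRing R] [Ring A] [Algebra R A] {S : Set A}
    (hS : Algebra.adjoin R S = ⊤) {M : Submodule R A} (h1 : 1 ∈ M)
    (hM : ∀ s ∈ S, ∀ m ∈ M, s * m ∈ M) : M = ⊤ := by
  have key : ∀ c ∈ Algebra.adjoin R S, ∀ m ∈ M, c * m ∈ M := by
    intro c hc
    induction hc using Algebra.adjoin_induction with
    | mem x hx => exact hM x hx
    | algebraMap r => exact fun m hm => (Algebra.smul_def r m) ▸ M.smul_mem r hm
    | add x y _ _ hx hy => exact fun m hm => (add_mul x y m) ▸ M.add_mem (hx m hm) (hy m hm)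
    | mul x y _ _ hx hy => exact fun m hm => (mul_assoc x y m) ▸ hx _ (hy m hm)
  refine eq_top_iff.2 fun c _ => ?_
  simpa using key c (hS ▸ Algebra.mem_top) 1 h1

theorem adjoin_mkAlgHom_ι {R : Type*} [CommRing R] {n : ℕ}
    (r : FreeAlgebra R (Fin n) → FreeAlgebra R (Fin n) → Prop) :
    Algebra.adjoin R (Set.range fun i => RingQuot.mkAlgHom R r (FreeAlgebra.ι R i)) = ⊤ := by
  have h := congrArg (Subalgebra.map (RingQuot.mkAlgHom R r)) (FreeAlgebra.adjoin_range_ι R (Fin n))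
  rw [AlgHom.map_adjoin, ← Set.range_comp, Algebra.map_top,
    (AlgHom.range_eq_top _).2 (RingQuot.mkAlgHom_surjective R r)] at h
  exact h

theorem pow_mul_pow_mem_span {R B : Type*} [CommRing R] [Ring B] [Algebra R B] {u v : B} {a b : R}
    (hu : u ^ 3 = algebraMap R B a) (hv : v ^ 3 = algebraMap R B b) (p q : ℕ) :
    u ^ p * v ^ q ∈ Submodule.span R (Set.range (mon u v)) := by
  have hp : u ^ p * v ^ q = (a ^ (p / 3) * b ^ (q / 3)) • (u ^ (p % 3) * v ^ (q % 3)) := by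
    conv_lhs => rw [← Nat.div_add_mod p 3, ← Nat.div_add_mod q 3, pow_add, pow_add, pow_mul,
      pow_mul, hu, hv, ← map_pow, ← map_pow, ← Algebra.smul_def, ← Algebra.smul_def]
    rw [smul_mul_smul_comm]
  rw [hp]
  exact Submodule.smul_mem _ _ (Submodule.subset_span
    ⟨(⟨p % 3, Nat.mod_lt _ (by norm_num)⟩, ⟨q % 3, Nat.mod_lt _ (by norm_num)⟩), rfl⟩)

section SymbolAlgebra

variable {K : Type*} [Field K] {ω a b : K}

/-- The generator `u` of `(a, b)_{3, K}`. -/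
noncomputable def symbolU (ω a b : K) : SymbolAlgebra K 3 ω a b :=
  RingQuot.mkAlgHom K (SymbolRel K 3 ω a b) (FreeAlgebra.ι K 0)

/-- The generator `v` of `(a, b)_{3, K}`. -/
noncomputable def symbolV (ω a b : K) : SymbolAlgebra K 3 ω a b :=
  RingQuot.mkAlgHom K (SymbolRel K 3 ω a b) (FreeAlgebra.ι K 1)

theorem symbolU_pow : symbolU ω a b ^ 3 = algebraMap K _ a := by
  have := RingQuot.mkAlgHom_rel K (SymbolRel.left (K := K) (n := 3) (ρ := ω) (a := a) (b := b))
  rwa [map_pow, AlgHom.commutes] at this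

theorem symbolV_pow : symbolV ω a b ^ 3 = algebraMap K _ b := by
  have := RingQuot.mkAlgHom_rel K (SymbolRel.right (K := K) (n := 3) (ρ := ω) (a := a) (b := b))
  rwa [map_pow, AlgHom.commutes] at this

theorem symbolV_mul_symbolU :
    symbolV ω a b * symbolU ω a b = ω • (symbolU ω a b * symbolV ω a b) := by
  have := RingQuot.mkAlgHom_rel K (SymbolRel.comm (K := K) (n := 3) (ρ := ω) (a := a) (b := b))
  rwa [map_mul, map_smul, map_mul] at this

theorem isSymbolPair_symbol (hω : ω ^ 2 + ω + 1 = 0) :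
    IsSymbolPair ω (symbolU ω a b) (symbolV ω a b) where
  sum_eq := hω
  rel := symbolV_mul_symbolU
  u_cube c := by
    rw [symbolU_pow]
    exact Algebra.commutes a c
  v_cube c := by
    rw [symbolV_pow]
    exact Algebra.commutes b c

theorem adjoin_symbol : Algebra.adjoin K {symbolU ω a b, symbolV ω a b} = ⊤ := by
  rw [← adjoin_mkAlgHom_ι (SymbolRel K 3 ω a b)]
  congr 1
  ext z
  simp [Fin.exists_fin_two, symbolU, symbolV, eq_comm]

theorem span_symbol (hω : ω ^ 2 + ω + 1 = 0) :
    Submodule.span K (Set.range (mon (symbolU ω a b) (symbolV ω a b))) = ⊤ := by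
  have hp := isSymbolPair_symbol (a := a) (b := b) hω
  have hmem := pow_mul_pow_mem_span (symbolU_pow (ω := ω) (a := a) (b := b)) symbolV_pow
  refine submodule_eq_top_of_adjoin adjoin_symbol (by simpa using hmem 0 0) ?_
  rintro s hs m hm
  induction hm using Submodule.span_induction with
  | mem x hx =>
    obtain ⟨i, rfl⟩ := hx
    rcases hs with rfl | rfl
    · rw [mon, ← mul_assoc, ← pow_succ']
      exact hmem _ _
    · rw [mon, ← mul_assoc, hp.v_mul_u_pow, smul_mul_assoc, mul_assoc, ← pow_succ']
      exact Submodule.smul_mem _ _ (hmem _ _)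
  | zero => simp
  | add x y _ _ hx hy =>
    rw [mul_add]
    exact add_mem hx hy
  | smul c x _ hx =>
    rw [mul_smul_comm]
    exact Submodule.smul_mem _ _ hx

/-- The relations hold for a diagonal matrix with entries `θ, ωθ, ω²θ`, `θ³ = a`, and a weighted
cyclic shift over an algebraic closure. This works for all `a` and `b`, zero included. -/
theorem nontrivial_symbol (hω : ω ^ 2 + ω + 1 = 0) : Nontrivial (SymbolAlgebra K 3 ω a b) := by
  let L := AlgebraicClosure K
  obtain ⟨θ, hθ⟩ := IsAlgClosed.exists_pow_nat_eq (algebraMap K L a) (n := 3) (by norm_num)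
  let w : L := algebraMap K L ω
  have hw : w ^ 2 + w + 1 = 0 := by
    have := congrArg (algebraMap K L) hω
    simpa using this
  have hw3 : w ^ 3 = 1 := by linear_combination (w - 1) * hw
  let U : Matrix (Fin 3) (Fin 3) L := Matrix.diagonal ![θ, w * θ, w ^ 2 * θ]
  let V : Matrix (Fin 3) (Fin 3) L := !![0, 1, 0; 0, 0, 1; algebraMap K L b, 0, 0]
  have hU : U ^ 3 = algebraMap K _ a := by
    rw [Matrix.diagonal_pow, Matrix.algebraMap_eq_diagonal, show algebraMap K (Fin 3 → L) a
      = fun _ => algebraMap K L a from rfl]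
    congr 1
    ext i
    fin_cases i
    · simp [hθ]
    · simp [mul_pow, hθ, hw3]
    · simp [mul_pow, hθ, ← pow_mul, show w ^ 6 = 1 by linear_combination (w ^ 3 + 1) * hw3]
  have hV : V ^ 3 = algebraMap K _ b := by
    rw [Matrix.algebraMap_eq_diagonal, pow_succ, pow_two, show algebraMap K (Fin 3 → L) b
      = fun _ => algebraMap K L b from rfl]
    ext i j
    fin_cases i <;> fin_cases j <;> simp [V, Matrix.mul_apply, Fin.sum_univ_three,
      Algebra.algebraMap_eq_smul_one]
  have hVU : V * U = ω • (U * V) := by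
    have hs : ∀ z : L, ω • z = w * z := fun z => Algebra.smul_def _ _
    ext i j
    rw [Matrix.smul_apply, hs, Matrix.mul_diagonal, Matrix.diagonal_mul]
    fin_cases i <;> fin_cases j <;> simp [V]
    · ring
    · linear_combination (-(algebraMap K L b * θ)) * hw3
  let f : SymbolAlgebra K 3 ω a b →ₐ[K] Matrix (Fin 3) (Fin 3) L :=
    RingQuot.liftAlgHom K ⟨FreeAlgebra.lift K ![U, V], by
      rintro _ _ (_ | _ | _)
      · simp [hU]
      · simp [hV]
      · simp [hVU]⟩
  exact f.toRingHom.domain_nontrivial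

theorem exists_conjSum_symbol (hω : ω ^ 2 + ω + 1 = 0) (c : SymbolAlgebra K 3 ω a b) :
    ∃ κ : K, conjSum (symbolU ω a b) (symbolV ω a b) c = algebraMap K _ κ := by
  have hp := isSymbolPair_symbol (a := a) (b := b) hω
  have hc : c ∈ Submodule.span K (Set.range (mon (symbolU ω a b) (symbolV ω a b))) := by
    rw [span_symbol hω]
    trivial
  induction hc using Submodule.span_induction with
  | mem x hx =>
    obtain ⟨i, rfl⟩ := hx
    rw [hp.conjSum_pow_mul_pow hω symbolV_mul_symbolU]
    split_ifs
    · exact ⟨9 * (b * a), by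
        rw [symbolU_pow, symbolV_pow, ← map_mul, Algebra.smul_def, ← map_mul]⟩
    · exact ⟨0, by simp⟩
  | zero => exact ⟨0, by simp [conjSum]⟩
  | add x y _ _ hx hy =>
    obtain ⟨κ, hκ⟩ := hx
    obtain ⟨μ, hμ⟩ := hy
    exact ⟨κ + μ, by rw [conjSum_add, hκ, hμ, map_add]⟩
  | smul c x _ hx =>
    obtain ⟨κ, hκ⟩ := hx
    exact ⟨c * κ, by
      rw [Algebra.smul_def, conjSum_mul_central _ (Algebra.commutes c), hκ, map_mul]⟩

/-- Symbol algebras of degree `3` are central simple. -/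
theorem isCentralSimpleOfDegree_symbol (hω : ω ^ 2 + ω + 1 = 0) (h3 : (3 : K) ≠ 0) (ha : a ≠ 0)
    (hb : b ≠ 0) : IsCentralSimpleOfDegree K (SymbolAlgebra K 3 ω a b) 3 := by
  have hp := isSymbolPair_symbol (a := a) (b := b) hω
  have hnt := nontrivial_symbol (a := a) (b := b) hω
  have h9 : (9 : K) * (b * a) ≠ 0 := by
    have : (9 : K) ≠ 0 := by convert pow_ne_zero 2 h3 using 1; norm_num
    positivity
  have hvu : symbolV ω a b ^ 3 * symbolU ω a b ^ 3 = algebraMap K _ (b * a) := by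
    rw [symbolU_pow, symbolV_pow, map_mul]
  have hvu2 : ∀ c : SymbolAlgebra K 3 ω a b,
      (9 : K) • ((symbolV ω a b ^ 3 * symbolU ω a b ^ 3) ^ 2 * c) = (9 * (b * a) ^ 2) • c := by
    intro c
    rw [hvu, ← map_pow, ← Algebra.smul_def, smul_smul]
  have h9' : 9 * (b * a) ^ 2 ≠ 0 := by
    rw [pow_two, ← mul_assoc]
    exact mul_ne_zero h9 (mul_ne_zero hb ha)
  -- Multiplying a linear relation by the dual monomial `comon i` and applying `conjSum` extracts
  -- the `i`-th coefficient.
  have hli : LinearIndependent K (mon (symbolU ω a b) (symbolV ω a b)) := by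
    rw [Fintype.linearIndependent_iff]
    intro g hg i
    have h0 := congrArg (fun c => conjSumHom K (symbolU ω a b) (symbolV ω a b)
      (c * comon (symbolU ω a b) (symbolV ω a b) i)) hg
    simp only [Finset.sum_mul, smul_mul_assoc, map_sum, map_smul, conjSumHom_apply,
      hp.conjSum_mon_mul_comon, zero_mul, map_zero, smul_ite, smul_zero, Finset.sum_ite_eq',
      Finset.mem_univ, if_true] at h0
    rw [← mul_one (_ ^ 2), hvu2, smul_smul] at h0
    exact (mul_eq_zero.1 ((smul_eq_zero.1 h0).resolve_right one_ne_zero)).resolve_right h9'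
  let B := Module.Basis.mk hli (span_symbol hω).ge
  refine ⟨⟨fun z hz => ?_⟩, ⟨⟨fun I => ?_⟩⟩, Module.Basis.finiteDimensional_of_finite B, ?_⟩
  -- For central `z`, `conjSum z = z · conjSum 1 = 9ba · z`, whereas `conjSum` takes only scalar
  -- values.
  · obtain ⟨κ, hκ⟩ := exists_conjSum_symbol hω z
    have hz' : ∀ d, Commute z d := fun d => (Subalgebra.mem_center_iff.1 hz d).symm
    have h1 := conjSum_mul_central (u := symbolU ω a b) (v := symbolV ω a b) 1 hz'
    have h2 := hp.conjSum_pow_mul_pow hω symbolV_mul_symbolU 0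
    rw [if_pos rfl, hvu, show mon (symbolU ω a b) (symbolV ω a b) 0 = 1 by simp [mon]] at h2
    rw [mul_one, hκ, h2, mul_smul_comm, ← (hz' _).symm.eq, ← Algebra.smul_def, smul_smul] at h1
    rw [Algebra.mem_bot]
    exact ⟨(9 * (b * a))⁻¹ * κ, by
      rw [map_mul, h1, ← Algebra.smul_def, smul_smul, inv_mul_cancel₀ h9, one_smul]⟩
  · by_cases hI : ∀ c ∈ I, c = 0
    · exact Or.inl (le_bot_iff.1 fun c hc => (TwoSidedIdeal.mem_bot _).2 (hI c hc))
    · push Not at hI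
      obtain ⟨c, hc, hc0⟩ := hI
      -- By the dual basis expansion, a nonzero `c` in the ideal has some nonzero `conjSum (c *
      -- comon i)`; it is a scalar and lies in the ideal.
      have h1 := hp.sum_conjSum_mul_comon c
      rw [hvu2] at h1
      obtain ⟨i, -, hi⟩ := Finset.exists_ne_zero_of_sum_ne_zero
        (h1 ▸ smul_ne_zero h9' hc0)
      obtain ⟨κ, hκ⟩ := exists_conjSum_symbol hω (c * comon (symbolU ω a b) (symbolV ω a b) i)
      have hκ0 : κ ≠ 0 := by
        rintro rfl
        rw [hκ, map_zero, zero_mul] at hi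
        exact hi rfl
      have hmem : conjSum (symbolU ω a b) (symbolV ω a b)
          (c * comon (symbolU ω a b) (symbolV ω a b) i) ∈ I :=
        conjSum_mem (I.mul_mem_right _ _ hc)
      right
      rw [← TwoSidedIdeal.one_mem_iff]
      have := I.mul_mem_left (algebraMap K _ κ⁻¹) _ hmem
      rwa [hκ, ← map_mul, inv_mul_cancel₀ hκ0, map_one] at this
  · rw [Module.finrank_eq_card_basis B]
    rfl

end SymbolAlgebra

end CubicClifford

/-! ### A criterion for Azumaya algebras, and comparison of ranks -/

open scoped TensorProduct

/-- An algebra with a trace form that has dual bases and is given by an element of the enveloping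
algebra is an Azumaya algebra. -/
theorem IsAzumaya.of_dualBases {R A ι κ : Type*} [CommRing R] [Ring A] [Algebra R A]
    [FaithfulSMul R A] [Fintype ι] [Fintype κ] (τ : A →ₗ[R] R) (a b : ι → A) (p q : κ → A)
    (h₁ : ∀ c, ∑ i, τ (c * b i) • a i = c) (h₂ : ∀ c, ∑ i, τ (a i * c) • b i = c)
    (hτ : ∀ c, algebraMap R A (τ c) = ∑ k, p k * c * q k) : IsAzumaya R A := by
  have hs : (Fintype.linearCombination R a).comp
      (LinearMap.pi fun i => τ.comp (LinearMap.mulRight R (b i))) = LinearMap.id := by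
    ext c
    simpa [Fintype.linearCombination_apply] using h₁ c
  have : Module.Projective R A := Module.Projective.of_split _ _ hs
  have : Module.Finite R A := Module.Finite.of_surjective (Fintype.linearCombination R a)
    fun c => ⟨_, LinearMap.congr_fun hs c⟩
  -- `e` maps `c ⊗ d` to `z ↦ τ(z c) d`. It is a second map, different from `mulLeftRight`, whose
  -- injectivity follows from the dual bases.
  let e : A ⊗[R] Aᵐᵒᵖ →ₗ[R] Module.End R A := TensorProduct.lift
    (LinearMap.mk₂ R (fun c d => (τ.comp (LinearMap.mulRight R c)).smulRight d.unop)
      (fun c c' d => by ext z; simp [mul_add, add_smul])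
      (fun r c d => by
        ext z
        simp only [LinearMap.smulRight_apply, LinearMap.comp_apply, LinearMap.mulRight_apply,
          mul_smul_comm, map_smul, LinearMap.smul_apply, smul_assoc])
      (fun c d d' => by ext z; simp)
      (fun r c d => by
        ext z
        simp only [LinearMap.smulRight_apply, MulOpposite.unop_smul, LinearMap.smul_apply]
        exact smul_comm _ _ _))
  let g : Module.End R A → A ⊗[R] Aᵐᵒᵖ := fun f => ∑ i, b i ⊗ₜ MulOpposite.op (f (a i))
  have hg : Function.LeftInverse g e := by
    intro t
    induction t with
    | zero => simp [g]
    | tmul c d =>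
      simp only [g, e, TensorProduct.lift.tmul, LinearMap.mk₂_apply, LinearMap.smulRight_apply,
        LinearMap.comp_apply, LinearMap.mulRight_apply, MulOpposite.op_smul, MulOpposite.op_unop,
        TensorProduct.tmul_smul, TensorProduct.smul_tmul', ← TensorProduct.sum_tmul, h₂]
    | add x y hx hy =>
      conv_rhs => rw [← hx, ← hy]
      simp [g, TensorProduct.tmul_add, Finset.sum_add_distrib]
  have hsurj : Function.Surjective (AlgHom.mulLeftRight R A) := by
    intro f
    -- `f(c) = ∑ τ(c b_i) f(a_i)` by linearity, and `hτ` writes each `τ(c b_i)` as `∑ p_k c b_i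
    -- q_k`.
    refine ⟨∑ i, ∑ k, (f (a i) * p k) ⊗ₜ MulOpposite.op (b i * q k), ?_⟩
    ext c
    conv_rhs => rw [← h₁ c, map_sum]
    simp only [map_sum, LinearMap.sum_apply, AlgHom.mulLeftRight_apply, MulOpposite.unop_op,
      map_smul]
    refine Finset.sum_congr rfl fun i _ => ?_
    rw [Algebra.smul_def, Algebra.commutes, hτ, Finset.mul_sum]
    simp only [mul_assoc]
  have : Module.Finite R (Module.End R A) :=
    Module.Finite.of_surjective (AlgHom.mulLeftRight R A).toLinearMap hsurj
  -- A surjection onto a finite module from a module that embeds into it is injective.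
  exact { bij := ⟨OrzechProperty.injective_of_surjective_of_injective e
    (AlgHom.mulLeftRight R A).toLinearMap hg.injective hsurj, hsurj⟩ }

theorem LocalizedModule.map_map_of_comp_eq_smul {R M N : Type*} [CommRing R] [AddCommGroup M]
    [Module R M] [AddCommGroup N] [Module R N] {g : N →ₗ[R] M} {h : M →ₗ[R] N} {r : R}
    (hgh : g.comp h = r • LinearMap.id) (S : Submonoid R) (z : LocalizedModule S M) :
    LocalizedModule.map S g (LocalizedModule.map S h z) = algebraMap R (Localization S) r • z := by
  induction z using LocalizedModule.induction_on with
  | h m s =>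
    have := LinearMap.congr_fun hgh m
    simp only [LinearMap.comp_apply, LinearMap.smul_apply, LinearMap.id_apply] at this
    rw [LocalizedModule.map_mk, LocalizedModule.map_mk, this, algebraMap_smul,
      LocalizedModule.smul'_mk]

/-- Modules that are isomorphic up to a scalar outside of `p` have the same rank at `p`. -/
theorem Module.rankAtStalk_eq_of_comp_eq_smul {R M N : Type*} [CommRing R] [AddCommGroup M]
    [Module R M] [AddCommGroup N] [Module R N] (g : N →ₗ[R] M) (h : M →ₗ[R] N) {r : R}
    (hgh : g.comp h = r • LinearMap.id) (hhg : h.comp g = r • LinearMap.id)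
    (p : PrimeSpectrum R) (hr : r ∉ p.asIdeal) :
    Module.rankAtStalk M p = Module.rankAtStalk N p := by
  have hu : IsUnit (algebraMap R (Localization.AtPrime p.asIdeal) r) :=
    IsLocalization.map_units _ (⟨r, hr⟩ : p.asIdeal.primeCompl)
  have e : LocalizedModule p.asIdeal.primeCompl N ≃ₗ[Localization.AtPrime p.asIdeal]
      LocalizedModule p.asIdeal.primeCompl M :=
    LinearEquiv.ofBijective (LocalizedModule.map p.asIdeal.primeCompl g) (by
      constructor
      · rw [injective_iff_map_eq_zero]
        intro z hz
        have := LocalizedModule.map_map_of_comp_eq_smul hhg p.asIdeal.primeCompl z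
        rw [hz, map_zero] at this
        exact (hu.smul_eq_zero.1 this.symm)
      · intro z
        obtain ⟨c, hc⟩ := hu
        refine ⟨LocalizedModule.map p.asIdeal.primeCompl h ((c⁻¹ : _ˣ) • z), ?_⟩
        rw [LocalizedModule.map_map_of_comp_eq_smul hgh, ← hc, ← Units.smul_def, smul_inv_smul])
  exact e.finrank_eq.symm

namespace CubicClifford

/-- `conjSum` as a linear map to the center. -/
def conjSumToCenter {B : Type*} [Ring B] {u v : B} (hT : ∀ c, conjSum u v c ∈ Subring.center B) :
    B →ₗ[Subring.center B] Subring.center B where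
  toFun c := ⟨conjSum u v c, hT c⟩
  map_add' c d := Subtype.ext (conjSum_add u v c d)
  map_smul' c d := Subtype.ext ((conjSumHom (Subring.center B) u v).map_smul c d)

namespace IsSymbolPair

/-- If the sums of conjugates lie in the center, the rank over the center is `9` wherever
`9 (v³ u³)²` does not vanish. -/
theorem rankAtStalk_eq {k B : Type*} [CommRing k] [Ring B] [Algebra k B] {ω : k} {u v : B}
    (h : IsSymbolPair ω u v) (hT : ∀ c, conjSum u v c ∈ Subring.center B) {r : Subring.center B}
    (hr : ∀ c, (9 : k) • ((v ^ 3 * u ^ 3) ^ 2 * c) = r • c) (p : PrimeSpectrum (Subring.center B))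
    (hrp : r ∉ p.asIdeal) : Module.rankAtStalk B p = 9 := by
  have : Nontrivial (Subring.center B) := p.nontrivial
  -- The free module of rank `9` is compared with `B`: coefficients go to combinations of monomials,
  -- and `c` goes back to the family `conjSum (c * comon i)`. Both composites are multiplication by
  -- `r`.
  rw [Module.rankAtStalk_eq_of_comp_eq_smul (Fintype.linearCombination (Subring.center B) (mon u v))
    (LinearMap.pi fun i => (conjSumToCenter hT).comp (LinearMap.mulRight _ (comon u v i))) ?_ ?_ p hrp]
  · rw [Module.rankAtStalk_eq_finrank_of_free]
    simp
  · ext c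
    have h1 := h.sum_conjSum_mul_comon c
    rw [hr] at h1
    simpa [Fintype.linearCombination_apply, conjSumToCenter, Subring.smul_def] using h1
  · refine (Pi.basisFun _ _).ext fun i => funext fun j => Subtype.ext ?_
    have h1 := h.conjSum_mon_mul_comon i j
    rw [← mul_one (_ ^ 2), hr] at h1
    by_cases hij : i = j
    · subst hij
      simp [conjSumToCenter, h1, Subring.smul_def]
    · simp [conjSumToCenter, h1, hij]

end IsSymbolPair

end CubicClifford

/-! ### The norm form, the two roots `S` and `S'`, and consequences of the frame relations -/

namespace CubicClifford

theorem norm_eq_prod {A : Type*} [CommRing A] {r t a b c : A} (hr : r ^ 2 + r + 1 = 0) :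
    (a + b * t + c * t ^ 2) * (a + r * b * t + r ^ 2 * c * t ^ 2)
      * (a + r ^ 2 * b * t + r * c * t ^ 2)
    = a ^ 3 + t ^ 3 * b ^ 3 + (t ^ 3) ^ 2 * c ^ 3 - 3 * t ^ 3 * a * b * c := by
  grind

/-- The norm form of `F(∛α)` is anisotropic. -/
theorem eq_zero_of_norm_eq_zero {F : Type*} [Field F] {ρ α : F} (hρ : ρ ^ 2 + ρ + 1 = 0)
    (hα : IsField (AdjoinRoot (Polynomial.X ^ 3 - Polynomial.C α))) {A B C : F}
    (h : A ^ 3 + α * B ^ 3 + α ^ 2 * C ^ 3 - 3 * α * A * B * C = 0) : B = 0 := by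
  have hρ0 : ρ ≠ 0 := by
    rintro rfl
    simp at hρ
  set p : Polynomial F := Polynomial.X ^ 3 - Polynomial.C α with hp
  have key : ∀ A' B' C' : F, AdjoinRoot.mk p (Polynomial.C A' + Polynomial.C B' * Polynomial.X
      + Polynomial.C C' * Polynomial.X ^ 2) = 0 → B' = 0 := by
    intro A' B' C' h'
    rw [AdjoinRoot.mk_eq_zero] at h'
    have hdeg : p.degree = 3 := Polynomial.degree_X_pow_sub_C (by norm_num) _
    have h0 := Polynomial.eq_zero_of_dvd_of_degree_lt h' (by
      rw [hdeg]
      refine lt_of_le_of_lt (b := 2) ?_ (by norm_num)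
      compute_degree)
    have := congrArg (fun q => Polynomial.coeff q 1) h0
    simpa [Polynomial.coeff_X, Polynomial.coeff_C] using this
  have hroot : (AdjoinRoot.root p) ^ 3 = AdjoinRoot.of p α := by
    have : (Polynomial.X ^ 3 - Polynomial.C α).eval₂ (AdjoinRoot.of p) (AdjoinRoot.root p) = 0 :=
      AdjoinRoot.eval₂_root p
    simpa [sub_eq_zero] using this
  have hρ' : AdjoinRoot.of p ρ ^ 2 + AdjoinRoot.of p ρ + 1 = 0 := by
    rw [← map_pow, ← map_add, ← map_one (AdjoinRoot.of p), ← map_add, hρ, map_zero]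
  have h' := congrArg (AdjoinRoot.of p) h
  simp only [map_add, map_sub, map_mul, map_pow, map_ofNat, map_zero, ← hroot] at h'
  have := hα.isDomain
  have hprod : AdjoinRoot.mk p (Polynomial.C A + Polynomial.C B * Polynomial.X
        + Polynomial.C C * Polynomial.X ^ 2)
      * AdjoinRoot.mk p (Polynomial.C A + Polynomial.C (ρ * B) * Polynomial.X
        + Polynomial.C (ρ ^ 2 * C) * Polynomial.X ^ 2)
      * AdjoinRoot.mk p (Polynomial.C A + Polynomial.C (ρ ^ 2 * B) * Polynomial.X
        + Polynomial.C (ρ * C) * Polynomial.X ^ 2) = 0 := by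
    simp only [map_add, map_mul, map_pow, AdjoinRoot.mk_X, AdjoinRoot.mk_C]
    rw [← norm_eq_prod hρ'] at h'
    exact h'
  rcases mul_eq_zero.1 hprod with h1 | h1
  · rcases mul_eq_zero.1 h1 with h1 | h1
    · exact key _ _ _ h1
    · exact (mul_eq_zero.1 (key _ _ _ h1)).resolve_left hρ0
  · exact (mul_eq_zero.1 (key _ _ _ h1)).resolve_left (pow_ne_zero 2 hρ0)

namespace Coeffs

variable {F : Type*} [Field F] {Φ : Coeffs F} {ρ : F}

/-- In terms of the coefficients of `w`, the part of the equation free of `S` is the norm of `-c₂ +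
R∛α - c₁∛α²`, the product `S S'` of the two roots. -/
theorem aeval_curve (hρ : ρ ^ 2 + ρ + 1 = 0) (hα : Φ.α ≠ 0) (h3 : (3 : F) ≠ 0) {A : Type*}
    [CommRing A] [Algebra F A] (P : Fin 2 → A) :
    MvPolynomial.aeval P (Φ.curve ρ) = (algebraMap F A Φ.D - algebraMap F A (ρ ^ 2 * Φ.e) * P 0) * P 1
      + P 1 ^ 2 + (algebraMap F A Φ.α * P 0 ^ 3
      - algebraMap F A (Φ.α ^ 2 * Φ.wCoeff₁ ρ ^ 3 + Φ.wCoeff₂ ^ 3)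
      - algebraMap F A (3 * Φ.α * Φ.wCoeff₁ ρ * Φ.wCoeff₂) * P 0) := by
  have e0 : ρ ^ 3 = 1 := by linear_combination (ρ - 1) * hρ
  have h9 : (9 : F) ≠ 0 := by convert pow_ne_zero 2 h3 using 1; norm_num
  have h27 : (27 : F) ≠ 0 := by convert pow_ne_zero 3 h3 using 1; norm_num
  have h729 : (729 : F) ≠ 0 := by convert pow_ne_zero 6 h3 using 1; norm_num
  have e1 : Φ.D₁ ^ 3 / (27 * Φ.α) = Φ.α ^ 2 * Φ.wCoeff₁ ρ ^ 3 := by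
    rw [wCoeff₁]
    field_simp
    linear_combination (-27 * Φ.D₁ ^ 3 * (ρ ^ 3 + 1)) * e0
  have e2 : Φ.D₂ ^ 3 / (729 * Φ.α ^ 3) = Φ.wCoeff₂ ^ 3 := by
    rw [wCoeff₂]
    field_simp
    norm_num
  have e3 : ρ ^ 2 * Φ.D₁ * Φ.D₂ / (9 * Φ.α) = 3 * Φ.α * Φ.wCoeff₁ ρ * Φ.wCoeff₂ := by
    rw [wCoeff₁, wCoeff₂]
    field_simp
  simp only [curve, map_add, map_sub, map_mul, map_pow, MvPolynomial.aeval_X, MvPolynomial.aeval_C]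
  simp only [← map_pow, ← map_mul, e1, e2, e3]
  simp only [map_mul, map_pow]
  ring

/-- On the curve, `S` and the other root `S' = ρ² e R - D - S` of its equation do not vanish
simultaneously. -/
theorem exists_mul_add_mul_eq_one (hρ : ρ ^ 2 + ρ + 1 = 0) (h3 : (3 : F) ≠ 0) (hα : Φ.α ≠ 0)
    (hα' : IsField (AdjoinRoot (Polynomial.X ^ 3 - Polynomial.C Φ.α))) (hD : Φ.D ≠ 0)
    {A : Type*} [CommRing A] [Algebra F A] {P : Fin 2 → A}
    (hP : MvPolynomial.aeval P (Φ.curve ρ) = 0) :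
    ∃ d d' : A, d * P 1
      + d' * (algebraMap F A (ρ ^ 2 * Φ.e) * P 0 - algebraMap F A Φ.D - P 1) = 1 := by
  rw [aeval_curve hρ hα h3] at hP
  by_cases he : Φ.e = 0
  · refine ⟨-algebraMap F A Φ.D⁻¹, -algebraMap F A Φ.D⁻¹, ?_⟩
    have h1 : algebraMap F A Φ.D⁻¹ * algebraMap F A Φ.D = 1 := by
      rw [← map_mul, inv_mul_cancel₀ hD, map_one]
    rw [he, mul_zero, map_zero, ← h1]
    ring
  · have hρ0 : ρ ≠ 0 := by
      rintro rfl
      simp at hρ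
    have hE : ρ ^ 2 * Φ.e ≠ 0 := mul_ne_zero (pow_ne_zero 2 hρ0) he
    set E := ρ ^ 2 * Φ.e
    -- `w₀` is the value of `R` at which `S + S'` vanishes, and `n` is the value of `S S'` there. It
    -- is a norm from `F(∛α)` of an element with middle coefficient `w₀ ≠ 0`, hence nonzero.
    set w₀ := Φ.D / E
    set n := Φ.α * w₀ ^ 3 - (Φ.α ^ 2 * Φ.wCoeff₁ ρ ^ 3 + Φ.wCoeff₂ ^ 3)
      - 3 * Φ.α * Φ.wCoeff₁ ρ * Φ.wCoeff₂ * w₀ with hn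
    have hn0 : n ≠ 0 := by
      intro h
      have := eq_zero_of_norm_eq_zero hρ hα' (A := -Φ.wCoeff₂) (B := w₀) (C := -Φ.wCoeff₁ ρ)
        (by rw [← h, hn]; ring)
      exact div_ne_zero hD hE this
    let q : A := algebraMap F A Φ.α * (P 0 ^ 2 + algebraMap F A w₀ * P 0 + algebraMap F A w₀ ^ 2)
      - algebraMap F A (3 * Φ.α * Φ.wCoeff₁ ρ * Φ.wCoeff₂)
    let S' : A := algebraMap F A E * P 0 - algebraMap F A Φ.D - P 1
    have hw : algebraMap F A E⁻¹ * (P 1 + S') = P 0 - algebraMap F A w₀ := by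
      have h1 : algebraMap F A E⁻¹ * algebraMap F A E = 1 := by
        rw [← map_mul, inv_mul_cancel₀ hE, map_one]
      have h2 : algebraMap F A w₀ = algebraMap F A E⁻¹ * algebraMap F A Φ.D := by
        rw [← map_mul]
        congr 1
        exact div_eq_inv_mul _ _
      rw [h2]
      linear_combination P 0 * h1
    have hnn : algebraMap F A n⁻¹ * algebraMap F A n = 1 := by
      rw [← map_mul, inv_mul_cancel₀ hn0, map_one]
    refine ⟨algebraMap F A n⁻¹ * (S' - algebraMap F A E⁻¹ * q),
      algebraMap F A n⁻¹ * (-(algebraMap F A E⁻¹ * q)), ?_⟩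
    -- `q` is the difference quotient of the norm at `R` and `w₀`, so `S S' - n = (R - w₀) q`, and
    -- `R - w₀ = E⁻¹(S + S')`.
    have key : P 1 * S' - algebraMap F A E⁻¹ * (P 1 + S') * q = algebraMap F A n := by
      rw [hw, hn]
      simp only [S', q, map_sub, map_add, map_mul, map_pow, map_ofNat] at hP ⊢
      linear_combination -hP
    rw [← hnn, ← key]
    ring

section Frame

variable {B : Type*} [Ring B] [Algebra F B] {x y₁ y₂ w : B}

theorem IsFrame.x_mul (h : Φ.IsFrame ρ x y₁ y₂ w) (z : B) : x * (x * (x * z)) = Φ.α • z := by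
  rw [← mul_assoc x x z, ← mul_assoc x _ z, h.x_cube, smul_mul_assoc, one_mul]

theorem IsFrame.y₁_mul_x_mul (h : Φ.IsFrame ρ x y₁ y₂ w) (z : B) :
    y₁ * (x * z) = ρ • (x * (y₁ * z)) := by
  rw [← mul_assoc, h.y₁_x, smul_mul_assoc, mul_assoc]

theorem IsFrame.y₂_mul_x_mul (h : Φ.IsFrame ρ x y₁ y₂ w) (z : B) :
    y₂ * (x * z) = ρ ^ 2 • (x * (y₂ * z)) := by
  rw [← mul_assoc, h.y₂_x, smul_mul_assoc, mul_assoc]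

theorem IsFrame.w_mul_x_mul (h : Φ.IsFrame ρ x y₁ y₂ w) (z : B) : w * (x * z) = x * (w * z) := by
  rw [← mul_assoc, h.w_x, mul_assoc]

theorem IsFrame.y₁_mul_w_mul (h : Φ.IsFrame ρ x y₁ y₂ w) (z : B) : y₁ * (w * z) = w * (y₁ * z) := by
  rw [← mul_assoc, ← h.w_y₁, mul_assoc]

theorem IsFrame.y₂_mul_w_mul (h : Φ.IsFrame ρ x y₁ y₂ w) (z : B) : y₂ * (w * z) = w * (y₂ * z) := by
  rw [← mul_assoc, ← h.w_y₂, mul_assoc]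

theorem IsFrame.y₂_mul_y₁_mul (h : Φ.IsFrame ρ x y₁ y₂ w) (z : B) :
    y₂ * (y₁ * z) = x * (w * z) - Φ.wCoeff₁ ρ • (x * (x * z)) - Φ.wCoeff₂ • z := by
  rw [← mul_assoc, h.y₂_y₁]
  simp only [sub_mul, smul_mul_assoc, mul_assoc, one_mul]

theorem IsFrame.y₁_mul_y₂_mul (h : Φ.IsFrame ρ x y₁ y₂ w) (z : B) :
    y₁ * (y₂ * z)
      = ρ • (x * (w * z)) - (ρ ^ 2 * Φ.wCoeff₁ ρ) • (x * (x * z)) - Φ.wCoeff₂ • z := by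
  rw [← mul_assoc, h.y₁_y₂]
  simp only [sub_mul, smul_mul_assoc, mul_assoc, one_mul]

/-- Both sides equal `q(x) y₁²`: on the right, `y₁² q(ρx) = q(ρ³x) y₁²`. -/
theorem IsFrame.y₁_cube_comm (hρ : ρ ^ 2 + ρ + 1 = 0) (h : Φ.IsFrame ρ x y₁ y₂ w) :
    y₂ * y₁ ^ 3 = y₁ ^ 3 * y₂ := by
  simp only [pow_succ' (_ : B), pow_zero, mul_one, mul_assoc, h.y₂_mul_y₁_mul, h.y₁_y₂, mul_sub,
    mul_smul_comm, h.y₁_mul_x_mul, h.y₁_mul_w_mul, h.y₁_x, h.w_y₁.symm, smul_smul]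
  match_scalars <;> grind (ematch := 0)

theorem IsFrame.y₂_cube_comm (hρ : ρ ^ 2 + ρ + 1 = 0) (h : Φ.IsFrame ρ x y₁ y₂ w) :
    y₁ * y₂ ^ 3 = y₂ ^ 3 * y₁ := by
  simp only [pow_succ' (_ : B), pow_zero, mul_one, mul_assoc, h.y₁_mul_y₂_mul, h.y₂_y₁, mul_sub,
    mul_smul_comm, h.y₂_mul_x_mul, h.y₂_mul_w_mul, h.y₂_x, h.w_y₂.symm, smul_smul]
  match_scalars <;> grind (ematch := 0)

theorem IsFrame.y₁_cube_x (hρ : ρ ^ 2 + ρ + 1 = 0) (h : Φ.IsFrame ρ x y₁ y₂ w) :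
    y₁ ^ 3 * x = x * y₁ ^ 3 := by
  rw [IsSymbolPair.pow_mul_of_mul h.y₁_x, show ρ ^ 3 = 1 by linear_combination (ρ - 1) * hρ,
    one_smul]

theorem IsFrame.y₂_cube_x (hρ : ρ ^ 2 + ρ + 1 = 0) (h : Φ.IsFrame ρ x y₁ y₂ w) :
    y₂ ^ 3 * x = x * y₂ ^ 3 := by
  rw [IsSymbolPair.pow_mul_of_mul h.y₂_x,
    show (ρ ^ 2) ^ 3 = 1 by linear_combination (ρ ^ 3 + 1) * (ρ - 1) * hρ, one_smul]

theorem IsFrame.y₂_cube_eq (h : Φ.IsFrame ρ x y₁ y₂ w) :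
    y₂ ^ 3 = (ρ ^ 2 * Φ.e) • w - Φ.D • 1 - y₁ ^ 3 := by
  rw [← h.cubes]
  noncomm_ring

/-- Contracting `y₂y₁ = q(x)` from the inside and moving the results past `y₂` produces the three
conjugates of `q(x)`; their product is the norm. -/
theorem IsFrame.cube_mul_cube (hρ : ρ ^ 2 + ρ + 1 = 0) (h : Φ.IsFrame ρ x y₁ y₂ w) :
    y₂ ^ 3 * y₁ ^ 3 = Φ.α • w ^ 3 - (Φ.α ^ 2 * Φ.wCoeff₁ ρ ^ 3 + Φ.wCoeff₂ ^ 3) • 1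
      - (3 * Φ.α * Φ.wCoeff₁ ρ * Φ.wCoeff₂) • w := by
  simp only [pow_succ' (_ : B), pow_zero, mul_one, mul_assoc, h.y₂_mul_y₁_mul, h.y₂_y₁, mul_sub,
    mul_smul_comm, h.y₂_mul_x_mul, h.y₂_mul_w_mul, smul_sub, smul_smul,
    h.x_cube, h.x_mul, h.w_x, h.w_mul_x_mul]
  match_scalars <;> grind (ematch := 0)

end Frame

end Coeffs

end CubicClifford

/-! ### The center and its map from the coordinate ring -/

namespace CubicClifford

namespace Coeffs

variable {F : Type*} [Field F] {Φ : Coeffs F} {ρ : F}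

theorem aeval_curve_eq_zero (hρ : ρ ^ 2 + ρ + 1 = 0) (hα : Φ.α ≠ 0) (h3 : (3 : F) ≠ 0)
    {A : Type*} [CommRing A] [Algebra F A] {R S S' : A}
    (hS : S' = algebraMap F A (ρ ^ 2 * Φ.e) * R - algebraMap F A Φ.D - S)
    (h : S' * S = algebraMap F A Φ.α * R ^ 3
      - algebraMap F A (Φ.α ^ 2 * Φ.wCoeff₁ ρ ^ 3 + Φ.wCoeff₂ ^ 3)
      - algebraMap F A (3 * Φ.α * Φ.wCoeff₁ ρ * Φ.wCoeff₂) * R) :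
    MvPolynomial.aeval ![R, S] (Φ.curve ρ) = 0 := by
  rw [aeval_curve hρ hα h3]
  simp only [Matrix.cons_val_zero, Matrix.cons_val_one]
  rw [← h, hS]
  ring

theorem eq_of_mul_eq_mul {A : Type*} [CommRing A] {a b s s' d d' : A} (h : a * s = b * s)
    (h' : a * s' = b * s') (hd : d * s + d' * s' = 1) : a = b := by
  linear_combination d * h + d' * h' - (a - b) * hd

variable (Φ ρ) in
/-- The standing assumptions on `Φ` and `ρ`. -/
structure IsAdmissible : Prop where
  sum_eq : ρ ^ 2 + ρ + 1 = 0
  two_ne : (2 : F) ≠ 0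
  three_ne : (3 : F) ≠ 0
  isField : IsField (AdjoinRoot (Polynomial.X ^ 3 - Polynomial.C Φ.α))
  D_ne : Φ.D ≠ 0

namespace IsAdmissible

variable (H : Φ.IsAdmissible ρ)

include H

theorem α_ne : Φ.α ≠ 0 := ne_zero_of_isField_adjoinRoot H.isField

theorem frame : Φ.IsFrame ρ Φ.x (Φ.yComp ρ 1) (Φ.yComp ρ 2) (Φ.w ρ) :=
  isFrame H.sum_eq H.two_ne H.three_ne H.α_ne

theorem adjoin_eq_top : Algebra.adjoin F {Φ.x, Φ.yComp ρ 1, Φ.yComp ρ 2} = ⊤ := by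
  rw [eq_top_iff, ← adjoin_mkAlgHom_ι (PappacenaRel F 2 3 Φ.form), Algebra.adjoin_le_iff]
  set S := Algebra.adjoin F {Φ.x, Φ.yComp ρ 1, Φ.yComp ρ 2}
  have hx : Φ.x ∈ S := Algebra.subset_adjoin (by simp)
  have h1 : Φ.yComp ρ 1 ∈ S := Algebra.subset_adjoin (by simp)
  have h2 : Φ.yComp ρ 2 ∈ S := Algebra.subset_adjoin (by simp)
  rintro _ ⟨i, rfl⟩
  fin_cases i
  · exact hx
  · change Φ.y ∈ S
    rw [y_eq H.sum_eq H.two_ne H.three_ne H.α_ne]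
    exact add_mem (add_mem (add_mem (add_mem (S.smul_mem (one_mem S) _) (S.smul_mem hx _))
      (S.smul_mem (mul_mem hx hx) _)) h1) h2

end IsAdmissible

variable (Φ ρ) in
/-- A frame that generates the algebra, with the standing assumptions. -/
structure IsGeneratingFrame {B : Type*} [Ring B] [Algebra F B] (x y₁ y₂ w : B) : Prop
    extends Φ.IsAdmissible ρ, Φ.IsFrame ρ x y₁ y₂ w where
  adjoin_eq : Algebra.adjoin F {x, y₁, y₂} = ⊤

theorem IsAdmissible.isGeneratingFrame (H : Φ.IsAdmissible ρ) :
    Φ.IsGeneratingFrame ρ Φ.x (Φ.yComp ρ 1) (Φ.yComp ρ 2) (Φ.w ρ) where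
  toIsAdmissible := H
  toIsFrame := H.frame
  adjoin_eq := H.adjoin_eq_top

namespace IsGeneratingFrame

variable {B : Type*} [Ring B] [Algebra F B] {x y₁ y₂ w : B}
  (H : Φ.IsGeneratingFrame ρ x y₁ y₂ w)

include H

theorem x_pow_three : x ^ 3 = algebraMap F B Φ.α := by
  rw [Algebra.algebraMap_eq_smul_one, ← H.x_cube, pow_succ, pow_two, mul_assoc]

theorem commute_of_generators {z : B} (hx : Commute z x) (h1 : Commute z (y₁))
    (h2 : Commute z (y₂)) (c : B) : Commute z c := by
  have hle : Algebra.adjoin F {x, y₁, y₂} ≤ Subalgebra.centralizer F {z} := by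
    rw [Algebra.adjoin_le_iff]
    rintro g hg y rfl
    rcases hg with rfl | rfl | rfl
    · exact hx
    · exact h1
    · exact h2
  rw [H.adjoin_eq] at hle
  exact hle (Algebra.mem_top (x := c)) z rfl

theorem commute_w (c : B) : Commute (w) c :=
  H.commute_of_generators H.toIsFrame.w_x H.toIsFrame.w_y₁ H.toIsFrame.w_y₂ c

theorem commute_y₁_cube (c : B) : Commute (y₁ ^ 3) c :=
  H.commute_of_generators (H.toIsFrame.y₁_cube_x H.sum_eq) ((Commute.refl _).pow_left 3)
    (H.toIsFrame.y₁_cube_comm H.sum_eq).symm c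

theorem commute_y₂_cube (c : B) : Commute (y₂ ^ 3) c :=
  H.commute_of_generators (H.toIsFrame.y₂_cube_x H.sum_eq)
    (H.toIsFrame.y₂_cube_comm H.sum_eq).symm ((Commute.refl _).pow_left 3) c

theorem isSymbolPair₁ : IsSymbolPair ρ x (y₁) where
  sum_eq := H.sum_eq
  rel := H.toIsFrame.y₁_x
  u_cube c := by
    rw [H.x_pow_three]
    exact Algebra.commutes _ c
  v_cube := H.commute_y₁_cube

theorem isSymbolPair₂ : IsSymbolPair (ρ ^ 2) x (y₂) where
  sum_eq := H.isSymbolPair₁.sq_sum_eq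
  rel := H.toIsFrame.y₂_x
  u_cube := H.isSymbolPair₁.u_cube
  v_cube := H.commute_y₂_cube

/-- `w` as an element of the center. -/
noncomputable def wCenter : Subalgebra.center F B :=
  ⟨w, Subalgebra.mem_center_iff.2 fun c => (H.commute_w c).symm⟩

/-- `y_1³` as an element of the center. -/
noncomputable def sCenter : Subalgebra.center F B :=
  ⟨y₁ ^ 3, Subalgebra.mem_center_iff.2 fun c => (H.commute_y₁_cube c).symm⟩

/-- `y_2³` as an element of the center. -/
noncomputable def sCenter' : Subalgebra.center F B :=
  ⟨y₂ ^ 3, Subalgebra.mem_center_iff.2 fun c => (H.commute_y₂_cube c).symm⟩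

theorem sCenter'_eq : H.sCenter' = algebraMap F _ (ρ ^ 2 * Φ.e) * H.wCenter - algebraMap F _ Φ.D
    - H.sCenter := by
  apply Subtype.ext
  have := H.toIsFrame.y₂_cube_eq
  rwa [Algebra.smul_def, ← Algebra.algebraMap_eq_smul_one] at this

theorem aeval_curve_center :
    MvPolynomial.aeval ![H.wCenter, H.sCenter] (Φ.curve ρ) = 0 := by
  have h : H.sCenter' * H.sCenter = algebraMap F _ Φ.α * H.wCenter ^ 3
      - algebraMap F _ (Φ.α ^ 2 * Φ.wCoeff₁ ρ ^ 3 + Φ.wCoeff₂ ^ 3)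
      - algebraMap F _ (3 * Φ.α * Φ.wCoeff₁ ρ * Φ.wCoeff₂) * H.wCenter := by
    apply Subtype.ext
    have := H.toIsFrame.cube_mul_cube H.sum_eq
    rwa [Algebra.smul_def, Algebra.smul_def, Algebra.smul_def, mul_one] at this
  exact aeval_curve_eq_zero H.sum_eq H.α_ne H.three_ne H.sCenter'_eq h

/-- The map from the coordinate ring of `E` to the center of `C_Φ`. -/
noncomputable def toCenter : Φ.CoordRing ρ →ₐ[F] Subalgebra.center F B :=
  Ideal.Quotient.liftₐ _ (MvPolynomial.aeval ![H.wCenter, H.sCenter]) (by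
    intro a ha
    have hle : Ideal.span {Φ.curve ρ}
        ≤ RingHom.ker (MvPolynomial.aeval ![H.wCenter, H.sCenter] : _ →ₐ[F] _) := by
      rw [Ideal.span_singleton_le_iff_mem]
      exact H.aeval_curve_center
    exact hle ha)

theorem toCenter_mk (p : MvPolynomial (Fin 2) F) :
    H.toCenter (Ideal.Quotient.mk _ p) = MvPolynomial.aeval ![H.wCenter, H.sCenter] p := rfl

theorem toCenter_coord_zero : H.toCenter (Φ.coord ρ 0) = H.wCenter := by
  rw [coord, toCenter_mk, MvPolynomial.aeval_X]
  rfl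

theorem toCenter_coord_one : H.toCenter (Φ.coord ρ 1) = H.sCenter := by
  rw [coord, toCenter_mk, MvPolynomial.aeval_X]
  rfl

/-- `C_Φ` is an algebra over the coordinate ring of `E`. -/
noncomputable abbrev algebraCoordRing : Algebra (Φ.CoordRing ρ) B :=
  ((Subalgebra.center F B).val.comp H.toCenter).toRingHom.toAlgebra'
    fun κ c => (Subalgebra.mem_center_iff.1 (H.toCenter κ).2 c).symm

/-- `C_Φ` is generated, as a module over the coordinate ring of `E`, by the monomials
`x^i y_1^j` and `x^i y_2^j`. -/
theorem span_eq_top : letI := H.algebraCoordRing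
    Submodule.span (Φ.CoordRing ρ) (Set.range (mon x (y₁))
      ∪ Set.range (mon x (y₂))) = ⊤ := by
  let := H.algebraCoordRing
  have : IsScalarTower F (Φ.CoordRing ρ) B := IsScalarTower.of_algebraMap_eq fun r =>
    (((Subalgebra.center F B).val.comp H.toCenter).commutes r).symm
  set M := Submodule.span (Φ.CoordRing ρ) (Set.range (mon x (y₁))
      ∪ Set.range (mon x (y₂))) with hM
  have fr := H.toIsFrame
  have hw : ∀ m ∈ M, w * m ∈ M := fun m hm => by
    have := M.smul_mem (Φ.coord ρ 0) hm
    rw [Algebra.smul_def] at this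
    change (H.toCenter (Φ.coord ρ 0) : B) * m ∈ M at this
    rwa [H.toCenter_coord_zero] at this
  have hF : ∀ (c : F), ∀ m ∈ M, c • m ∈ M := fun c m hm =>
    (M.restrictScalars F).smul_mem c hm
  have hxx : ∀ (p : ℕ) (z : B), x ^ p * (x * z) = x ^ (p + 1) * z := fun p z => by
    rw [← mul_assoc, pow_succ]
  have hxw : ∀ (p : ℕ) (z : B), x ^ p * (w * z) = w * (x ^ p * z) := fun p z => by
    rw [← mul_assoc, ← (H.commute_w _).eq, mul_assoc]
  have hx3 : x ^ 3 = algebraMap (Φ.CoordRing ρ) B (algebraMap F _ Φ.α) := by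
    rw [← IsScalarTower.algebraMap_apply, H.x_pow_three]
  have hs : y₁ ^ 3 = algebraMap (Φ.CoordRing ρ) B (Φ.coord ρ 1) := by
    change _ = (H.toCenter (Φ.coord ρ 1) : B)
    rw [H.toCenter_coord_one]
    rfl
  have hs' : y₂ ^ 3 = algebraMap (Φ.CoordRing ρ) B
      (algebraMap F _ (ρ ^ 2 * Φ.e) * Φ.coord ρ 0 - algebraMap F _ Φ.D - Φ.coord ρ 1) := by
    change _ = (H.toCenter _ : B)
    rw [map_sub, map_sub, map_mul, AlgHom.commutes, AlgHom.commutes, H.toCenter_coord_one,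
      H.toCenter_coord_zero, ← H.sCenter'_eq]
    rfl
  have m1 : ∀ p q : ℕ, x ^ p * y₁ ^ q ∈ M := fun p q =>
    Submodule.span_mono Set.subset_union_left (pow_mul_pow_mem_span hx3 hs p q)
  have m2 : ∀ p q : ℕ, x ^ p * y₂ ^ q ∈ M := fun p q =>
    Submodule.span_mono Set.subset_union_right (pow_mul_pow_mem_span hx3 hs' p q)
  have key : M.restrictScalars F = ⊤ := by
    refine submodule_eq_top_of_adjoin H.adjoin_eq (by simpa using m1 0 0) ?_
    intro g hg m hm
    change g * m ∈ M
    replace hm : m ∈ M := hm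
    induction hm using Submodule.span_induction with
    | zero => simp
    | add a b _ _ ha hb =>
      rw [mul_add]
      exact M.add_mem ha hb
    | smul κ a _ ha =>
      rw [mul_smul_comm]
      exact M.smul_mem κ ha
    | mem a ha =>
      rcases ha with ⟨⟨i, j⟩, rfl⟩ | ⟨⟨i, j⟩, rfl⟩ <;> simp only [mon] <;> rcases hg with rfl | rfl | rfl
      · rw [← mul_assoc, ← pow_succ']
        exact m1 _ _
      · rw [← mul_assoc, H.isSymbolPair₁.v_mul_u_pow, smul_mul_assoc, mul_assoc, ← pow_succ']
        exact hF _ _ (m1 _ _)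
      · rw [← mul_assoc, H.isSymbolPair₂.v_mul_u_pow, smul_mul_assoc, mul_assoc]
        refine hF _ _ ?_
        -- For `j > 0` the product `y₂y₁` is replaced by `q(x)`, which lowers the exponent of `y₁`;
        -- for `j = 0` a monomial of the other family results.
        rcases Nat.eq_zero_or_eq_succ_pred (j : ℕ) with e | e
        · rw [e]
          simpa using m2 i 1
        · rw [e, pow_succ', fr.y₂_mul_y₁_mul, mul_sub, mul_sub]
          simp only [mul_smul_comm, hxx, hxw]
          exact sub_mem (sub_mem (hw _ (m1 _ _)) (hF _ _ (m1 _ _))) (hF _ _ (m1 _ _))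
      · rw [← mul_assoc, ← pow_succ']
        exact m2 _ _
      · rw [← mul_assoc, H.isSymbolPair₁.v_mul_u_pow, smul_mul_assoc, mul_assoc]
        refine hF _ _ ?_
        rcases Nat.eq_zero_or_eq_succ_pred (j : ℕ) with e | e
        · rw [e]
          simpa using m1 i 1
        · rw [e, pow_succ', fr.y₁_mul_y₂_mul, mul_sub, mul_sub]
          simp only [mul_smul_comm, hxx, hxw]
          exact sub_mem (sub_mem (hF _ _ (hw _ (m2 _ _))) (hF _ _ (m2 _ _))) (hF _ _ (m2 _ _))
      · rw [← mul_assoc, H.isSymbolPair₂.v_mul_u_pow, smul_mul_assoc, mul_assoc, ← pow_succ']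
        exact hF _ _ (m2 _ _)
  exact eq_top_iff.2 fun c _ => by
    have : c ∈ M.restrictScalars F := key ▸ Submodule.mem_top
    exact this

/-- Both sums are the same trace up to the factors `9αS` and `9αS'`: on each spanning monomial both
vanish, except on `1`, where `κ = 1`. The common `κ` is what allows gluing. -/
theorem exists_conjSum (c : B) : ∃ κ : Φ.CoordRing ρ,
    conjSum x (y₁) c = (H.toCenter κ * ((9 * Φ.α) • H.sCenter) : Subalgebra.center F _) ∧
    conjSum x (y₂) c
      = (H.toCenter κ * ((9 * Φ.α) • H.sCenter') : Subalgebra.center F _) := by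
  let := H.algebraCoordRing
  have hc : c ∈ Submodule.span (Φ.CoordRing ρ) (Set.range (mon x (y₁))
      ∪ Set.range (mon x (y₂))) := by
    rw [H.span_eq_top]
    trivial
  have e : ∀ z : B, (9 : F) • (z * x ^ 3) = (9 * Φ.α) • z := fun z => by
    rw [H.x_pow_three, ← Algebra.commutes, ← Algebra.smul_def, smul_smul]
  have hq := H.isSymbolPair₁.sq_sum_eq
  induction hc using Submodule.span_induction with
  | mem c hc =>
    rcases hc with ⟨i, rfl⟩ | ⟨i, rfl⟩
    · rw [H.isSymbolPair₁.conjSum_pow_mul_pow H.sum_eq H.toIsFrame.y₁_x,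
        H.isSymbolPair₂.conjSum_pow_mul_pow H.sum_eq H.toIsFrame.y₁_x]
      split_ifs with hi
      · exact ⟨1, by rw [map_one, one_mul, e]; rfl, by rw [map_one, one_mul, e]; rfl⟩
      · exact ⟨0, by simp, by simp⟩
    · rw [H.isSymbolPair₁.conjSum_pow_mul_pow hq H.toIsFrame.y₂_x,
        H.isSymbolPair₂.conjSum_pow_mul_pow hq H.toIsFrame.y₂_x]
      split_ifs with hi
      · exact ⟨1, by rw [map_one, one_mul, e]; rfl, by rw [map_one, one_mul, e]; rfl⟩
      · exact ⟨0, by simp, by simp⟩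
  | zero => exact ⟨0, by simp [conjSum], by simp [conjSum]⟩
  | add a b _ _ ha hb =>
    obtain ⟨κ, h1, h2⟩ := ha
    obtain ⟨μ, h3, h4⟩ := hb
    exact ⟨κ + μ, by rw [conjSum_add, h1, h3, map_add, add_mul]; rfl,
      by rw [conjSum_add, h2, h4, map_add, add_mul]; rfl⟩
  | smul ν a _ ha =>
    obtain ⟨κ, h1, h2⟩ := ha
    have hν : ν • a = (H.toCenter ν : B) * a := rfl
    have hc : ∀ d, Commute (H.toCenter ν : B) d :=
      fun d => (Subalgebra.mem_center_iff.1 (H.toCenter ν).2 d).symm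
    exact ⟨ν * κ, by rw [hν, conjSum_mul_central _ hc, h1, map_mul, mul_assoc]; rfl,
      by rw [hν, conjSum_mul_central _ hc, h2, map_mul, mul_assoc]; rfl⟩

theorem exists_mul_sCenter_add : ∃ d d' : Φ.CoordRing ρ,
    H.toCenter d * H.sCenter + H.toCenter d' * H.sCenter' = 1 := by
  have hP : MvPolynomial.aeval (Φ.coord ρ) (Φ.curve ρ) = 0 := by
    have : MvPolynomial.aeval (Φ.coord ρ) (Φ.curve ρ) = Ideal.Quotient.mk _ (Φ.curve ρ) := by
      have h : (MvPolynomial.aeval (Φ.coord ρ) : _ →ₐ[F] Φ.CoordRing ρ)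
          = Ideal.Quotient.mkₐ F (Ideal.span {Φ.curve ρ}) := by
        ext i
        simp [coord]
      rw [h]
      rfl
    rw [this, Ideal.Quotient.eq_zero_iff_mem]
    exact Ideal.mem_span_singleton_self _
  obtain ⟨d, d', h⟩ := exists_mul_add_mul_eq_one H.sum_eq H.three_ne H.α_ne H.isField H.D_ne hP
  refine ⟨d, d', ?_⟩
  rw [H.sCenter'_eq, ← H.toCenter_coord_zero, ← H.toCenter_coord_one, ← map_one H.toCenter, ← h]
  simp only [map_add, map_mul, map_sub, AlgHom.commutes]

/-- For central `z` the sums of conjugates are `z · 9αS` and `z · 9αS'`. Comparison with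
`exists_conjSum` gives `zS = κS` and `zS' = κS'`, and `S`, `S'` generate the unit ideal. -/
theorem toCenter_surjective : Function.Surjective H.toCenter := by
  intro z
  obtain ⟨κ, h1, h2⟩ := H.exists_conjSum z
  have hz : ∀ d, Commute (z : B) d := fun d => (Subalgebra.mem_center_iff.1 z.2 d).symm
  have e : ∀ c : B, (9 : F) • (c * x ^ 3) = (9 * Φ.α) • c := fun c => by
    rw [H.x_pow_three, ← Algebra.commutes, ← Algebra.smul_def, smul_smul]
  have hone : ∀ y : B, mon x y 0 = 1 := fun y => by simp [mon]
  have e1 := H.isSymbolPair₁.conjSum_pow_mul_pow H.sum_eq H.toIsFrame.y₁_x 0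
  have e2 := H.isSymbolPair₂.conjSum_pow_mul_pow H.isSymbolPair₁.sq_sum_eq H.toIsFrame.y₂_x 0
  rw [if_pos rfl, hone, e] at e1 e2
  have h9 : 9 * Φ.α ≠ 0 :=
    mul_ne_zero (by convert pow_ne_zero 2 H.three_ne using 1; norm_num) H.α_ne
  rw [← mul_one (z : B), conjSum_mul_central _ hz] at h1 h2
  rw [e1] at h1
  rw [e2] at h2
  have h1' : z * H.sCenter = H.toCenter κ * H.sCenter := by
    have : (9 * Φ.α) • (z * H.sCenter) = (9 * Φ.α) • (H.toCenter κ * H.sCenter) := by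
      rw [← mul_smul_comm, ← mul_smul_comm]
      exact Subtype.ext h1
    exact (smul_right_injective _ h9) this
  have h2' : z * H.sCenter' = H.toCenter κ * H.sCenter' := by
    have : (9 * Φ.α) • (z * H.sCenter') = (9 * Φ.α) • (H.toCenter κ * H.sCenter') := by
      rw [← mul_smul_comm, ← mul_smul_comm]
      exact Subtype.ext h2
    exact (smul_right_injective _ h9) this
  obtain ⟨d, d', hd⟩ := H.exists_mul_sCenter_add
  exact ⟨κ, (eq_of_mul_eq_mul h1' h2' hd).symm⟩

end IsGeneratingFrame

end Coeffs

end CubicClifford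

/-! ### The Azumaya property and the rank -/

namespace CubicClifford

namespace Coeffs

namespace IsGeneratingFrame

variable {F : Type*} [Field F] {Φ : Coeffs F} {ρ : F}
variable {B : Type*} [Ring B] [Algebra F B] {x y₁ y₂ w : B}
  (H : Φ.IsGeneratingFrame ρ x y₁ y₂ w)

include H

/-- Here `t₁ = 9αS`, `t₂ = 9αS'` and `e = 1/9`, since `9(αS)² = (9αS)²/9`. -/
theorem exists_center_data : ∃ t₁ t₂ e : Subring.center B, IsCoprime t₁ t₂ ∧ IsUnit e ∧
    (∀ c, ∃ κ : Subring.center B,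
      conjSum x y₁ c = (κ * t₁ : Subring.center B) ∧ conjSum x y₂ c = (κ * t₂ : Subring.center B)) ∧
    (∀ c, (9 : F) • ((y₁ ^ 3 * x ^ 3) ^ 2 * c) = (e * t₁ ^ 2) • c) ∧
    (∀ c, (9 : F) • ((y₂ ^ 3 * x ^ 3) ^ 2 * c) = (e * t₂ ^ 2) • c) := by
  have h9 : (9 : F) ≠ 0 := by convert pow_ne_zero 2 H.three_ne using 1; norm_num
  have h9' : 9 * Φ.α ≠ 0 := mul_ne_zero h9 H.α_ne
  let ι : F → Subring.center B := fun c =>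
    ⟨algebraMap F B c, Subring.mem_center_iff.2 fun b => (Algebra.commutes c b).symm⟩
  have hι : ∀ {c : F}, c ≠ 0 → ι c⁻¹ * ι c = 1 := fun {c} hc =>
    Subtype.ext (by
      change algebraMap F B _ * algebraMap F B _ = 1
      rw [← map_mul, inv_mul_cancel₀ hc, map_one])
  have hsq : ∀ y : B, (∀ c, Commute (y ^ 3) c) → ∀ c, (9 : F) • ((y ^ 3 * x ^ 3) ^ 2 * c)
      = algebraMap F B 9⁻¹ * (algebraMap F B (9 * Φ.α) * y ^ 3) ^ 2 * c := by
    intro y hy c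
    rw [H.x_pow_three, (hy _).eq]
    simp only [← Algebra.smul_def, smul_pow, smul_mul_assoc, smul_smul]
    congr 1
    field_simp
  obtain ⟨d, d', hd⟩ := H.exists_mul_sCenter_add
  let j : Subalgebra.center F B → Subring.center B := fun z =>
    ⟨z, Subring.mem_center_iff.2 (Subalgebra.mem_center_iff.1 z.2)⟩
  refine ⟨ι (9 * Φ.α) * j H.sCenter, ι (9 * Φ.α) * j H.sCenter', ι 9⁻¹,
    ⟨ι (9 * Φ.α)⁻¹ * j (H.toCenter d), ι (9 * Φ.α)⁻¹ * j (H.toCenter d'), ?_⟩, ?_, fun c => ?_,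
    fun c => hsq _ H.commute_y₁_cube c, fun c => hsq _ H.commute_y₂_cube c⟩
  · have hd' : j (H.toCenter d) * j H.sCenter + j (H.toCenter d') * j H.sCenter' = 1 :=
      Subtype.ext (congrArg Subtype.val hd)
    have := hι h9'
    linear_combination hd' + (j (H.toCenter d) * j H.sCenter + j (H.toCenter d') * j H.sCenter') * this
  · exact IsUnit.of_mul_eq_one (ι 9) (hι h9)
  · obtain ⟨κ, h1, h2⟩ := H.exists_conjSum c
    refine ⟨j (H.toCenter κ), ?_, ?_⟩
    · rw [h1, Algebra.smul_def]
      rfl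
    · rw [h2, Algebra.smul_def]
      rfl

/-- An algebra with a generating frame is Azumaya over its center, of constant rank `9`. -/
theorem isAzumaya_and_rankAtStalk : IsAzumaya (Subring.center B) B ∧
    ∀ p : PrimeSpectrum (Subring.center B), Module.rankAtStalk B p = 9 := by
  obtain ⟨t₁, t₂, e, ht, he, hT, h1, h2⟩ := H.exists_center_data
  have hT1 : ∀ c, conjSum x y₁ c ∈ Subring.center B := fun c => by
    obtain ⟨κ, h, -⟩ := hT c
    rw [h]
    exact (κ * t₁).2
  have hT2 : ∀ c, conjSum x y₂ c ∈ Subring.center B := fun c => by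
    obtain ⟨κ, -, h⟩ := hT c
    rw [h]
    exact (κ * t₂).2
  obtain ⟨z₁, z₂, hz⟩ : IsCoprime (e * t₁ ^ 2) (e * t₂ ^ 2) :=
    (isCoprime_mul_unit_left he _ _).2 (ht.pow (m := 2) (n := 2))
  constructor
  · obtain ⟨a₁, a₂, ha⟩ := ht
    -- As `a₁t₁ + a₂t₂ = 1`, this combination of `κt₁` and `κt₂` recovers `κ`: it is the glued
    -- trace.
    let τ : B →ₗ[Subring.center B] Subring.center B :=
      a₁ • conjSumToCenter hT1 + a₂ • conjSumToCenter hT2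
    have hτ : ∀ c, conjSum x y₁ c = (τ c * t₁ : Subring.center B) ∧
        conjSum x y₂ c = (τ c * t₂ : Subring.center B) := by
      intro c
      obtain ⟨κ, hκ1, hκ2⟩ := hT c
      have hc : τ c = κ := by
        have e1 : conjSumToCenter hT1 c = κ * t₁ := Subtype.ext hκ1
        have e2 : conjSumToCenter hT2 c = κ * t₂ := Subtype.ext hκ2
        simp only [τ, LinearMap.add_apply, LinearMap.smul_apply, smul_eq_mul, e1, e2]
        linear_combination κ * ha
      rw [hc]
      exact ⟨hκ1, hκ2⟩
    have hsum : ∀ c : B, z₁ • (e * t₁ ^ 2) • c + z₂ • (e * t₂ ^ 2) • c = c := fun c => by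
      rw [smul_smul, smul_smul, ← add_smul, hz, one_smul]
    -- The dual bases of the two charts are joined. The weights `z₁t₁` and `z₂t₂` come from the
    -- partition `z₁et₁² + z₂et₂² = 1`, one factor `t₁` or `t₂` being absorbed in `conjSum = τ · t`.
    refine IsAzumaya.of_dualBases τ
      (Sum.elim (fun i => (z₁ * t₁) • mon x y₁ i) (fun i => (z₂ * t₂) • mon x y₂ i))
      (Sum.elim (comon x y₁) (comon x y₂))
      (Sum.elim (fun i => (a₁ : B) * mon x y₁ i) (fun i => (a₂ : B) * mon x y₂ i))
      (Sum.elim (comon x y₁) (comon x y₂)) (fun c => ?_) (fun c => ?_) (fun c => ?_)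
    · have e1 := H.isSymbolPair₁.sum_conjSum_mul_comon c
      have e2 := H.isSymbolPair₂.sum_conjSum_mul_comon c
      simp only [h1, h2, (hτ _).1, (hτ _).2] at e1 e2
      simp only [Fintype.sum_sum_type, Sum.elim_inl, Sum.elim_inr]
      refine Eq.trans ?_ (hsum c)
      rw [← e1, ← e2, Finset.smul_sum, Finset.smul_sum]
      congr 1 <;> refine Finset.sum_congr rfl fun i _ => ?_
      · rw [smul_smul, mul_left_comm, mul_smul]
        rfl
      · rw [smul_smul, mul_left_comm, mul_smul]
        rfl
    · have e1 := H.isSymbolPair₁.sum_comon_mul_conjSum c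
      have e2 := H.isSymbolPair₂.sum_comon_mul_conjSum c
      simp only [h1, h2, (hτ _).1, (hτ _).2] at e1 e2
      simp only [Fintype.sum_sum_type, Sum.elim_inl, Sum.elim_inr, smul_mul_assoc, map_smul]
      refine Eq.trans ?_ (hsum c)
      rw [← e1, ← e2, Finset.smul_sum, Finset.smul_sum]
      congr 1 <;> refine Finset.sum_congr rfl fun i _ => ?_
      · rw [smul_eq_mul, mul_assoc, mul_smul, mul_comm t₁, Subring.mem_center_iff.1 (_ * t₁).2]
        rfl
      · rw [smul_eq_mul, mul_assoc, mul_smul, mul_comm t₂, Subring.mem_center_iff.1 (_ * t₂).2]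
        rfl
    · change ((a₁ : B) * conjSum x y₁ c + a₂ * conjSum x y₂ c) = _
      simp only [Fintype.sum_sum_type, Sum.elim_inl, Sum.elim_inr, conjSum, Finset.mul_sum,
        mul_assoc]
  · intro p
    -- A prime cannot contain both scalars, so one of the two charts computes the rank at `p`.
    by_cases hp : e * t₁ ^ 2 ∈ p.asIdeal
    · refine H.isSymbolPair₂.rankAtStalk_eq hT2 h2 p fun hp' => ?_
      refine p.isPrime.ne_top ((Ideal.eq_top_iff_one _).2 ?_)
      rw [← hz]
      exact add_mem (Ideal.mul_mem_left _ _ hp) (Ideal.mul_mem_left _ _ hp')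
    · exact H.isSymbolPair₁.rankAtStalk_eq hT1 h1 p hp

end IsGeneratingFrame

end Coeffs

end CubicClifford

/-! ### Frames in the symbol algebras at the points of `E` -/

namespace CubicClifford

section SkewPartner

variable {K B : Type*} [Field K] [Ring B] [Algebra K B] {ω a s : K} {X Y : B}

/-- The solution `Z` of `Z Y = c₁ X - c₂ X² - c₃`, if `Y³ = s ≠ 0`. -/
noncomputable def skewPartner (X Y : B) (s c₁ c₂ c₃ : K) : B :=
  (c₁ • X - c₂ • (X * X) - c₃ • 1) * (s⁻¹ • (Y * Y))

variable (c₁ c₂ c₃ : K)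

theorem skewPartner_mul_self (hs : s ≠ 0) (hY : Y * (Y * Y) = s • 1) :
    skewPartner X Y s c₁ c₂ c₃ * Y = c₁ • X - c₂ • (X * X) - c₃ • 1 := by
  rw [skewPartner, mul_assoc, smul_mul_assoc, mul_assoc, hY, smul_smul, inv_mul_cancel₀ hs,
    one_smul, mul_one]

theorem mul_quadratic_of_rel (hYX : Y * X = ω • (X * Y)) (c₁ c₂ c₃ : K) :
    Y * (c₁ • X - c₂ • (X * X) - c₃ • 1)
      = ((ω * c₁) • X - (ω ^ 2 * c₂) • (X * X) - c₃ • 1) * Y := by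
  have h : Y * (X * X) = (ω ^ 2) • (X * X * Y) := by
    rw [← mul_assoc, hYX, smul_mul_assoc, mul_assoc, hYX, mul_smul_comm, smul_smul, ← pow_two,
      mul_assoc]
  simp only [mul_sub, sub_mul, mul_smul_comm, smul_mul_assoc, h, hYX, mul_one, one_mul, smul_smul]
  rw [mul_comm c₁, mul_comm c₂]

theorem self_mul_skewPartner (hs : s ≠ 0) (hY : Y * (Y * Y) = s • 1)
    (hYX : Y * X = ω • (X * Y)) :
    Y * skewPartner X Y s c₁ c₂ c₃ = (ω * c₁) • X - (ω ^ 2 * c₂) • (X * X) - c₃ • 1 := by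
  rw [skewPartner, ← mul_assoc, mul_quadratic_of_rel hYX, mul_assoc, mul_smul_comm, hY, smul_smul,
    inv_mul_cancel₀ hs, one_smul, mul_one]

theorem skewPartner_mul (hYX : Y * X = ω • (X * Y)) :
    skewPartner X Y s c₁ c₂ c₃ * X = (ω ^ 2) • (X * skewPartner X Y s c₁ c₂ c₃) := by
  have h : Y * Y * X = (ω ^ 2) • (X * (Y * Y)) := by
    rw [mul_assoc, hYX, mul_smul_comm, ← mul_assoc, hYX, smul_mul_assoc, smul_smul, ← pow_two,
      mul_assoc]
  have h' : (c₁ • X - c₂ • (X * X) - c₃ • 1) * X = X * (c₁ • X - c₂ • (X * X) - c₃ • 1) := by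
    simp only [sub_mul, mul_sub, smul_mul_assoc, mul_smul_comm, mul_assoc, mul_one, one_mul]
  rw [skewPartner, mul_assoc, smul_mul_assoc, h]
  simp only [mul_smul_comm]
  rw [← mul_assoc _ X, h', mul_assoc, smul_comm]

/-- All factors are polynomials in `X`, so the identity is checked in the commutative ring `K[X]`
modulo `X³ - a`. -/
theorem quadratic_norm (hω : ω ^ 2 + ω + 1 = 0) (hX : X * (X * X) = a • 1) :
    (c₁ • X - c₂ • (X * X) - c₃ • 1)
      * (((ω * (ω * c₁)) • X - (ω ^ 2 * (ω ^ 2 * c₂)) • (X * X) - c₃ • 1)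
      * ((ω * c₁) • X - (ω ^ 2 * c₂) • (X * X) - c₃ • 1))
      = (a * c₁ ^ 3 - (a ^ 2 * c₂ ^ 3 + c₃ ^ 3) - 3 * a * c₁ * c₂ * c₃) • 1 := by
  have hp : ∀ d₁ d₂ d₃ : K, d₁ • X - d₂ • (X * X) - d₃ • (1 : B)
      = Polynomial.aeval X (Polynomial.C d₁ * Polynomial.X - Polynomial.C d₂ * Polynomial.X ^ 2
        - Polynomial.C d₃) := fun d₁ d₂ d₃ => by
    simp [Algebra.smul_def, pow_two]
  have hX3 : Polynomial.aeval X (Polynomial.X ^ 3 - Polynomial.C a) = 0 := by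
    rw [map_sub, map_pow, Polynomial.aeval_X, Polynomial.aeval_C, pow_succ', pow_two, hX,
      Algebra.algebraMap_eq_smul_one, sub_self]
  have hC : Polynomial.C ω ^ 2 + Polynomial.C ω + 1 = 0 := by
    simpa using congrArg Polynomial.C hω
  rw [hp, hp, hp, ← map_mul, ← map_mul, ← sub_eq_zero, ← Algebra.algebraMap_eq_smul_one,
    ← Polynomial.aeval_C X, ← map_sub]
  have hw3 : Polynomial.C ω ^ 3 = 1 := by linear_combination (Polynomial.C ω - 1) * hC
  have hdvd : ∃ q : Polynomial K, (Polynomial.C c₁ * Polynomial.X - Polynomial.C c₂ * Polynomial.X ^ 2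
        - Polynomial.C c₃) * ((Polynomial.C (ω * (ω * c₁)) * Polynomial.X
        - Polynomial.C (ω ^ 2 * (ω ^ 2 * c₂)) * Polynomial.X ^ 2 - Polynomial.C c₃)
        * (Polynomial.C (ω * c₁) * Polynomial.X
        - Polynomial.C (ω ^ 2 * c₂) * Polynomial.X ^ 2 - Polynomial.C c₃))
        - Polynomial.C (a * c₁ ^ 3 - (a ^ 2 * c₂ ^ 3 + c₃ ^ 3) - 3 * a * c₁ * c₂ * c₃)
        = (Polynomial.X ^ 3 - Polynomial.C a) * q := by
    refine ⟨Polynomial.C c₁ ^ 3 - Polynomial.C c₂ ^ 3 * (Polynomial.X ^ 3 + Polynomial.C a)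
      - 3 * Polynomial.C c₁ * Polynomial.C c₂ * Polynomial.C c₃, ?_⟩
    simp only [map_sub, map_add, map_mul, map_pow, Polynomial.C_ofNat]
    generalize Polynomial.C c₁ = p at *
    generalize Polynomial.C c₂ = q at *
    generalize Polynomial.C c₃ = r at *
    generalize Polynomial.C ω = o at *
    have ho2 : o ^ 2 = -o - 1 := by linear_combination hC
    grind
  obtain ⟨q, hq⟩ := hdvd
  rw [hq, map_mul, hX3, zero_mul]

/-- The partner is `q(X)T` with `T = Y⁻¹`, here `q(X) = c₁X - c₂X² - c₃`. Moving `T` to the right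
substitutes `ω²X` for `X`, so the cube is `q(X) q(ω²X) q(ωX) T³`. -/
theorem skewPartner_cube (hω : ω ^ 2 + ω + 1 = 0) (hs : s ≠ 0) (hX : X * (X * X) = a • 1)
    (hY : Y * (Y * Y) = s • 1) (hYX : Y * X = ω • (X * Y)) :
    skewPartner X Y s c₁ c₂ c₃ * (skewPartner X Y s c₁ c₂ c₃ * skewPartner X Y s c₁ c₂ c₃)
      = (s⁻¹ * (a * c₁ ^ 3 - (a ^ 2 * c₂ ^ 3 + c₃ ^ 3) - 3 * a * c₁ * c₂ * c₃)) • 1 := by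
  have hw3 : ω ^ 3 = 1 := by linear_combination (ω - 1) * hω
  set T : B := s⁻¹ • (Y * Y) with hT
  have hTY : T * Y = 1 := by
    rw [hT, smul_mul_assoc, mul_assoc, hY, smul_smul, inv_mul_cancel₀ hs, one_smul]
  have hYT : Y * T = 1 := by
    rw [hT, mul_smul_comm, hY, smul_smul, inv_mul_cancel₀ hs, one_smul]
  have hT3 : T * (T * T) = s⁻¹ • 1 := by
    have h1 : T * (T * (T * (Y * (Y * Y)))) = 1 := by
      rw [← mul_assoc T Y, hTY, one_mul, ← mul_assoc T Y, hTY, one_mul, hTY]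
    rw [hY, mul_smul_comm, mul_smul_comm, mul_smul_comm, mul_one] at h1
    rw [← h1, smul_smul, inv_mul_cancel₀ hs, one_smul]
  have move : ∀ d₁ d₂ d₃ : K, T * ((ω * d₁) • X - (ω ^ 2 * d₂) • (X * X) - d₃ • 1)
      = (d₁ • X - d₂ • (X * X) - d₃ • 1) * T := fun d₁ d₂ d₃ => by
    have h := congrArg (fun z => T * (z * T)) (mul_quadratic_of_rel (X := X) hYX d₁ d₂ d₃)
    simp only [mul_assoc, hYT, mul_one] at h
    rw [← h, ← mul_assoc T, hTY, one_mul]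
  have e₁ : T * (c₁ • X - c₂ • (X * X) - c₃ • 1)
      = ((ω * (ω * c₁)) • X - (ω ^ 2 * (ω ^ 2 * c₂)) • (X * X) - c₃ • 1) * T := by
    rw [← move]
    congr 4
    · linear_combination (-c₁) * hw3
    · linear_combination (-c₂ * (ω ^ 3 + 1)) * hw3
  have e₂ := move (ω * c₁) (ω ^ 2 * c₂) c₃
  change _ * T * (_ * T * (_ * T)) = _
  simp only [mul_assoc]
  rw [← mul_assoc T (c₁ • X - c₂ • (X * X) - c₃ • 1) (T * _),
    ← mul_assoc T (c₁ • X - c₂ • (X * X) - c₃ • 1) T, e₁]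
  simp only [mul_assoc]
  rw [← mul_assoc T _ (T * T), e₂, mul_assoc, hT3, mul_smul_comm, mul_smul_comm, mul_smul_comm,
    mul_one, quadratic_norm c₁ c₂ c₃ hω hX, smul_smul]
  simp only [mul_assoc]

end SkewPartner

namespace Coeffs

variable {F : Type*} [Field F] {Φ : Coeffs F} {ρ : F} {K : Type*} [Field K] [Algebra F K]
  {B : Type*} [Ring B] [Algebra K B] [Algebra F B] [IsScalarTower F K B] {X Y : B} {R S : K}

theorem aeval_curve_point (hρ : ρ ^ 2 + ρ + 1 = 0) (hα : Φ.α ≠ 0) (h3 : (3 : F) ≠ 0)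
    (hP : MvPolynomial.aeval ![R, S] (Φ.curve ρ) = 0) :
    (algebraMap F K Φ.D - algebraMap F K ρ ^ 2 * algebraMap F K Φ.e * R) * S + S ^ 2
      + algebraMap F K Φ.α * R ^ 3
      - (algebraMap F K Φ.α ^ 2 * algebraMap F K (Φ.wCoeff₁ ρ) ^ 3
        + algebraMap F K Φ.wCoeff₂ ^ 3)
      - 3 * algebraMap F K Φ.α * algebraMap F K (Φ.wCoeff₁ ρ) * algebraMap F K Φ.wCoeff₂ * R
      = 0 := by
  rw [aeval_curve hρ hα h3] at hP
  simp only [Matrix.cons_val_zero, Matrix.cons_val_one, map_mul, map_pow, map_add,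
    map_ofNat] at hP
  linear_combination hP

/-- With `y₁ = Y` invertible, `y₂ = q(x) y₁⁻¹` is forced. Its cube is the norm divided by `S`, which
the equation of `E` identifies with `S'`. -/
theorem isFrame_of_ne_zero (hρ : ρ ^ 2 + ρ + 1 = 0) (hα : Φ.α ≠ 0) (h3 : (3 : F) ≠ 0)
    (hP : MvPolynomial.aeval ![R, S] (Φ.curve ρ) = 0) (hS : S ≠ 0)
    (hX : X * (X * X) = algebraMap F K Φ.α • 1) (hY : Y * (Y * Y) = S • 1)
    (hYX : Y * X = algebraMap F K ρ • (X * Y)) :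
    Φ.IsFrame ρ X Y (skewPartner X Y S R (algebraMap F K (Φ.wCoeff₁ ρ)) (algebraMap F K Φ.wCoeff₂))
      (algebraMap K B R) := by
  have e := aeval_curve_point hρ hα h3 hP
  have hρK : algebraMap F K ρ ^ 2 + algebraMap F K ρ + 1 = 0 := by
    simpa using congrArg (algebraMap F K) hρ
  have sm : ∀ (c : F) (z : B), c • z = algebraMap F K c • z := fun c z =>
    (algebraMap_smul K c z).symm
  have hW : ∀ z : B, z * algebraMap K B R = R • z := fun z => by
    rw [← Algebra.commutes, Algebra.smul_def]
  have hW' : ∀ z : B, algebraMap K B R * z = z * algebraMap K B R := fun z => Algebra.commutes _ _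
  constructor
  · rw [sm, hX]
  · rw [sm, hYX]
  · rw [sm, skewPartner_mul _ _ _ hYX, map_pow]
  · rw [skewPartner_mul_self _ _ _ hS hY, sm, sm, hW]
  · rw [self_mul_skewPartner _ _ _ hS hY hYX, sm, sm, sm, hW, smul_smul, map_mul, map_pow]
  · exact hW' _
  · exact hW' _
  · exact hW' _
  · rw [skewPartner_cube _ _ _ hρK hS hX hY hYX, hY, sm, sm, Algebra.algebraMap_eq_smul_one R,
      smul_smul, ← add_smul, ← sub_smul]
    congr 1
    rw [map_mul, map_pow]
    field_simp
    linear_combination e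

/-- Now `y₂ = Y` is the invertible component, and `y₁y₂ = q(ρx)` forces `y₁ = q(ρx) y₂⁻¹`, which
explains the powers of `ρ` in the coefficients of the partner. The cube of `y₁` vanishes because the
norm `S S'` does. -/
theorem isFrame_of_eq_zero (hρ : ρ ^ 2 + ρ + 1 = 0) (hα : Φ.α ≠ 0) (h3 : (3 : F) ≠ 0)
    (hP : MvPolynomial.aeval ![R, S] (Φ.curve ρ) = 0) (hS : S = 0) {S' : K}
    (hS' : S' = algebraMap F K (ρ ^ 2 * Φ.e) * R - algebraMap F K Φ.D) (hS'0 : S' ≠ 0)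
    (hX : X * (X * X) = algebraMap F K Φ.α • 1) (hY : Y * (Y * Y) = S' • 1)
    (hXY : X * Y = algebraMap F K ρ • (Y * X)) :
    ∃ Y₁, Y₁ ^ 3 = 0 ∧ Φ.IsFrame ρ X Y₁ Y (algebraMap K B R) := by
  have e := aeval_curve_point hρ hα h3 hP
  have hρK : algebraMap F K ρ ^ 2 + algebraMap F K ρ + 1 = 0 := by
    simpa using congrArg (algebraMap F K) hρ
  have hq : (algebraMap F K ρ ^ 2) ^ 2 + algebraMap F K ρ ^ 2 + 1 = 0 := by
    linear_combination (algebraMap F K ρ ^ 2 - algebraMap F K ρ + 1) * hρK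
  have h31 : algebraMap F K ρ ^ 3 = 1 := by
    linear_combination (algebraMap F K ρ - 1) * hρK
  have hYX : Y * X = (algebraMap F K ρ ^ 2) • (X * Y) := by
    rw [hXY, smul_smul, ← pow_succ, h31, one_smul]
  have sm : ∀ (c : F) (z : B), c • z = algebraMap F K c • z := fun c z =>
    (algebraMap_smul K c z).symm
  have hW : ∀ z : B, z * algebraMap K B R = R • z := fun z => by
    rw [← Algebra.commutes, Algebra.smul_def]
  have hW' : ∀ z : B, algebraMap K B R * z = z * algebraMap K B R := fun z => Algebra.commutes _ _
  set Y₁ : B := skewPartner X Y S' (algebraMap F K ρ * R)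
    (algebraMap F K ρ ^ 2 * algebraMap F K (Φ.wCoeff₁ ρ)) (algebraMap F K Φ.wCoeff₂) with hY₁
  have hcube : Y₁ * (Y₁ * Y₁) = 0 := by
    rw [hY₁, skewPartner_cube _ _ _ hq hS'0 hX hY hYX]
    convert zero_smul K (1 : B) using 2
    refine mul_eq_zero_of_right _ ?_
    rw [hS] at e
    generalize algebraMap F K ρ = o at *
    linear_combination e + (algebraMap F K Φ.α * R ^ 3 - (o ^ 3 + 1) * algebraMap F K Φ.α ^ 2
      * algebraMap F K (Φ.wCoeff₁ ρ) ^ 3 - 3 * algebraMap F K Φ.α * R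
      * algebraMap F K (Φ.wCoeff₁ ρ) * algebraMap F K Φ.wCoeff₂) * h31
  refine ⟨Y₁, by rw [pow_succ', pow_two, hcube], ?_⟩
  constructor
  · rw [sm, hX]
  · rw [sm, hY₁, skewPartner_mul _ _ _ hYX, ← pow_mul, pow_succ _ 3, h31, one_mul]
  · rw [sm, hYX, map_pow]
  · rw [hY₁, self_mul_skewPartner _ _ _ hS'0 hY hYX, sm, sm, hW]
    congr 3
    · linear_combination R * h31
    · linear_combination (algebraMap F K (Φ.wCoeff₁ ρ) * (algebraMap F K ρ ^ 3 + 1)) * h31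
  · rw [hY₁, skewPartner_mul_self _ _ _ hS'0 hY, sm, sm, sm, hW, smul_smul, map_mul, map_pow]
  · exact hW' _
  · exact hW' _
  · exact hW' _
  · rw [hcube, hY, zero_add, hS', sm, sm, Algebra.algebraMap_eq_smul_one R, smul_smul, ← sub_smul]

variable (Φ ρ) in
/-- `(a, b)` are the parameters of the symbol algebra attached to the point `(R, S)`. -/
def IsSymbolParam (R S a b : K) : Prop :=
  (S ≠ 0 ∧ a = algebraMap F K Φ.α ∧ b = S) ∨
    (S = 0 ∧ a = algebraMap F K (ρ ^ 2 * Φ.e) * R - algebraMap F K Φ.D ∧ b = algebraMap F K Φ.α)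

variable (Φ ρ) in
theorem exists_isSymbolParam (R S : K) : ∃ a b, Φ.IsSymbolParam ρ R S a b := by
  by_cases hS : S = 0
  · exact ⟨_, _, Or.inr ⟨hS, rfl, rfl⟩⟩
  · exact ⟨_, _, Or.inl ⟨hS, rfl, rfl⟩⟩

namespace IsAdmissible

variable (H : Φ.IsAdmissible ρ) (hP : MvPolynomial.aeval ![R, S] (Φ.curve ρ) = 0)

include H

variable (K) in
theorem map_sum_eq : algebraMap F K ρ ^ 2 + algebraMap F K ρ + 1 = 0 := by
  simpa using congrArg (algebraMap F K) H.sum_eq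

variable (K) in
theorem map_three_ne : (3 : K) ≠ 0 := by
  rw [← map_ofNat (algebraMap F K) 3]
  exact (map_ne_zero _).2 H.three_ne

variable (K) in
theorem map_α_ne : algebraMap F K Φ.α ≠ 0 := (map_ne_zero _).2 H.α_ne

include hP

theorem param_ne_zero (hS : S = 0) :
    algebraMap F K (ρ ^ 2 * Φ.e) * R - algebraMap F K Φ.D ≠ 0 := by
  intro h0
  obtain ⟨d, d', h⟩ := exists_mul_add_mul_eq_one H.sum_eq H.three_ne H.α_ne H.isField H.D_ne hP
  simp only [Matrix.cons_val_zero, Matrix.cons_val_one] at h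
  rw [h0, hS] at h
  simp at h

theorem isCentralSimpleOfDegree_symbol {a b : K} (hab : Φ.IsSymbolParam ρ R S a b) :
    IsCentralSimpleOfDegree K (SymbolAlgebra K 3 (algebraMap F K ρ) a b) 3 := by
  rcases hab with ⟨hS, rfl, rfl⟩ | ⟨hS, rfl, rfl⟩
  · exact CubicClifford.isCentralSimpleOfDegree_symbol (H.map_sum_eq K) (H.map_three_ne K)
      (H.map_α_ne K) hS
  · exact CubicClifford.isCentralSimpleOfDegree_symbol (H.map_sum_eq K) (H.map_three_ne K)
      (H.param_ne_zero hP hS) (H.map_α_ne K)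

/-- For `S ≠ 0` the generators `u, v` are the images of `x, y₁`. For `S = 0` they are the images of
`y₂, x`, in this order. -/
theorem exists_algHom_symbol {a b : K} (hab : Φ.IsSymbolParam ρ R S a b) :
    ∃ f : Φ.Alg →ₐ[F] SymbolAlgebra K 3 (algebraMap F K ρ) a b,
      f (Φ.w ρ) = algebraMap K _ R ∧ f (Φ.yComp ρ 1 ^ 3) = algebraMap K _ S ∧
      symbolU (algebraMap F K ρ) a b ∈ f.range ∧ symbolV (algebraMap F K ρ) a b ∈ f.range := by
  have hu : symbolU (algebraMap F K ρ) a b * (symbolU _ a b * symbolU _ a b) = a • 1 := by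
    rw [← Algebra.algebraMap_eq_smul_one, ← symbolU_pow, pow_succ', pow_two]
  have hv : symbolV (algebraMap F K ρ) a b * (symbolV _ a b * symbolV _ a b) = b • 1 := by
    rw [← Algebra.algebraMap_eq_smul_one, ← symbolV_pow, pow_succ', pow_two]
  have hvu := symbolV_mul_symbolU (ω := algebraMap F K ρ) (a := a) (b := b)
  rcases hab with ⟨hS, rfl, rfl⟩ | ⟨hS, rfl, rfl⟩
  · obtain ⟨f, h0, h1, -, hw⟩ := (isFrame_of_ne_zero H.sum_eq H.α_ne H.three_ne hP hS hu hv
      hvu).exists_algHom H.sum_eq H.two_ne H.three_ne H.α_ne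
    exact ⟨f, hw, by rw [map_pow, h1, symbolV_pow], ⟨_, h0⟩, ⟨_, h1⟩⟩
  · obtain ⟨Y₁, hY₁, hfr⟩ := isFrame_of_eq_zero H.sum_eq H.α_ne H.three_ne hP hS rfl
      (H.param_ne_zero hP hS) hv hu hvu
    obtain ⟨f, h0, h1, h2, hw⟩ := hfr.exists_algHom H.sum_eq H.two_ne H.three_ne H.α_ne
    exact ⟨f, hw, by rw [map_pow, h1, hY₁, hS, map_zero], ⟨_, h2⟩, ⟨_, h0⟩⟩

end IsAdmissible

end Coeffs

end CubicClifford

/-! ### Injectivity of `F[E] → Z`, and ideals determined by the center -/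

namespace CubicClifford

namespace Coeffs

variable {F : Type*} [Field F] {Φ : Coeffs F} {ρ : F}

/-- The equation of `E` is monic of degree `2` in `S`, so `1` and `S` span `F[E]` over `F[R]`. -/
theorem exists_coordRing_eq (H : Φ.IsAdmissible ρ) (κ : Φ.CoordRing ρ) : ∃ A B : Polynomial F,
    κ = Ideal.Quotient.mk _ (Polynomial.aeval (MvPolynomial.X 0) A
      + Polynomial.aeval (MvPolynomial.X 0) B * MvPolynomial.X 1) := by
  obtain ⟨p, rfl⟩ := Ideal.Quotient.mk_surjective κ
  induction p using MvPolynomial.induction_on with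
  | C c => exact ⟨Polynomial.C c, 0, by simp [MvPolynomial.algebraMap_eq]⟩
  | add p q hp hq =>
    obtain ⟨A, B, h⟩ := hp
    obtain ⟨A', B', h'⟩ := hq
    exact ⟨A + A', B + B', by
      rw [map_add, h, h', ← map_add (Ideal.Quotient.mk _)]
      congr 1
      simp only [map_add]
      ring⟩
  | mul_X p i hp =>
    obtain ⟨A, B, h⟩ := hp
    rw [map_mul, h, ← map_mul]
    fin_cases i
    · refine ⟨A * Polynomial.X, B * Polynomial.X, ?_⟩
      congr 1
      simp only [map_mul, Polynomial.aeval_X, Fin.zero_eta]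
      ring
    · refine ⟨-B * (Polynomial.C Φ.α * Polynomial.X ^ 3
        - Polynomial.C (Φ.α ^ 2 * Φ.wCoeff₁ ρ ^ 3 + Φ.wCoeff₂ ^ 3)
        - Polynomial.C (3 * Φ.α * Φ.wCoeff₁ ρ * Φ.wCoeff₂) * Polynomial.X),
        A - B * (Polynomial.C Φ.D - Polynomial.C (ρ ^ 2 * Φ.e) * Polynomial.X), ?_⟩
      rw [Ideal.Quotient.eq, Ideal.mem_span_singleton]
      refine ⟨Polynomial.aeval (MvPolynomial.X 0) B, ?_⟩
      have e := aeval_curve H.sum_eq H.α_ne H.three_ne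
        (MvPolynomial.X : Fin 2 → MvPolynomial (Fin 2) F)
      rw [MvPolynomial.aeval_X_left, AlgHom.id_apply] at e
      rw [e]
      simp only [map_sub, map_mul, map_neg, map_pow, Polynomial.aeval_X, Polynomial.aeval_C,
        Fin.mk_one]
      ring

/-- The discriminant of the equation of `E`, as a quadratic equation in `S`, is not zero. -/
theorem disc_ne_zero {L : Type*} [Field L] {α : L} (h2 : (2 : L) ≠ 0) (hα : α ≠ 0)
    (d e k l : L) :
    (Polynomial.C d - Polynomial.C e * Polynomial.X) ^ 2 - 4 * (Polynomial.C α * Polynomial.X ^ 3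
      - Polynomial.C k - Polynomial.C l * Polynomial.X) ≠ 0 := by
  intro h
  have h' : (Polynomial.C (-4 * α) * Polynomial.X ^ 3 + Polynomial.C (e ^ 2) * Polynomial.X ^ 2
      + Polynomial.C (4 * l - 2 * d * e) * Polynomial.X + Polynomial.C (d ^ 2 + 4 * k)) = 0 := by
    rw [← h]
    simp only [map_mul, map_sub, map_add, map_pow, map_neg, Polynomial.C_ofNat]
    ring
  have hc := congrArg (fun p => Polynomial.coeff p 3) h'
  simp only [Polynomial.coeff_add, Polynomial.coeff_C_mul, Polynomial.coeff_X_pow,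
    Polynomial.coeff_X, Polynomial.coeff_C, Polynomial.coeff_zero] at hc
  norm_num at hc
  have h4 : (4 : L) ≠ 0 := by convert mul_ne_zero h2 h2 using 1; norm_num
  exact hc.elim h4 hα

/-- Over every `R` both roots of the quadratic equation lie on `E`; subtracting the two conditions
gives `B(R) z = 0` with `z² = disc(R)`. Hence `B² disc` vanishes identically, and `disc` is a
nonzero polynomial. -/
theorem eq_zero_of_forall_point (H : Φ.IsAdmissible ρ) {A B : Polynomial F}
    (h : ∀ R S : AlgebraicClosure F, MvPolynomial.aeval ![R, S] (Φ.curve ρ) = 0 →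
      Polynomial.aeval R A + Polynomial.aeval R B * S = 0) : A = 0 ∧ B = 0 := by
  set L := AlgebraicClosure F
  set i := algebraMap F L
  have h2 : (2 : L) ≠ 0 := by
    rw [← map_ofNat i 2]
    exact (map_ne_zero i).2 H.two_ne
  set k := Φ.α ^ 2 * Φ.wCoeff₁ ρ ^ 3 + Φ.wCoeff₂ ^ 3
  set l := 3 * Φ.α * Φ.wCoeff₁ ρ * Φ.wCoeff₂
  set disc := (Polynomial.C (i Φ.D) - Polynomial.C (i (ρ ^ 2 * Φ.e)) * Polynomial.X) ^ 2
    - 4 * (Polynomial.C (i Φ.α) * Polynomial.X ^ 3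
      - Polynomial.C (i k) - Polynomial.C (i l) * Polynomial.X) with hdisc
  have hmap : ∀ (p : Polynomial F) (R : L), Polynomial.aeval R p = Polynomial.eval R (p.map i) :=
    fun p R => Polynomial.aeval_def R p ▸ Polynomial.eval₂_eq_eval_map i
  have key : ∀ R : L, Polynomial.eval R (B.map i ^ 2 * disc) = 0 ∧
      ∃ S, MvPolynomial.aeval ![R, S] (Φ.curve ρ) = 0 := by
    intro R
    obtain ⟨z, hz⟩ := IsAlgClosed.exists_pow_nat_eq (Polynomial.eval R disc) (n := 2) (by norm_num)
    rw [hdisc] at hz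
    simp only [Polynomial.eval_sub, Polynomial.eval_pow, Polynomial.eval_mul, Polynomial.eval_C,
      Polynomial.eval_X, Polynomial.eval_ofNat] at hz
    obtain ⟨t, ht⟩ : ∃ t : L, 2 * t = 1 := ⟨_, mul_inv_cancel₀ h2⟩
    set d := i Φ.D - i (ρ ^ 2 * Φ.e) * R
    set n := i Φ.α * R ^ 3 - i k - i l * R
    have hc : ∀ ε : L, ε ^ 2 = 1 → MvPolynomial.aeval ![R, t * (ε * z - d)] (Φ.curve ρ) = 0 := by
      intro ε hε
      rw [aeval_curve H.sum_eq H.α_ne H.three_ne]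
      simp only [Matrix.cons_val_zero, Matrix.cons_val_one]
      change d * _ + _ + n = 0
      linear_combination hz * t ^ 2 + t ^ 2 * z ^ 2 * hε
        + (t * d ^ 2 - n * (2 * t + 1) - t * ε * z * d) * ht
    have e₁ := h _ _ (hc 1 (by ring))
    have e₂ := h _ _ (hc (-1) (by ring))
    refine ⟨?_, _, hc 1 (by ring)⟩
    have e₃ : Polynomial.aeval R B * z = 0 := by
      linear_combination e₁ - e₂ - Polynomial.aeval R B * z * ht
    rw [Polynomial.eval_mul, Polynomial.eval_pow, ← hmap, hdisc]
    simp only [Polynomial.eval_sub, Polynomial.eval_pow, Polynomial.eval_mul, Polynomial.eval_C,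
      Polynomial.eval_X, Polynomial.eval_ofNat]
    rw [← hz, ← mul_pow, e₃, zero_pow two_ne_zero]
  have hB : B.map i = 0 := by
    have : B.map i ^ 2 * disc = 0 := Polynomial.funext fun R => by
      rw [(key R).1, Polynomial.eval_zero]
    exact pow_eq_zero_iff two_ne_zero |>.1 <| (mul_eq_zero.1 this).resolve_right
      (disc_ne_zero h2 (H.map_α_ne L) _ _ _ _)
  have hA : A.map i = 0 := Polynomial.funext fun R => by
    obtain ⟨S, hS⟩ := (key R).2
    have := h R S hS
    rw [hmap, hmap, hB, Polynomial.eval_zero, zero_mul, add_zero] at this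
    rw [this, Polynomial.eval_zero]
  exact ⟨(Polynomial.map_eq_zero i).1 hA, (Polynomial.map_eq_zero i).1 hB⟩

namespace IsGeneratingFrame

variable {B : Type*} [Ring B] [Algebra F B] {x y₁ y₂ w : B}
  (H : Φ.IsGeneratingFrame ρ x y₁ y₂ w)
  {K : Type*} [Field K] [Algebra F K] {C : Type*} [Ring C] [Algebra K C] [Algebra F C]
  [IsScalarTower F K C]

include H

theorem map_toCenter {R S : K} {f : B →ₐ[F] C} (hw : f w = algebraMap K C R)
    (hs : f (y₁ ^ 3) = algebraMap K C S) (p : MvPolynomial (Fin 2) F) :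
    f (H.toCenter (Ideal.Quotient.mk _ p)) = algebraMap K C (MvPolynomial.aeval ![R, S] p) := by
  have h : f.comp ((Subalgebra.center F B).val.comp (MvPolynomial.aeval ![H.wCenter, H.sCenter]))
      = (IsScalarTower.toAlgHom F K C).comp (MvPolynomial.aeval ![R, S]) := by
    refine MvPolynomial.algHom_ext fun i => ?_
    fin_cases i
    · simp only [AlgHom.comp_apply, MvPolynomial.aeval_X]
      exact hw
    · simp only [AlgHom.comp_apply, MvPolynomial.aeval_X]
      exact hs
  exact DFunLike.congr_fun h p

/-- For `c` in `I` the elements `conjSum (c * comon i)` are central and in `I`, hence in `J`. The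
dual basis expansions put `et₁²c` and `et₂²c` into `J`, and these scalars generate the unit ideal.
-/
theorem le_of_forall_center {I J : TwoSidedIdeal B}
    (h : ∀ z : Subalgebra.center F B, (z : B) ∈ I → (z : B) ∈ J) : I ≤ J := by
  obtain ⟨t₁, t₂, e, ht, he, -, h₁, h₂⟩ := H.exists_center_data
  intro c hc
  have step : ∀ {y : B} {η : F}, IsSymbolPair η x y → (∀ c, ∃ z : Subalgebra.center F B,
      conjSum x y c = z) → (9 : F) • ((y ^ 3 * x ^ 3) ^ 2 * c) ∈ J := by
    intro y η hp hz
    have hmem : ∑ i, conjSum x y (c * comon x y i) * mon x y i ∈ J := by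
      refine sum_mem fun i _ => J.mul_mem_right _ _ ?_
      obtain ⟨z, hz⟩ := hz (c * comon x y i)
      rw [hz]
      exact h z (hz ▸ conjSum_mem (I.mul_mem_right _ _ hc))
    rwa [hp.sum_conjSum_mul_comon] at hmem
  have s₁ := step H.isSymbolPair₁ fun c => by
    obtain ⟨κ, hκ, -⟩ := H.exists_conjSum c
    exact ⟨_, hκ⟩
  have s₂ := step H.isSymbolPair₂ fun c => by
    obtain ⟨κ, -, hκ⟩ := H.exists_conjSum c
    exact ⟨_, hκ⟩
  rw [h₁] at s₁
  rw [h₂] at s₂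
  obtain ⟨a, b, hab⟩ := (ht.pow (m := 2) (n := 2))
  obtain ⟨u, rfl⟩ := he
  have hu : (↑u⁻¹ * a * (u * t₁ ^ 2) + ↑u⁻¹ * b * (u * t₂ ^ 2) : Subring.center B) = 1 := by
    rw [← hab]
    linear_combination (a * t₁ ^ 2 + b * t₂ ^ 2) * u.inv_mul
  have := J.add_mem (J.mul_mem_left (↑(↑u⁻¹ * a : Subring.center B) : B) _ s₁)
    (J.mul_mem_left (↑(↑u⁻¹ * b : Subring.center B) : B) _ s₂)
  have e : c = (↑(↑u⁻¹ * a : Subring.center B) : B) * ((u * t₁ ^ 2 : Subring.center B) • c)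
      + (↑(↑u⁻¹ * b : Subring.center B) : B) * ((u * t₂ ^ 2 : Subring.center B) • c) := by
    rw [← smul_eq_mul, ← smul_eq_mul]
    change c = (↑u⁻¹ * a : Subring.center B) • _ + (↑u⁻¹ * b : Subring.center B) • _
    rw [smul_smul, smul_smul, ← add_smul, hu, one_smul]
  rwa [← e] at this

theorem center_eq_adjoin : Subalgebra.center F B = Algebra.adjoin F {y₁ ^ 3, w} := by
  refine le_antisymm (fun z hz => ?_) (Algebra.adjoin_le ?_)
  · obtain ⟨κ, hκ⟩ := H.toCenter_surjective ⟨z, hz⟩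
    obtain ⟨p, rfl⟩ := Ideal.Quotient.mk_surjective κ
    have hz : z = ((Subalgebra.center F B).val.comp
      (MvPolynomial.aeval ![H.wCenter, H.sCenter])) p := (congrArg Subtype.val hκ).symm
    rw [hz]
    clear hz hκ
    induction p using MvPolynomial.induction_on with
    | C c =>
      rw [← MvPolynomial.algebraMap_eq, AlgHom.commutes]
      exact Subalgebra.algebraMap_mem _ c
    | add p q hp hq =>
      rw [map_add]
      exact add_mem hp hq
    | mul_X p i hp =>
      rw [map_mul]
      refine mul_mem hp (Algebra.subset_adjoin ?_)
      fin_cases i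
      · right
        simp [wCenter]
      · left
        simp [sCenter]
  · rintro _ (rfl | rfl)
    · exact H.sCenter.2
    · exact H.wCenter.2

end IsGeneratingFrame

namespace IsAdmissible

variable (H : Φ.IsAdmissible ρ)

include H

/-- An element of the kernel is sent to zero in the nontrivial symbol algebra at each point, so it
vanishes at all points of `E` over the algebraic closure. -/
theorem toCenter_bijective : Function.Bijective H.isGeneratingFrame.toCenter := by
  refine ⟨(injective_iff_map_eq_zero _).2 fun κ hκ => ?_, H.isGeneratingFrame.toCenter_surjective⟩
  obtain ⟨A, B, rfl⟩ := exists_coordRing_eq H κ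
  obtain ⟨rfl, rfl⟩ : A = 0 ∧ B = 0 := by
    refine eq_zero_of_forall_point H fun R S hP => ?_
    obtain ⟨a, b, hab⟩ := Φ.exists_isSymbolParam ρ R S
    obtain ⟨f, hw, hs, -⟩ := H.exists_algHom_symbol hP hab
    have := nontrivial_symbol (a := a) (b := b) (H.map_sum_eq (AlgebraicClosure F))
    have h := H.isGeneratingFrame.map_toCenter hw hs (Polynomial.aeval (MvPolynomial.X 0) A
      + Polynomial.aeval (MvPolynomial.X 0) B * MvPolynomial.X 1)
    rw [hκ, ZeroMemClass.coe_zero, map_zero, eq_comm,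
      FaithfulSMul.algebraMap_eq_zero_iff] at h
    simpa [← Polynomial.aeval_algHom_apply] using h
  simp

theorem center_isCoordRing :
    Subalgebra.center F Φ.Alg = Algebra.adjoin F {Φ.yComp ρ 1 ^ 3, Φ.w ρ} ∧
      ∃ φ : Φ.CoordRing ρ ≃ₐ[F] Subalgebra.center F Φ.Alg,
        (φ (Φ.coord ρ 0) : Φ.Alg) = Φ.w ρ ∧ (φ (Φ.coord ρ 1) : Φ.Alg) = Φ.yComp ρ 1 ^ 3 :=
  ⟨H.isGeneratingFrame.center_eq_adjoin, AlgEquiv.ofBijective _ H.toCenter_bijective,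
    congrArg Subtype.val H.isGeneratingFrame.toCenter_coord_zero,
    congrArg Subtype.val H.isGeneratingFrame.toCenter_coord_one⟩

end IsAdmissible

end Coeffs

end CubicClifford

/-! ### Simple images and Galois orbits of points -/

namespace CubicClifford

/-- A surjective algebra homomorphism identifies its target with the quotient by its kernel. -/
noncomputable def quotientKerAlgEquiv {R A B : Type*} [CommRing R] [Ring A] [Ring B] [Algebra R A]
    [Algebra R B] (f : A →ₐ[R] B) (hf : Function.Surjective f) :
    (TwoSidedIdeal.ker f).ringCon.Quotient ≃ₐ[R] B :=
  AlgEquiv.ofBijective (RingCon.liftₐ (TwoSidedIdeal.ker f).ringCon f fun _ _ h => h) <| by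
    refine ⟨fun a b h => ?_, fun b => ?_⟩
    · obtain ⟨a, rfl⟩ := RingCon.mk'_surjective _ a
      obtain ⟨b, rfl⟩ := RingCon.mk'_surjective _ b
      exact (RingCon.eq _).2 h
    · obtain ⟨a, rfl⟩ := hf b
      exact ⟨(TwoSidedIdeal.ker f).ringCon.mk' a, rfl⟩

/-- A homomorphism from a simple ring to a nontrivial ring is injective. -/
theorem le_of_isSimpleRing_quotient {A : Type*} [Ring A] {I J : TwoSidedIdeal A}
    (hI : IsSimpleRing I.ringCon.Quotient) (hJ : Nontrivial J.ringCon.Quotient) (h : I ≤ J) :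
    J ≤ I := by
  have hle : I.ringCon ≤ J.ringCon := fun a b hab => by
    rw [TwoSidedIdeal.rel_iff] at hab ⊢
    exact h hab
  have hinj := (RingCon.map _ _ hle).injective
  intro c hc
  rw [TwoSidedIdeal.mem_iff] at hc ⊢
  exact (RingCon.eq _).1 (hinj ((RingCon.eq _).2 hc : (c : J.ringCon.Quotient) = (0 : A)))

/-- Points with the same vanishing ideal `𝔭` give two embeddings of the domain `F[X]/𝔭`. As `L` is
algebraic over it and `M` is algebraically closed, the second embedding extends to `L`. -/
theorem exists_algHom_of_aeval_eq_zero_iff {F L M ι : Type*} [Field F] [Field L] [Field M]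
    [Algebra F L] [Algebra F M] [Algebra.IsAlgebraic F L] [IsAlgClosed M] {P : ι → L} {Q : ι → M}
    (h : ∀ p : MvPolynomial ι F, MvPolynomial.aeval P p = 0 ↔ MvPolynomial.aeval Q p = 0) :
    ∃ σ : L →ₐ[F] M, ∀ i, σ (P i) = Q i := by
  let 𝔭 := RingHom.ker (MvPolynomial.aeval P : MvPolynomial ι F →ₐ[F] L)
  let f : MvPolynomial ι F ⧸ 𝔭 →ₐ[F] L := Ideal.Quotient.liftₐ 𝔭 (MvPolynomial.aeval P) fun _ h => h
  let g : MvPolynomial ι F ⧸ 𝔭 →ₐ[F] M :=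
    Ideal.Quotient.liftₐ 𝔭 (MvPolynomial.aeval Q) fun p hp => (h p).1 hp
  have hf : Function.Injective f := (injective_iff_map_eq_zero f).2 fun a ha => by
    obtain ⟨p, rfl⟩ := Ideal.Quotient.mk_surjective a
    exact Ideal.Quotient.eq_zero_iff_mem.2 ha
  have hg : Function.Injective g := (injective_iff_map_eq_zero g).2 fun a ha => by
    obtain ⟨p, rfl⟩ := Ideal.Quotient.mk_surjective a
    exact Ideal.Quotient.eq_zero_iff_mem.2 ((h p).2 ha)
  have : 𝔭.IsPrime := RingHom.ker_isPrime _
  let := f.toRingHom.toAlgebra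
  let := g.toRingHom.toAlgebra
  have : IsScalarTower F (MvPolynomial ι F ⧸ 𝔭) L :=
    IsScalarTower.of_algebraMap_eq fun r => (f.commutes r).symm
  have : IsScalarTower F (MvPolynomial ι F ⧸ 𝔭) M :=
    IsScalarTower.of_algebraMap_eq fun r => (g.commutes r).symm
  have : FaithfulSMul (MvPolynomial ι F ⧸ 𝔭) L := (faithfulSMul_iff_algebraMap_injective _ _).2 hf
  have : FaithfulSMul (MvPolynomial ι F ⧸ 𝔭) M := (faithfulSMul_iff_algebraMap_injective _ _).2 hg
  have : Algebra.IsAlgebraic (MvPolynomial ι F ⧸ 𝔭) L := 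
    Algebra.IsAlgebraic.extendScalars (R := F) ((algebraMap F (MvPolynomial ι F ⧸ 𝔭)).injective)
  let σ : L →ₐ[MvPolynomial ι F ⧸ 𝔭] M := IsAlgClosed.lift
  refine ⟨σ.restrictScalars F, fun i => ?_⟩
  have := σ.commutes (Ideal.Quotient.mk 𝔭 (MvPolynomial.X i))
  change σ (MvPolynomial.aeval P (MvPolynomial.X i)) = MvPolynomial.aeval Q (MvPolynomial.X i)
    at this
  rwa [MvPolynomial.aeval_X, MvPolynomial.aeval_X] at this

theorem exists_forall_aeval_eq_zero {F L ι : Type*} [Field F] [Field L] [Algebra F L]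
    [IsAlgClosed L] [Finite ι] {J : Ideal (MvPolynomial ι F)} (hJ : J ≠ ⊤) :
    ∃ P : ι → L, ∀ p ∈ J, MvPolynomial.aeval P p = 0 := by
  obtain ⟨𝔪, h𝔪, hle⟩ := J.exists_le_maximal hJ
  let := Ideal.Quotient.field 𝔪
  have : Module.Finite F (MvPolynomial ι F ⧸ 𝔪) := finite_of_finite_type_of_isJacobsonRing _ _
  let σ : MvPolynomial ι F ⧸ 𝔪 →ₐ[F] L := IsAlgClosed.lift
  refine ⟨fun i => σ (Ideal.Quotient.mk 𝔪 (MvPolynomial.X i)), fun p hp => ?_⟩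
  have h : MvPolynomial.aeval (fun i => σ (Ideal.Quotient.mk 𝔪 (MvPolynomial.X i)))
      = σ.comp (Ideal.Quotient.mkₐ F 𝔪) := MvPolynomial.algHom_ext fun i => by simp
  rw [h, AlgHom.comp_apply, Ideal.Quotient.mkₐ_eq_mk, Ideal.Quotient.eq_zero_iff_mem.2 (hle hp),
    map_zero]

namespace Coeffs

variable {F : Type*} [Field F] {Φ : Coeffs F} {ρ : F}

theorem aeval_pointCoord (P : Φ.Point ρ) (p : MvPolynomial (Fin 2) F) :
    (MvPolynomial.aeval ![Φ.pointCoord ρ P 0, Φ.pointCoord ρ P 1] p : AlgebraicClosure F)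
      = MvPolynomial.aeval P.1 p := by
  have h : (Φ.pointField ρ P).val.comp
      (MvPolynomial.aeval ![Φ.pointCoord ρ P 0, Φ.pointCoord ρ P 1]) = MvPolynomial.aeval P.1 := by
    refine MvPolynomial.algHom_ext fun i => ?_
    fin_cases i <;> simp [pointCoord]
  exact DFunLike.congr_fun h p

theorem aeval_pointCoord_curve (P : Φ.Point ρ) :
    MvPolynomial.aeval ![Φ.pointCoord ρ P 0, Φ.pointCoord ρ P 1] (Φ.curve ρ) = 0 :=
  Subtype.ext ((aeval_pointCoord P _).trans P.2)

theorem map_pointField_le {P : Φ.Point ρ} {C : Type*} [Ring C] [Algebra F C]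
    (g : Φ.pointField ρ P →ₐ[F] C) {M : Subalgebra F C} (h : ∀ i, g (Φ.pointCoord ρ P i) ∈ M)
    (z : Φ.pointField ρ P) : g z ∈ M := by
  have hz : (z : AlgebraicClosure F) ∈ Algebra.adjoin F (Set.range P.1) := by
    rw [← IntermediateField.adjoin_toSubalgebra]
    exact z.2
  have hle : Algebra.adjoin F (Set.range P.1) ≤ (M.comap g).map (Φ.pointField ρ P).val := by
    rw [Algebra.adjoin_le_iff]
    rintro _ ⟨i, rfl⟩
    exact ⟨Φ.pointCoord ρ P i, h i, rfl⟩
  obtain ⟨z', hz', e⟩ := hle hz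
  obtain rfl : z' = z := Subtype.ext e
  exact hz'

/-- The polynomials that map into `I` form a proper ideal, which has a zero by the Nullstellensatz;
the zero lies on `E` because that ideal contains the equation. -/
theorem IsGeneratingFrame.exists_point_le {B : Type*} [Ring B] [Algebra F B] {x y₁ y₂ w : B}
    (H : Φ.IsGeneratingFrame ρ x y₁ y₂ w) (I : TwoSidedIdeal B) [Nontrivial I.ringCon.Quotient] :
    ∃ P : Φ.Point ρ, ∀ p, (H.toCenter (Ideal.Quotient.mk _ p) : B) ∈ I →
      MvPolynomial.aeval P.1 p = 0 := by
  let f : MvPolynomial (Fin 2) F →+* I.ringCon.Quotient :=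
    (I.ringCon.mk'.comp ((Subalgebra.center F B).val.comp H.toCenter).toRingHom).comp
      (Ideal.Quotient.mk _)
  have hf : ∀ p, (H.toCenter (Ideal.Quotient.mk _ p) : B) ∈ I → p ∈ RingHom.ker f := fun p hp => by
    rw [TwoSidedIdeal.mem_iff] at hp
    exact (RingCon.eq _).2 hp
  obtain ⟨P, hP⟩ := exists_forall_aeval_eq_zero (L := AlgebraicClosure F) (RingHom.ker_ne_top f)
  refine ⟨⟨P, hP _ (hf _ ?_)⟩, fun p hp => hP p (hf p hp)⟩
  rw [Ideal.Quotient.eq_zero_iff_mem.2 (Ideal.mem_span_singleton_self _), map_zero]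
  exact zero_mem I

namespace IsAdmissible

variable (H : Φ.IsAdmissible ρ)

include H

theorem exists_surjective_algHom (P : Φ.Point ρ) {a b : Φ.pointField ρ P}
    (hab : Φ.IsSymbolParam ρ (Φ.pointCoord ρ P 0) (Φ.pointCoord ρ P 1) a b) :
    ∃ f : Φ.Alg →ₐ[F] SymbolAlgebra (Φ.pointField ρ P) 3 (algebraMap F _ ρ) a b,
      Function.Surjective f ∧ f (Φ.w ρ) = algebraMap _ _ (Φ.pointCoord ρ P 0) ∧
      f (Φ.yComp ρ 1 ^ 3) = algebraMap _ _ (Φ.pointCoord ρ P 1) ∧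
      ∀ p, (H.isGeneratingFrame.toCenter (Ideal.Quotient.mk _ p) : Φ.Alg) ∈ TwoSidedIdeal.ker f ↔
        MvPolynomial.aeval P.1 p = 0 := by
  obtain ⟨f, hw, hs, hu, hv⟩ := H.exists_algHom_symbol (aeval_pointCoord_curve P) hab
  have := nontrivial_symbol (a := a) (b := b) (H.map_sum_eq (Φ.pointField ρ P))
  refine ⟨f, ?_, hw, hs, fun p => ?_⟩
  · have hK : ∀ z, algebraMap (Φ.pointField ρ P)
        (SymbolAlgebra (Φ.pointField ρ P) 3 (algebraMap F _ ρ) a b) z ∈ f.range :=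
      map_pointField_le (IsScalarTower.toAlgHom F (Φ.pointField ρ P)
        (SymbolAlgebra (Φ.pointField ρ P) 3 (algebraMap F _ ρ) a b)) fun i => by
      fin_cases i
      · exact ⟨_, hw⟩
      · exact ⟨_, hs⟩
    intro c
    have hc : c ∈ Algebra.adjoin (Φ.pointField ρ P) {symbolU (algebraMap F _ ρ) a b,
      symbolV (algebraMap F _ ρ) a b} := by
      rw [adjoin_symbol]
      exact Algebra.mem_top
    change c ∈ f.range
    induction hc using Algebra.adjoin_induction with
    | mem c hc =>
      rcases hc with rfl | rfl
      · exact hu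
      · exact hv
    | algebraMap z => exact hK z
    | add c d _ _ hc hd => exact add_mem hc hd
    | mul c d _ _ hc hd => exact mul_mem hc hd
  · rw [TwoSidedIdeal.mem_ker, H.isGeneratingFrame.map_toCenter hw hs,
      FaithfulSMul.algebraMap_eq_zero_iff, ← aeval_pointCoord, ZeroMemClass.coe_eq_zero]

/-- `I` is the kernel at the point `P`. -/
def IsKernelAt (P : Φ.Point ρ) (I : TwoSidedIdeal Φ.Alg) : Prop :=
  ∀ p, (H.isGeneratingFrame.toCenter (Ideal.Quotient.mk _ p) : Φ.Alg) ∈ I ↔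
    MvPolynomial.aeval P.1 p = 0

theorem le_of_isKernelAt {P : Φ.Point ρ} {I J : TwoSidedIdeal Φ.Alg}
    (hI : ∀ p, (H.isGeneratingFrame.toCenter (Ideal.Quotient.mk _ p) : Φ.Alg) ∈ I →
      MvPolynomial.aeval P.1 p = 0) (hJ : H.IsKernelAt P J) : I ≤ J := by
  refine H.isGeneratingFrame.le_of_forall_center fun z hz => ?_
  obtain ⟨κ, rfl⟩ := H.isGeneratingFrame.toCenter_surjective z
  obtain ⟨p, rfl⟩ := Ideal.Quotient.mk_surjective κ
  exact (hJ p).2 (hI p hz)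

theorem eq_of_isKernelAt {P : Φ.Point ρ} {I J : TwoSidedIdeal Φ.Alg} (hI : H.IsKernelAt P I)
    (hJ : H.IsKernelAt P J) : I = J :=
  le_antisymm (H.le_of_isKernelAt (fun p => (hI p).1) hJ)
    (H.le_of_isKernelAt (fun p => (hJ p).1) hI)

theorem exists_isKernelAt (P : Φ.Point ρ) : ∃ I : SimpleImage Φ.Alg, H.IsKernelAt P I.1 := by
  obtain ⟨a, b, hab⟩ := Φ.exists_isSymbolParam ρ (Φ.pointCoord ρ P 0) (Φ.pointCoord ρ P 1)
  obtain ⟨f, hf, -, -, hk⟩ := H.exists_surjective_algHom P hab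
  have hs := (H.isCentralSimpleOfDegree_symbol (aeval_pointCoord_curve P) hab).2.1
  exact ⟨⟨TwoSidedIdeal.ker f,
    hs.of_ringEquiv (quotientKerAlgEquiv f hf).symm.toRingEquiv⟩, hk⟩

theorem imageIsSymbol {P : Φ.Point ρ} {I : SimpleImage Φ.Alg} (hI : H.IsKernelAt P I.1)
    {a b : Φ.pointField ρ P}
    (hab : Φ.IsSymbolParam ρ (Φ.pointCoord ρ P 0) (Φ.pointCoord ρ P 1) a b) :
    Φ.ImageIsSymbol ρ P I a b := by
  refine ⟨H.isCentralSimpleOfDegree_symbol (aeval_pointCoord_curve P) hab, ?_⟩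
  obtain ⟨f, hf, hw, hs, hk⟩ := H.exists_surjective_algHom P hab
  obtain ⟨I, hI'⟩ := I
  obtain rfl : TwoSidedIdeal.ker f = I := H.eq_of_isKernelAt hk hI
  exact ⟨quotientKerAlgEquiv f hf, hw, hs⟩

theorem isKernelAt_smul {P : Φ.Point ρ} {I : TwoSidedIdeal Φ.Alg} (hI : H.IsKernelAt P I)
    (σ : Gal(AlgebraicClosure F/F)) : H.IsKernelAt (σ • P) I := by
  intro p
  have h : MvPolynomial.aeval (σ • P).1
      = (σ : AlgebraicClosure F →ₐ[F] AlgebraicClosure F).comp (MvPolynomial.aeval P.1) := by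
    refine MvPolynomial.algHom_ext fun i => ?_
    simp only [AlgHom.comp_apply, MvPolynomial.aeval_X]
    rfl
  rw [hI p, h, AlgHom.comp_apply, AlgEquiv.coe_toAlgHom, map_eq_zero_iff σ σ.injective]

theorem exists_smul_eq {P Q : Φ.Point ρ} {I : TwoSidedIdeal Φ.Alg} (hP : H.IsKernelAt P I)
    (hQ : H.IsKernelAt Q I) : ∃ σ : Gal(AlgebraicClosure F/F), σ • Q = P := by
  obtain ⟨σ, hσ⟩ := exists_algHom_of_aeval_eq_zero_iff fun p => (hQ p).symm.trans (hP p)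
  exact ⟨AlgEquiv.ofBijective σ (Algebra.IsAlgebraic.algHom_bijective σ),
    Subtype.ext (funext hσ)⟩

/-- The Nullstellensatz gives only `I ≤ J` for the kernel `J` at some point; simplicity of the
quotient by `I` makes this an equality. -/
theorem exists_point_isKernelAt (I : SimpleImage Φ.Alg) : ∃ P : Φ.Point ρ, H.IsKernelAt P I.1 := by
  have hI : IsSimpleRing I.1.ringCon.Quotient := I.2
  have hIn : Nontrivial I.1.ringCon.Quotient := hI.instNontrivial
  obtain ⟨P, hP⟩ := H.isGeneratingFrame.exists_point_le I.1
  obtain ⟨J, hJ⟩ := H.exists_isKernelAt P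
  have hJs : IsSimpleRing J.1.ringCon.Quotient := J.2
  have hJn : Nontrivial J.1.ringCon.Quotient := hJs.instNontrivial
  have hle : I.1 ≤ J.1 := H.le_of_isKernelAt hP hJ
  have heq : I.1 = J.1 := le_antisymm hle (le_of_isSimpleRing_quotient hI hJn hle)
  refine ⟨P, ?_⟩
  rw [heq]
  exact hJ

theorem exists_equiv_simpleImage :
    ∃ Ψ : MulAction.orbitRel.Quotient Gal(AlgebraicClosure F/F) (Φ.Point ρ) ≃ SimpleImage Φ.Alg,
      ∀ P : Φ.Point ρ, H.IsKernelAt P (Ψ (Quotient.mk'' P)).1 := by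
  choose I hI using H.exists_isKernelAt
  have heq : ∀ P Q, I P = I Q ↔ MulAction.orbitRel Gal(AlgebraicClosure F/F) (Φ.Point ρ) P Q := by
    intro P Q
    rw [MulAction.orbitRel_apply]
    constructor
    · intro h
      obtain ⟨σ, hσ⟩ := H.exists_smul_eq (hI P) (h ▸ hI Q)
      exact ⟨σ, hσ⟩
    · rintro ⟨σ, rfl⟩
      exact Subtype.ext (H.eq_of_isKernelAt (hI _) (H.isKernelAt_smul (hI Q) σ))
  refine ⟨Equiv.ofBijective (Quotient.lift I fun P Q h => (heq P Q).2 h) ⟨?_, ?_⟩, hI⟩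
  · rintro ⟨P⟩ ⟨Q⟩ h
    exact Quotient.sound ((heq P Q).1 h)
  · intro J
    obtain ⟨P, hP⟩ := H.exists_point_isKernelAt J
    exact ⟨Quotient.mk'' P, Subtype.ext (H.eq_of_isKernelAt (hI P) hP)⟩

end IsAdmissible

end Coeffs

end CubicClifford

namespace CubicClifford

namespace Coeffs

variable {F : Type*} [Field F] {Φ : Coeffs F} {ρ : F}

theorem isSymbolParam_of_ne_zero (P : Φ.Point ρ) (h : P.1 1 ≠ 0) :
    Φ.IsSymbolParam ρ (Φ.pointCoord ρ P 0) (Φ.pointCoord ρ P 1) (algebraMap F _ Φ.α)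
      (Φ.pointCoord ρ P 1) :=
  Or.inl ⟨fun h0 => h (congrArg Subtype.val h0), rfl, rfl⟩

theorem isSymbolParam_of_eq_zero (P : Φ.Point ρ) (h : P.1 1 = 0) :
    Φ.IsSymbolParam ρ (Φ.pointCoord ρ P 0) (Φ.pointCoord ρ P 1)
      (algebraMap F _ (ρ ^ 2 * Φ.e) * Φ.pointCoord ρ P 0 - algebraMap F _ Φ.D)
      (algebraMap F _ Φ.α) :=
  Or.inr ⟨Subtype.ext h, rfl, rfl⟩

end Coeffs

end CubicClifford
theorem mainTheorem5 {F : Type*} [Field F] (h2 : ringChar F ≠ 2) (h3 : ringChar F ≠ 3)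
    (ρ : F) (hρ : IsPrimitiveRoot ρ 3) (Φ : CubicClifford.Coeffs F)
    (hΔ : (Φ.weierstrass ρ).Δ ≠ 0) (hD : Φ.D ≠ 0)
    (hα : IsField (AdjoinRoot (Polynomial.X ^ 3 - Polynomial.C Φ.α))) :
    (IsAzumaya (Subring.center Φ.Alg) Φ.Alg ∧
      ∀ p : PrimeSpectrum (Subring.center Φ.Alg), Module.rankAtStalk Φ.Alg p = 9) ∧
    (Subalgebra.center F Φ.Alg = Algebra.adjoin F {Φ.yComp ρ 1 ^ 3, Φ.w ρ} ∧
      ∃ φ : Φ.CoordRing ρ ≃ₐ[F] Subalgebra.center F Φ.Alg,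
        (φ (Φ.coord ρ 0) : Φ.Alg) = Φ.w ρ ∧ (φ (Φ.coord ρ 1) : Φ.Alg) = Φ.yComp ρ 1 ^ 3) ∧
    ∃ Ψ : MulAction.orbitRel.Quotient Gal(AlgebraicClosure F/F) (Φ.Point ρ) ≃
        CubicClifford.SimpleImage Φ.Alg,
      ∀ P : Φ.Point ρ,
        (P.1 1 ≠ 0 → Φ.ImageIsSymbol ρ P (Ψ (Quotient.mk'' P))
          (algebraMap F _ Φ.α) (Φ.pointCoord ρ P 1)) ∧
        (P.1 1 = 0 → Φ.ImageIsSymbol ρ P (Ψ (Quotient.mk'' P))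
          (algebraMap F _ (ρ ^ 2 * Φ.e) * Φ.pointCoord ρ P 0 - algebraMap F _ Φ.D)
          (algebraMap F _ Φ.α)) := by
  have H : Φ.IsAdmissible ρ :=
    { sum_eq := CubicClifford.IsPrimitiveRoot.sq_add_self_add_one hρ
      two_ne := Ring.two_ne_zero h2
      three_ne := CubicClifford.IsPrimitiveRoot.three_ne_zero hρ
      isField := hα
      D_ne := hD }
  obtain ⟨Ψ, hΨ⟩ := H.exists_equiv_simpleImage
  exact ⟨H.isGeneratingFrame.isAzumaya_and_rankAtStalk, H.center_isCoordRing, Ψ, fun P =>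
    ⟨fun h => H.imageIsSymbol (hΨ P) (CubicClifford.Coeffs.isSymbolParam_of_ne_zero P h),
      fun h => H.imageIsSymbol (hΨ P) (CubicClifford.Coeffs.isSymbolParam_of_eq_zero P h)⟩⟩
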